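/- **Setting.** Let $X=(VX,EX)$ be an infinite connected simple graph of bounded degree. All subgraphs are full (induced) subgraphs. For a subgraph $K$, $|K|$ is its number of vertices, and its frontier $\mathcal F(K)$ is the set of vertices of $K$ adjacent to a vertex outside $K$. Assume that $X$ is *self-similar*: there are an increasing sequence of finite subgraphs $K_n$ $(n\in\mathbb N)$ with union $X$ and $|\mathcal F(K_n)|/|K_n|\to0$, and, for every $n$, a finite set $\mathcal G(n,n+1)$ of graph isomorphisms $\gamma$ from $K_n$ onto subgraphs $\gamma K_n$ of $X$, such that $\bigcup_\gamma\gamma K_n=K_{n+1}$ (vertices and edges); $V(\gamma K_n)\cap V(\gamma'K_n)=\mathcal F(\gamma K_n)\cap\mathcal F(\gamma'K_n)$ for $\gamma\ne\gamma'$; and, with $\mathcal G(n,m)$ the set of all products $\gamma_{m-1}\cdots\gamma_n$, $\gamma_i\in\mathcal G(i,i+1)$ (and $\mathcal G(n,n)=\{\mathrm{id}_{K_n}\}$), $\mathcal G(n)=\bigcup_{m\ge n}\mathcal G(n,m)$ and $\mathcal F_{\mathcal G}(K_n)=\bigcup_{\gamma\in\mathcal G(n)}\gamma^{-1}\mathcal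 F(\gamma K_n)$, also $|\mathcal F_{\mathcal G}(K_n)|/|K_n|\to0$. Assume that $X$ is *essentially $(q+1)$-regular*: $\deg(v)=q+1$ for all but finitely many vertices $v$. On $\ell^2(VX)$ let $A$ be the adjacency operator, $(Af)(x)=\sum_{y\sim x}f(y)$, and $P$ the transition operator of the simple random walk, $(Pf)(x)=\deg(x)^{-1}\sum_{y\sim x}f(y)$. Put $$\mathrm{Tr}_{\mathcal G}(T)=\lim_n \frac1{|K_n|}\sum_{v\in K_n}\langle T\delta_v,\delta_v\rangle ,\qquad \chi_{av}(X)=\lim_n\frac{|VK_n|-|EK_n|}{|K_n|}.$$ If $0$ is not in the convex hull of the spectrum of $T$, put $\det_{\mathcal G}(T)=\exp\mathrm{Tr}_{\mathcal G}\bigl(\frac1{2\pi i}\oint_\Gamma\log\lambda\,(\lambda-T)^{-1}d\lambda\bigr)$, where $\Gamma$ is the boundary of a disc that contains the spectrum of $T$ and whose closure omits $0$, and $\log$ is any branch of the logarithm on the closed disc. A closed path $(v_0,\dots,v_m=v_0)$, $m\ge1$, is *reduced* if it has no backtracking ($v_{i-1}\neq v_{i+1}$ for $1\le i\le m-1$)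 and no tail (there is no $1\le k\le[m/2]-1$ with $v_j=v_{m-j}$ for $1\le j\le k$), and *primitive* if it does not go $n\geq2$ times around another closed path. A *prime cycle* $C$, of length $|C|=m$, is a primitive reduced closed path up to the choice of its origin. Let $\sim_{\mathcal G}$ be the equivalence relation on prime cycles generated by $C\sim\gamma(C)$ for $C\subset K_n$, $\gamma\in\mathcal G(n)$, and let $\mu(C)$ be the average multiplicity of $C$ and $Z$ the zeta function: $$\mu(C)=\lim_n\frac{|\{D\subset K_n: D\text{ a prime cycle},\ D\sim_{\mathcal G}C\}|}{|K_n|},\qquad Z(u)=\prod_{[C]_{\mathcal G}}(1-u^{|C|})^{-\mu(C)}$$ (product over $\mathcal G$-classes of prime cycles, principal powers). Put $$\Omega=\mathbb C\setminus\bigl(\{|u|^2=\tfrac1q\}\cup\{u\in\mathbb R:\tfrac1q\le|u|\le1\}\bigr),\quad \Omega'=\mathbb C\setminus\bigl(\{|u|^2=\tfrac1q,\ \mathrm{Im}\,u\le0\}\cup\{u\in\mathbb R:\tfrac1q\le|u|\le1\}\bigr).$$ **Proposition.** The limits $\chi_{av}(X)$, $\mu(C)$ (for every prime cycle $C$) and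 $\mathrm{Tr}_{\mathcal G}(P^k)$ ($k\ge0$) exist. Moreover: (0) Suppose that for every $n$ the inclusion $K_n\subset K_{n+1}$ belongs to $\mathcal G(n,n+1)$ and $\gamma K_n\cap\gamma'K_n$ contains no reduced closed path for $\gamma\neq\gamma'$ in $\mathcal G(n,n+1)$. Then $\mu(C)=\lim_n|\mathcal G(s(C),n)|/|K_n|$ for every prime cycle $C$, where the size $s(C)$ is the least $m$ such that $C\subset\gamma(K_m)$ for some $\gamma\in\mathcal G(m)$. (i) $\chi_{av}(X)=\frac{1-q}2$. For $|u|<\frac1q$ the product $Z(u)$ converges unconditionally, both determinants below are defined (the traces of the logarithms exist, and the values do not depend on the disc or the branch), and $$Z(u)=(1-u^2)^{(1-q)/2}\det{}_{\mathcal G}((1+qu^2)I-uA)^{-1}=(1-u^2)^{(1-q)/2}\det{}_{\mathcal G}((1+qu^2)I-(q+1)uP)^{-1}.$$ (ii) $\det_{\mathcal G}((1+qu^2)I-uA)$ is defined for all $u\in\Omega$, the function $(1-u^2)^{(1-q)/2}$ (principal power for $|u|<\frac1q$) extends to a holomorphic function $w$ on $\Omega'\supset\Omega$, and $w(u)\det_{\mathcal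 G}((1+qu^2)I-uA)^{-1}$ is holomorphic without zeros on $\Omega$ and equal to $Z(u)$ for $|u|<\frac1q$. (iii) Let $\log Z$ be the holomorphic logarithm of $Z$ on $\{|u|<\frac1q\}$ with $\log Z(0)=0$ (it exists). For $|u|<\frac1q$, $$\log Z(u)=\frac{1-q}2\log(1-u^2)+\sum_{m=0}^\infty u^m\sum_{n=1}^{m}\frac1n\sum_{\substack{0\le k\le n\\ 2n-k=m}}\binom nk(q+1)^k(-q)^{n-k}\,\mathrm{Tr}_{\mathcal G}(P^k),$$ and for $(q+1)|u|+q|u|^2<1$ also $$\log Z(u)=\frac{1-q}2\log(1-u^2)+\sum_{n=1}^\infty\frac1n\sum_{k=0}^n\binom nk(q+1)^k(-q)^{n-k}u^{2n-k}\,\mathrm{Tr}_{\mathcal G}(P^k),$$ both series converging absolutely. -/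

import Mathlib

open Filter Topology

/-! ### Operators on `ℓ²(VX)` -/

/-- The complex Hilbert space `ℓ²(VX)`. -/
noncomputable abbrev VertexSpace (V : Type*) := lp (fun _ : V => ℂ) 2

section Operators

theorem weightedAdj_sum_le {V : Type*} (X : SimpleGraph V) [X.LocallyFinite] {d : ℕ}
    (hd : ∀ v, X.degree v ≤ d) (c : V → ℂ) (hc : ∀ v, ‖c v‖ ≤ 1) (f : VertexSpace V)
    (s : Finset V) :
    ∑ x ∈ s, ‖c x * ∑ y ∈ X.neighborFinset x, f y‖ ^ (2 : ENNReal).toReal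
      ≤ ((d : ℝ) * ‖f‖) ^ (2 : ENNReal).toReal := by
  classical
  have h2 : (2 : ENNReal).toReal = ((2 : ℕ) : ℝ) := by norm_num
  simp only [h2, Real.rpow_natCast]
  have h1 : ∀ x, ‖c x * ∑ y ∈ X.neighborFinset x, f y‖ ^ 2
      ≤ (d : ℝ) * ∑ y ∈ X.neighborFinset x, ‖f y‖ ^ 2 := by
    intro x
    have e1 : ‖c x * ∑ y ∈ X.neighborFinset x, f y‖ ≤ ∑ y ∈ X.neighborFinset x, ‖f y‖ := by
      rw [norm_mul]
      calc ‖c x‖ * ‖∑ y ∈ X.neighborFinset x, f y‖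
          ≤ 1 * ‖∑ y ∈ X.neighborFinset x, f y‖ := by gcongr; exact hc x
        _ ≤ _ := by rw [one_mul]; exact norm_sum_le _ _
    calc ‖c x * ∑ y ∈ X.neighborFinset x, f y‖ ^ 2
        ≤ (∑ y ∈ X.neighborFinset x, ‖f y‖) ^ 2 := by gcongr
      _ ≤ ((X.neighborFinset x).card : ℝ) * ∑ y ∈ X.neighborFinset x, ‖f y‖ ^ 2 :=
          sq_sum_le_card_mul_sum_sq
      _ ≤ (d : ℝ) * ∑ y ∈ X.neighborFinset x, ‖f y‖ ^ 2 := by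
          gcongr
          rw [X.card_neighborFinset_eq_degree]; exact hd x
  have h3 : ∑ x ∈ s, ∑ y ∈ X.neighborFinset x, ‖f y‖ ^ 2 ≤ (d : ℝ) * ‖f‖ ^ 2 := by
    set t := s.biUnion fun x => X.neighborFinset x with ht
    have e : ∑ x ∈ s, ∑ y ∈ X.neighborFinset x, ‖f y‖ ^ 2
        = ∑ y ∈ t, ∑ x ∈ s.filter (fun x => X.Adj x y), ‖f y‖ ^ 2 := by
      apply Finset.sum_comm'
      intro x y
      simp only [ht, Finset.mem_biUnion, Finset.mem_filter, SimpleGraph.mem_neighborFinset]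
      constructor
      · rintro ⟨hx, hxy⟩
        exact ⟨⟨hx, hxy⟩, x, hx, hxy⟩
      · rintro ⟨h, _⟩
        exact h
    rw [e]
    calc ∑ y ∈ t, ∑ x ∈ s.filter (fun x => X.Adj x y), ‖f y‖ ^ 2
        ≤ ∑ y ∈ t, (d : ℝ) * ‖f y‖ ^ 2 := by
          apply Finset.sum_le_sum
          intro y _
          rw [Finset.sum_const, nsmul_eq_mul]
          gcongr
          calc (s.filter (fun x => X.Adj x y)).card ≤ (X.neighborFinset y).card := by
                apply Finset.card_le_card
                intro x hx
                simp only [Finset.mem_filter] at hx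
                simpa using hx.2.symm
            _ ≤ d := by rw [X.card_neighborFinset_eq_degree]; exact hd y
      _ = (d : ℝ) * ∑ y ∈ t, ‖f y‖ ^ 2 := by rw [Finset.mul_sum]
      _ ≤ (d : ℝ) * ‖f‖ ^ 2 := by
          gcongr
          have := lp.sum_rpow_le_norm_rpow (p := 2) (by norm_num) f t
          simpa only [h2, Real.rpow_natCast] using this
  calc ∑ x ∈ s, ‖c x * ∑ y ∈ X.neighborFinset x, f y‖ ^ 2
      ≤ ∑ x ∈ s, (d : ℝ) * ∑ y ∈ X.neighborFinset x, ‖f y‖ ^ 2 :=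
        Finset.sum_le_sum fun x _ => h1 x
    _ = (d : ℝ) * ∑ x ∈ s, ∑ y ∈ X.neighborFinset x, ‖f y‖ ^ 2 := by rw [Finset.mul_sum]
    _ ≤ (d : ℝ) * ((d : ℝ) * ‖f‖ ^ 2) := by gcongr
    _ = ((d : ℝ) * ‖f‖) ^ 2 := by ring

/-- The bounded operator `(Tf)(x) = c(x) ∑_{y ∼ x} f(y)` on `ℓ²(VX)`, for a graph whose degrees are
bounded by `d` and a weight with `|c| ≤ 1`. -/
noncomputable def weightedAdj {V : Type*} (X : SimpleGraph V) [X.LocallyFinite] {d : ℕ}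
    (hd : ∀ v, X.degree v ≤ d) (c : V → ℂ) (hc : ∀ v, ‖c v‖ ≤ 1) :
    VertexSpace V →L[ℂ] VertexSpace V :=
  LinearMap.mkContinuous
    { toFun := fun f => ⟨fun x => c x * ∑ y ∈ X.neighborFinset x, f y,
        memℓp_gen' (weightedAdj_sum_le X hd c hc f)⟩
      map_add' := by
        intro f g
        ext x
        change c x * ∑ y ∈ X.neighborFinset x, (f y + g y) = c x * ∑ y ∈ X.neighborFinset x, f y
          + c x * ∑ y ∈ X.neighborFinset x, g y
        rw [Finset.sum_add_distrib, mul_add]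
      map_smul' := by
        intro a f
        ext x
        simp only [lp.coeFn_smul, Pi.smul_apply, smul_eq_mul, RingHom.id_apply, ← Finset.mul_sum]
        ring }
    d
    (fun f => lp.norm_le_of_forall_sum_le (by norm_num) (by positivity)
      (weightedAdj_sum_le X hd c hc f))

/-- The adjacency operator `A`: `(Af)(x) = ∑_{y ∼ x} f(y)`. -/
noncomputable def adjOp {V : Type*} (X : SimpleGraph V) [X.LocallyFinite] {d : ℕ}
    (hd : ∀ v, X.degree v ≤ d) : VertexSpace V →L[ℂ] VertexSpace V :=
  weightedAdj X hd (fun _ => 1) (by simp)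

theorem norm_inv_degree_le {V : Type*} (X : SimpleGraph V) [X.LocallyFinite] (v : V) :
    ‖((X.degree v : ℂ))⁻¹‖ ≤ 1 := by
  rcases Nat.eq_zero_or_pos (X.degree v) with h | h
  · simp [h]
  · rw [norm_inv, Complex.norm_natCast]
    exact inv_le_one_of_one_le₀ (by exact_mod_cast h)

/-- The transition operator `P` of the simple random walk:
`(Pf)(x) = (deg x)⁻¹ ∑_{y ∼ x} f(y)`. -/
noncomputable def walkOp {V : Type*} (X : SimpleGraph V) [X.LocallyFinite] {d : ℕ}
    (hd : ∀ v, X.degree v ≤ d) : VertexSpace V →L[ℂ] VertexSpace V :=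
  weightedAdj X hd (fun v => ((X.degree v : ℂ))⁻¹) (norm_inv_degree_le X)

end Operators

/-! ### Self-similar graphs

Subgraphs are full (induced) subgraphs, so they are given by their vertex sets. -/

/-- The frontier of the subgraph with vertex set `S`: vertices of `S` adjacent to a vertex
outside `S`. -/
def graphFrontier {V : Type*} (X : SimpleGraph V) (S : Set V) : Set V :=
  {v | v ∈ S ∧ ∃ w, w ∉ S ∧ X.Adj v w}

/-- `𝒢(n,m)`: admissible products `γ_{m-1} ⋯ γ_n` with `γ_i ∈ 𝒢(i,i+1)`, as maps on `K n`;
`𝒢(n,n)` consists of the identity of `K n`. -/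
inductive IsCopyMap {V : Type*} (X : SimpleGraph V) (K : ℕ → Finset V)
    (gen : ∀ n, Set (X.induce (K n : Set V) ↪g X)) (n : ℕ) :
    ℕ → (↥(K n : Set V) → V) → Prop
  | refl : IsCopyMap X K gen n n Subtype.val
  | step {m : ℕ} {f : ↥(K n : Set V) → V} {γ : X.induce (K m : Set V) ↪g X}
      (hf : IsCopyMap X K gen n m f) (hγ : γ ∈ gen m) (hr : ∀ x, f x ∈ (K m : Set V)) :
      IsCopyMap X K gen n (m + 1) (fun x => γ ⟨f x, hr x⟩)

/-- The `𝒢`-invariant frontier `⋃_{γ ∈ 𝒢(n)} γ⁻¹ ℱ(γ K_n)` of `K n`, where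
`𝒢(n) = ⋃_{m ≥ n} 𝒢(n,m)`. -/
def invariantFrontier {V : Type*} (X : SimpleGraph V) (K : ℕ → Finset V)
    (gen : ∀ n, Set (X.induce (K n : Set V) ↪g X)) (n : ℕ) : Set (K n : Set V) :=
  {x | ∃ m f, IsCopyMap X K gen n m f ∧ f x ∈ graphFrontier X (Set.range f)}

/-- The data that make a graph self-similar: an amenable exhaustion `K` by finite subgraphs, and
finite sets `gen n = 𝒢(n,n+1)` of local isomorphisms with source `K n`. (A local isomorphism with
source `K n` is an isomorphism of the subgraph `K n` onto a full subgraph, i.e. a graph embedding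
of `K n` into `X`.) -/
structure SelfSimilarData {V : Type*} (X : SimpleGraph V) where
  /-- the vertex set of the `n`-th subgraph -/
  K : ℕ → Finset V
  mono : Monotone K
  exhaust : ∀ v, ∃ n, v ∈ K n
  amenable : Tendsto
    (fun n => ((graphFrontier X (K n : Set V)).ncard : ℝ) / ((K n).card : ℝ)) atTop (𝓝 0)
  /-- the set `𝒢(n,n+1)` of local isomorphisms -/
  gen : ∀ n, Set (X.induce (K n : Set V) ↪g X)
  gen_finite : ∀ n, (gen n).Finite
  /-- the copies of `K n` cover the vertices of `K (n+1)` … -/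
  cover : ∀ n, ⋃ γ ∈ gen n, Set.range γ = (K (n + 1) : Set V)
  /-- … and its edges -/
  cover_edges : ∀ n, ∀ v ∈ K (n + 1), ∀ w ∈ K (n + 1), X.Adj v w →
    ∃ γ ∈ gen n, v ∈ Set.range γ ∧ w ∈ Set.range γ
  inter : ∀ n, ∀ γ ∈ gen n, ∀ γ' ∈ gen n, γ ≠ γ' →
    Set.range γ ∩ Set.range γ'
      = graphFrontier X (Set.range γ) ∩ graphFrontier X (Set.range γ')
  small_frontier : Tendsto
    (fun n => ((invariantFrontier X K gen n).ncard : ℝ) / ((K n).card : ℝ)) atTop (𝓝 0)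

/-- `𝒢(n,m)`, as a set of maps on `K n`. -/
def SelfSimilarData.copies {V : Type*} {X : SimpleGraph V} (S : SelfSimilarData X) (n m : ℕ) :
    Set (↥(S.K n : Set V) → V) :=
  {f | IsCopyMap X S.K S.gen n m f}

/-- The Euler–Poincaré characteristic `|VK_n| - |EK_n|` of the subgraph `K n`. -/
noncomputable def SelfSimilarData.eulerChar {V : Type*} {X : SimpleGraph V}
    (S : SelfSimilarData X) (n : ℕ) : ℝ :=
  ((S.K n).card : ℝ) - ((X.induce (S.K n : Set V)).edgeSet.ncard : ℝ)

/-! ### The trace and the analytic determinant -/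

open Classical in
/-- `Tr_𝒢 T = t`, i.e. `Tr (P(K_n) T) / Tr P(K_n)` converges to `t`. -/
def SelfSimilarData.HasTrace {V : Type*} {X : SimpleGraph V} (S : SelfSimilarData X)
    (T : VertexSpace V →L[ℂ] VertexSpace V) (t : ℂ) : Prop :=
  Tendsto (fun n => (∑ v ∈ S.K n, (T (lp.single 2 v (1 : ℂ)) : VertexSpace V) v)
    / ((S.K n).card : ℂ)) atTop (𝓝 t)

/-- The closed disc with centre `c` and radius `r` omits `0`, its interior contains the spectrum
of `T` (hence the convex hull of the spectrum), and `φ` is a branch of the logarithm on it. A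
compact convex subset of `ℂ` omitting `0` lies in such a disc, so admissible data exist exactly when
`0` is not in the convex hull of the spectrum. -/
def IsLogContour {𝔸 : Type*} [Ring 𝔸] [Algebra ℂ 𝔸] (T : 𝔸) (c : ℂ) (r : ℝ) (φ : ℂ → ℂ) : Prop :=
  0 < r ∧ spectrum ℂ T ⊆ Metric.ball c r ∧ (0 : ℂ) ∉ Metric.closedBall c r ∧
    AnalyticOnNhd ℂ φ (Metric.closedBall c r) ∧
    ∀ z ∈ Metric.closedBall c r, Complex.exp (φ z) = z

/-- `(2πi)⁻¹ ∮_{|z-c|=r} φ(z) (z - T)⁻¹ dz`. -/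
noncomputable def contourLog {𝔸 : Type*} [NormedRing 𝔸] [NormedAlgebra ℂ 𝔸] (T : 𝔸)
    (c : ℂ) (r : ℝ) (φ : ℂ → ℂ) : 𝔸 :=
  (2 * (Real.pi : ℂ) * Complex.I)⁻¹ • ∮ z in C(c, r), φ z • resolvent T z

/-- `det_𝒢 T = δ`: the point `0` is not in the convex hull of the spectrum of `T`, and
`δ = exp Tr_𝒢 (log T)`, where the trace exists and the value is the same for all admissible contours
and branches. -/
def SelfSimilarData.HasDet {V : Type*} {X : SimpleGraph V} (S : SelfSimilarData X)
    (T : VertexSpace V →L[ℂ] VertexSpace V) (δ : ℂ) : Prop :=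
  (∃ c r φ, IsLogContour T c r φ) ∧
    ∀ c r φ, IsLogContour T c r φ →
      ∃ t, S.HasTrace (contourLog T c r φ) t ∧ Complex.exp t = δ

/-! ### Cycles and the zeta function -/

/-- A closed path `(v_0, …, v_m = v_0)` of length `m ≥ 1`, with vertices indexed modulo `m`. -/
structure ClosedPath {V : Type*} (X : SimpleGraph V) where
  len : ℕ
  len_pos : 0 < len
  vert : ZMod len → V
  adj : ∀ i, X.Adj (vert i) (vert (i + 1))

namespace ClosedPath

/-- `v_{i-1} = v_{i+1}` for some `1 ≤ i ≤ m-1`. -/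
def HasBacktracking {V : Type*} {X : SimpleGraph V} (C : ClosedPath X) : Prop :=
  ∃ i : ℕ, 1 ≤ i ∧ i + 1 ≤ C.len ∧ C.vert ((i : ZMod C.len) - 1) = C.vert ((i : ZMod C.len) + 1)

/-- For some `1 ≤ k ≤ [m/2]-1`, one has `v_j = v_{m-j}` for `j = 1, …, k`. -/
def HasTail {V : Type*} {X : SimpleGraph V} (C : ClosedPath X) : Prop :=
  ∃ k : ℕ, 1 ≤ k ∧ k + 1 ≤ C.len / 2 ∧
    ∀ j : ℕ, 1 ≤ j → j ≤ k → C.vert (j : ZMod C.len) = C.vert (-(j : ZMod C.len))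

/-- Reduced closed paths: no backtracking, no tail. -/
def Reduced {V : Type*} {X : SimpleGraph V} (C : ClosedPath X) : Prop :=
  ¬ C.HasBacktracking ∧ ¬ C.HasTail

/-- Not obtained by going `n ≥ 2` times around another closed path. -/
def Primitive {V : Type*} {X : SimpleGraph V} (C : ClosedPath X) : Prop :=
  ¬ ∃ (n : ℕ) (D : ClosedPath X), 2 ≤ n ∧ C.len = n * D.len ∧
    ∀ j : ℕ, C.vert (j : ZMod C.len) = D.vert (j : ZMod D.len)

/-- `D` is `C` with the origin shifted by `k` steps. -/
def Shift {V : Type*} {X : SimpleGraph V} (C D : ClosedPath X) : Prop :=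
  C.len = D.len ∧ ∃ k : ℕ, ∀ j : ℕ,
    D.vert (j : ZMod D.len) = C.vert ((j : ZMod C.len) + (k : ZMod C.len))

/-- `D = γ(C)` for some `γ ∈ 𝒢(n,m)` with `C ⊂ K_n`. -/
def Move {V : Type*} {X : SimpleGraph V} (S : SelfSimilarData X) (C D : ClosedPath X) : Prop :=
  C.len = D.len ∧ ∃ n m, ∃ f ∈ S.copies n m, ∃ h : ∀ i, C.vert i ∈ (S.K n : Set V),
    ∀ j : ℕ, D.vert (j : ZMod D.len) = f ⟨C.vert (j : ZMod C.len), h _⟩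

/-- All vertices of `C` lie in `W`. -/
def InSet {V : Type*} {X : SimpleGraph V} (C : ClosedPath X) (W : Set V) : Prop :=
  ∀ i, C.vert i ∈ W

end ClosedPath

/-- Primitive reduced closed paths. -/
abbrev PrimePath {V : Type*} (X : SimpleGraph V) := {C : ClosedPath X // C.Reduced ∧ C.Primitive}

/-- Prime cycles: primitive reduced closed paths up to the choice of the origin. -/
def PrimeCycle {V : Type*} (X : SimpleGraph V) :=
  Quot (fun C D : PrimePath X => C.1.Shift D.1)

/-- The length of a prime cycle. -/
def PrimeCycle.len {V : Type*} {X : SimpleGraph V} (c : PrimeCycle X) : ℕ :=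
  Quot.lift (fun C : PrimePath X => C.1.len) (fun _ _ h => h.1) c

/-- The cycle `c` is contained in the subgraph with vertex set `W`. -/
def PrimeCycle.InSet {V : Type*} {X : SimpleGraph V} (c : PrimeCycle X) (W : Set V) : Prop :=
  ∃ C : PrimePath X, Quot.mk _ C = c ∧ C.1.InSet W

/-- `𝒢`-equivalence classes of prime cycles, for the equivalence relation generated by
`c ∼ γ(c)`, `γ ∈ ⋃ 𝒢(n)`. -/
def PrimeClass {V : Type*} {X : SimpleGraph V} (S : SelfSimilarData X) :=
  Quot (fun c d : PrimeCycle X => ∃ C D : PrimePath X,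
    Quot.mk _ C = c ∧ Quot.mk _ D = d ∧ C.1.Move S D.1)

/-- The `𝒢`-equivalence class of a prime cycle. -/
def PrimeCycle.toClass {V : Type*} {X : SimpleGraph V} (S : SelfSimilarData X)
    (c : PrimeCycle X) : PrimeClass S :=
  Quot.mk _ c

/-- The common length `|C|` of the cycles in a class. -/
def PrimeClass.len {V : Type*} {X : SimpleGraph V} {S : SelfSimilarData X}
    (κ : PrimeClass S) : ℕ :=
  Quot.lift PrimeCycle.len
    (by rintro _ _ ⟨C, D, rfl, rfl, h⟩; exact h.1) κ

/-- The number of cycles of the class `κ` that are contained in `K n`. -/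
noncomputable def PrimeClass.count {V : Type*} {X : SimpleGraph V} {S : SelfSimilarData X}
    (κ : PrimeClass S) (n : ℕ) : ℕ :=
  {c : PrimeCycle X | c.toClass S = κ ∧ c.InSet (S.K n : Set V)}.ncard

/-- `μ(C) = m`: the number of cycles in the class, per vertex of `K_n`, converges to `m`. -/
def PrimeClass.HasMultiplicity {V : Type*} {X : SimpleGraph V} {S : SelfSimilarData X}
    (κ : PrimeClass S) (m : ℝ) : Prop :=
  Tendsto (fun n => (κ.count n : ℝ) / ((S.K n).card : ℝ)) atTop (𝓝 m)

/-- The size `s(C)`: the least `m` with `C ⊂ γ(K_m)` for some `γ ∈ 𝒢(m)`. -/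
noncomputable def PrimeCycle.size {V : Type*} {X : SimpleGraph V} (S : SelfSimilarData X)
    (c : PrimeCycle X) : ℕ :=
  sInf {m | ∃ k, ∃ f ∈ S.copies m k, c.InSet (Set.range f)}

/-- The inclusion of `K n` into `K (n+1)` is one of the maps in `𝒢(n,n+1)`, and two distinct copies
of `K n` in `K (n+1)` have no reduced closed path in common. -/
def SelfSimilarData.CycleSeparated {V : Type*} {X : SimpleGraph V} (S : SelfSimilarData X) :
    Prop :=
  (∀ n, ∃ γ ∈ S.gen n, ∀ x, γ x = x.1) ∧
  ∀ n, ∀ γ ∈ S.gen n, ∀ γ' ∈ S.gen n, γ ≠ γ' →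
    ∀ C : ClosedPath X, C.Reduced → ¬ C.InSet (Set.range γ ∩ Set.range γ')

/-! ### The domains -/

/-- `Ω = ℂ ∖ ({|u|² = 1/q} ∪ {u real, 1/q ≤ |u| ≤ 1})`. -/
def zetaDomain (q : ℕ) : Set ℂ :=
  ({u : ℂ | ‖u‖ ^ 2 = 1 / (q : ℝ)} ∪
    {u : ℂ | u.im = 0 ∧ 1 / (q : ℝ) ≤ |u.re| ∧ |u.re| ≤ 1})ᶜ

/-- `Ω' = ℂ ∖ ({|u|² = 1/q, Im u ≤ 0} ∪ {u real, 1/q ≤ |u| ≤ 1})`, a connected open set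
containing `Ω`. -/
def zetaPowerDomain (q : ℕ) : Set ℂ :=
  ({u : ℂ | ‖u‖ ^ 2 = 1 / (q : ℝ) ∧ u.im ≤ 0} ∪
    {u : ℂ | u.im = 0 ∧ 1 / (q : ℝ) ≤ |u.re| ∧ |u.re| ≤ 1})ᶜ

/-! ### Copies in a self-similar graph -/

namespace SelfSimilarData

variable {V : Type*} {X : SimpleGraph V} (S : SelfSimilarData X)

/-! All the limits are averages over `K n` of local quantities, and the theorem compares two ways of
counting reduced closed walks per vertex: by prime cycles, and by the spectrum of `A`.

Densities. Two copies of `K n` inside `K m` meet only in images of the invariant frontier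
(`mem_invariantFrontier_of_overlap`), and a closed walk that avoids these images stays in one copy.
So a family of closed walks of length `l` that is invariant under `𝒢` has in `K m` about `|𝒢(n,m)|`
times as many members as in `K n`, with an error of order `|𝒢(n,m)|` times the size of the invariant
frontier. The same holds for vertices, so the number of walks per vertex is a Cauchy sequence
(`exists_density`). The error bound depends on `l` but not on the family. This gives the moments `a
k = Tr (A ^ k)` and the multiplicities `μ`; the uniformity shows that `l * μ`, summed over the
possibly infinitely many classes of length `l`, is the density of the primitive reduced walks of
length `l` (`exists_multiplicity`).

Ihara's identity up to `o(|K n|)`. On a finite graph the reduced closed walks of length `m` are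
counted by the trace of the `m`-th power of the nonbacktracking matrix. If all degrees were `q + 1`,
this would be the trace of `D_m(A)` plus `q - 1` per vertex for even `m`, where `D_m` is the Dickson
polynomial with `D_m(y + z) = y ^ m + z ^ m` for `y * z = q`. In general the error is at most a
constant times the total deviation of the degrees from `q + 1` (`exists_trace_dart_pow_sub_le`). For
`K n` that deviation is `o(|K n|)`, because only frontier vertices and finitely many others
contribute.

Spectral side. No degree exceeds `q + 1` (`degree_le_of_essentially_regular`), so the spectrum of
`A` lies in `[-(q+1), q+1]`. The moments determine a contraction `L` on the continuous functions on
this segment which gives the trace of every continuous function of `A`. The operator `(q+1)P` is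
conjugate, by a diagonal operator, to `q + 1` times a self-adjoint contraction with the same
moments, so the same `L` serves it. The contour integral of the logarithm is the functional
calculus, whence both determinants equal `exp L(log (1 + q u² - u x))`.

Conclusion. Since `1 + q u² - u x = (1 - y u)(1 - z u)` with `y + z = x` and `y z = q`, the series
`∑ u ^ m / m * L(D_m)` is minus the logarithm of the determinant, while the even terms sum to
`(1-q)/2 * log (1 - u²)`. The total is `∑ u ^ m / m` times the density of reduced walks of length
`m`, and splitting these walks by their minimal period turns it into the logarithm of the Euler
product (`hasProd_of_hasSum`). The extension to `Ω` holds because `1 + q u² - u x` has no zero there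
for `x` in the segment. The moment series come from expanding the logarithm in powers of `u x - q
u²`. -/

theorem gen_mem {n : ℕ} {γ : X.induce (S.K n : Set V) ↪g X} (hγ : γ ∈ S.gen n)
    (x : (S.K n : Set V)) : γ x ∈ (S.K (n + 1) : Set V) := by
  rw [← S.cover n]
  exact Set.mem_biUnion hγ ⟨x, rfl⟩

variable {S}

theorem le_of_copies {n m : ℕ} {f : ↥(S.K n : Set V) → V} (hf : f ∈ S.copies n m) : n ≤ m := by
  induction hf with
  | refl => exact le_rfl
  | step _ _ _ ih => omega

theorem copies_mem {n m : ℕ} {f : ↥(S.K n : Set V) → V} (hf : f ∈ S.copies n m)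
    (x : (S.K n : Set V)) : f x ∈ (S.K m : Set V) := by
  induction hf with
  | refl => exact x.2
  | step hf hγ hr ih => exact S.gen_mem hγ _

theorem copies_injective {n m : ℕ} {f : ↥(S.K n : Set V) → V} (hf : f ∈ S.copies n m) :
    Function.Injective f := by
  induction hf with
  | refl => exact Subtype.val_injective
  | step hf hγ hr ih =>
    intro x y hxy
    exact ih (congrArg Subtype.val ((RelEmbedding.injective _) hxy))

theorem copies_adj {n m : ℕ} {f : ↥(S.K n : Set V) → V} (hf : f ∈ S.copies n m)
    (x y : (S.K n : Set V)) : X.Adj (f x) (f y) ↔ X.Adj x y := by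
  induction hf with
  | refl => exact Iff.rfl
  | @step _ _ γ _ _ _ ih => exact γ.map_rel_iff.trans ih

theorem eq_val_of_copies_self {n : ℕ} {f : ↥(S.K n : Set V) → V} (hf : f ∈ S.copies n n) :
    f = Subtype.val := by
  have key : ∀ m, IsCopyMap X S.K S.gen n m f → m = n → f = Subtype.val := by
    intro m h
    induction h with
    | refl => intro _; rfl
    | step hg hγ hr ih =>
      intro h
      have := le_of_copies (S := S) hg
      omega
  exact key n hf rfl

theorem copies_succ {n m : ℕ} (hnm : n ≤ m) {f : ↥(S.K n : Set V) → V}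
    (hf : f ∈ S.copies n (m + 1)) :
    ∃ g ∈ S.copies n m, ∃ γ ∈ S.gen m, ∃ hr : ∀ x, g x ∈ (S.K m : Set V),
      f = fun x => γ ⟨g x, hr x⟩ := by
  -- The final index is made a variable with an equation, because `n` is a parameter on which the
  -- type of `f` depends and the case `n = m + 1` cannot be eliminated directly.
  have key : ∀ k, IsCopyMap X S.K S.gen n k f → k = m + 1 →
      ∃ g ∈ S.copies n m, ∃ γ ∈ S.gen m, ∃ hr : ∀ x, g x ∈ (S.K m : Set V),
      f = fun x => γ ⟨g x, hr x⟩ := by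
    intro k h
    cases h with
    | refl => intro h; omega
    | @step k g γ hg hγ hr =>
      intro h
      obtain rfl : k = m := by omega
      exact ⟨g, hg, γ, hγ, hr, rfl⟩
  exact key _ hf rfl

theorem copies_self_mem (n : ℕ) : (Subtype.val : ↥(S.K n : Set V) → V) ∈ S.copies n n :=
  IsCopyMap.refl

theorem copies_finite (n m : ℕ) : (S.copies n m).Finite := by
  rcases lt_or_ge m n with h | h
  · have : S.copies n m = ∅ := by
      ext f
      simp only [Set.mem_empty_iff_false, iff_false]
      intro hf
      have := le_of_copies hf
      omega
    rw [this]; exact Set.finite_empty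
  · induction m, h using Nat.le_induction with
    | base =>
      refine (Set.finite_singleton (Subtype.val : ↥(S.K n : Set V) → V)).subset ?_
      intro f hf
      exact eq_val_of_copies_self hf
    | succ m hm ih =>
      classical
      -- Composition is made total by a junk value outside `K m`, which admissible pairs never
      -- reach.
      refine ((ih.prod (S.gen_finite m)).image
        (fun (p : (↥(S.K n : Set V) → V) × (X.induce (S.K m : Set V) ↪g X)) =>
          fun x : ↥(S.K n : Set V) =>
            if h : p.1 x ∈ (S.K m : Set V) then (p.2 ⟨p.1 x, h⟩ : V) else x)).subset ?_
      intro f hf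
      obtain ⟨g, hg, γ, hγ, hr, rfl⟩ := copies_succ hm hf
      refine ⟨(g, γ), ⟨hg, hγ⟩, ?_⟩
      funext x
      exact dif_pos (hr x)

theorem copies_cover {n m : ℕ} (hnm : n ≤ m) {v : V} (hv : v ∈ S.K m) :
    ∃ f ∈ S.copies n m, ∃ x, f x = v := by
  induction m, hnm using Nat.le_induction generalizing v with
  | base => exact ⟨_, copies_self_mem n, ⟨v, hv⟩, rfl⟩
  | succ m hm ih =>
    have hv' : v ∈ (S.K (m + 1) : Set V) := hv
    rw [← S.cover m] at hv'
    obtain ⟨γ, hγ, y, rfl⟩ := Set.mem_iUnion₂.1 hv'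
    obtain ⟨f, hf, x, hx⟩ := ih (v := y) y.2
    refine ⟨_, IsCopyMap.step hf hγ (copies_mem hf), x, ?_⟩
    congr 1
    exact Subtype.ext hx

theorem copies_comp {n a m : ℕ} {g : ↥(S.K n : Set V) → V} {h : ↥(S.K a : Set V) → V}
    (hg : g ∈ S.copies n a) (hh : h ∈ S.copies a m) (hr : ∀ x, g x ∈ (S.K a : Set V)) :
    (fun x => h ⟨g x, hr x⟩) ∈ S.copies n m := by
  induction hh with
  | refl => exact hg
  | step hf hγ hr' ih => exact IsCopyMap.step ih hγ _

theorem copies_factor {n a m : ℕ} (hna : n ≤ a) (ham : a ≤ m) {f : ↥(S.K n : Set V) → V}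
    (hf : f ∈ S.copies n m) :
    ∃ g ∈ S.copies n a, ∃ h ∈ S.copies a m, ∃ hr : ∀ x, g x ∈ (S.K a : Set V),
      f = fun x => h ⟨g x, hr x⟩ := by
  induction m, ham using Nat.le_induction generalizing f with
  | base => exact ⟨f, hf, _, copies_self_mem a, copies_mem hf, rfl⟩
  | succ m hm ih =>
    obtain ⟨f', hf', γ, hγ, hr, rfl⟩ := copies_succ (hna.trans hm) hf
    obtain ⟨g, hg, h, hh, hr', rfl⟩ := ih hf'
    exact ⟨g, hg, _, IsCopyMap.step hh hγ (copies_mem hh), hr', rfl⟩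

/-- Compare the last generators. If they agree they can be cancelled. If not, `inter` gives the
common point a neighbour outside `γ K_m`, which is then also outside the smaller copy of `K n`. -/
theorem mem_invariantFrontier_of_overlap {n m : ℕ} {f f' : ↥(S.K n : Set V) → V}
    (hf : f ∈ S.copies n m) (hf' : f' ∈ S.copies n m) (hne : f ≠ f') {x y : (S.K n : Set V)}
    (hxy : f x = f' y) : x ∈ invariantFrontier X S.K S.gen n := by
  have hnm := le_of_copies hf
  induction m, hnm using Nat.le_induction generalizing f f' with
  | base => exact absurd ((eq_val_of_copies_self hf).trans (eq_val_of_copies_self hf').symm) hne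
  | succ m hm ih =>
    have hf0 := hf
    obtain ⟨g, hg, γ, hγ, hr, rfl⟩ := copies_succ hm hf
    obtain ⟨g', hg', γ', hγ', hr', rfl⟩ := copies_succ hm hf'
    by_cases h : γ = γ'
    · subst h
      have hgg : g ≠ g' := by
        rintro rfl
        exact hne rfl
      exact ih hg hg' hgg (congrArg Subtype.val (γ.injective hxy))
    · have h1 : γ ⟨g x, hr x⟩ ∈ Set.range γ ∩ Set.range γ' := ⟨⟨_, rfl⟩, ⟨_, hxy.symm⟩⟩
      rw [S.inter m γ hγ γ' hγ' h] at h1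
      obtain ⟨⟨-, w, hw, hadj⟩, -⟩ := h1
      refine ⟨_, _, hf0, ⟨x, rfl⟩, w, ?_, hadj⟩
      rintro ⟨z, rfl⟩
      exact hw ⟨_, rfl⟩

theorem adj_mem_range_of_not_mem_invariantFrontier {n m : ℕ} {f : ↥(S.K n : Set V) → V}
    (hf : f ∈ S.copies n m) {x : (S.K n : Set V)} (hx : x ∉ invariantFrontier X S.K S.gen n)
    {w : V} (hw : X.Adj (f x) w) : w ∈ Set.range f := by
  by_contra h
  exact hx ⟨m, f, hf, ⟨x, rfl⟩, w, h, hw⟩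

/-- The copies meeting the invariant frontier. -/
def copyBoundary (S : SelfSimilarData X) (n m : ℕ) : Set V :=
  ⋃ f ∈ S.copies n m, f '' invariantFrontier X S.K S.gen n

theorem copyBoundary_finite (n m : ℕ) : (S.copyBoundary n m).Finite :=
  (copies_finite n m).biUnion fun _ _ => (Set.toFinite _).image _

theorem copyBoundary_ncard_le (n m : ℕ) :
    (S.copyBoundary n m).ncard
      ≤ (S.copies n m).ncard * (invariantFrontier X S.K S.gen n).ncard := by
  have : S.copyBoundary n m = (fun p : (↥(S.K n : Set V) → V) × (S.K n : Set V) => p.1 p.2) ''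
      (S.copies n m ×ˢ invariantFrontier X S.K S.gen n) := by
    ext v
    simp only [copyBoundary, Set.mem_iUnion, Set.mem_image, Prod.exists]
    constructor
    · rintro ⟨f, hf, x, hx, rfl⟩; exact ⟨f, x, ⟨hf, hx⟩, rfl⟩
    · rintro ⟨f, x, ⟨hf, hx⟩, rfl⟩; exact ⟨f, hf, x, hx, rfl⟩
  rw [this, ← Set.ncard_prod]
  exact Set.ncard_image_le ((copies_finite n m).prod (Set.toFinite _))

/-- A boundary point of another copy that lies in the range of `f` is an overlap of two copies,
hence also comes from the invariant frontier through `f`. So every copy has the same boundary,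
transported by its map. -/
theorem copies_apply_mem_copyBoundary {n m : ℕ} {f : ↥(S.K n : Set V) → V}
    (hf : f ∈ S.copies n m) {x : (S.K n : Set V)} :
    f x ∈ S.copyBoundary n m ↔ x ∈ invariantFrontier X S.K S.gen n := by
  constructor
  · intro h
    obtain ⟨f', hf', y, hy, hxy⟩ := Set.mem_iUnion₂.1 h
    by_cases hff : f = f'
    · subst hff
      rwa [← copies_injective hf hxy]
    · exact mem_invariantFrontier_of_overlap hf hf' hff hxy.symm
  · intro h
    exact Set.mem_biUnion hf ⟨x, h, rfl⟩

end SelfSimilarData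

/-! ### Counting periodic sequences -/

/-- Periodic sequences of period `l` whose consecutive terms are equal or adjacent. -/
def IsCyclicWalk {V : Type*} (X : SimpleGraph V) (l : ℕ) (s : ℕ → V) : Prop :=
  (∀ j, s (j + l) = s j) ∧ ∀ j, s j = s (j + 1) ∨ X.Adj (s j) (s (j + 1))

/-- The number of sequences of the family `Q` with all terms in `W`. -/
noncomputable def seqCount {V : Type*} (Q : Set (ℕ → V)) (W : Set V) : ℕ :=
  {s ∈ Q | ∀ j, s j ∈ W}.ncard

theorem IsCyclicWalk.mod {V : Type*} {X : SimpleGraph V} {l : ℕ} {s : ℕ → V} (h : IsCyclicWalk X l s) (j : ℕ) :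
    s (j % l) = s j := by
  have : ∀ k r, s (r + l * k) = s r := by
    intro k
    induction k with
    | zero => intro r; rfl
    | succ k ih => intro r; rw [Nat.mul_succ, ← add_assoc, h.1, ih]
  conv_rhs => rw [← Nat.mod_add_div j l, this]

section Through

variable {V : Type*} (X : SimpleGraph V) [X.LocallyFinite]

/-- Each closed neighbourhood has at most `d + 1` points, so the steps of a walk can be labelled by
`Fin (d + 1)`; a starting point and a word of labels then determine the walk. -/
theorem exists_neighbor_code {d : ℕ} (hd : ∀ v, X.degree v ≤ d) :
    ∃ e : V → V → Fin (d + 1), ∀ v w w', (v = w ∨ X.Adj v w) → (v = w' ∨ X.Adj v w') →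
      e v w = e v w' → w = w' := by
  classical
  have : ∀ v, ∃ e : V → Fin (d + 1), ∀ w w', (v = w ∨ X.Adj v w) → (v = w' ∨ X.Adj v w') →
      e w = e w' → w = w' := by
    intro v
    have hc : (insert v (X.neighborFinset v)).card ≤ (Finset.univ : Finset (Fin (d + 1))).card := by
      refine (Finset.card_insert_le _ _).trans ?_
      rw [X.card_neighborFinset_eq_degree, Finset.card_univ, Fintype.card_fin]
      exact Nat.succ_le_succ (hd v)
    obtain ⟨e, -, he⟩ := (Finset.le_card_iff_exists_subset_card.1 hc).elim fun t ht =>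
      (⟨t, ht.1, ht.2⟩ : ∃ t, t ⊆ (Finset.univ : Finset (Fin (d + 1))) ∧ t.card = _)
    let φ := Finset.equivOfCardEq he.symm
    refine ⟨fun w => if h : w ∈ insert v (X.neighborFinset v) then (φ ⟨w, h⟩ : Fin (d + 1)) else 0,
      ?_⟩
    intro w w' hw hw' h
    have h1 : w ∈ insert v (X.neighborFinset v) := by
      simp only [Finset.mem_insert, SimpleGraph.mem_neighborFinset]
      exact hw.imp Eq.symm id
    have h2 : w' ∈ insert v (X.neighborFinset v) := by
      simp only [Finset.mem_insert, SimpleGraph.mem_neighborFinset]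
      exact hw'.imp Eq.symm id
    simp only [dif_pos h1, dif_pos h2] at h
    exact congrArg Subtype.val (φ.injective (Subtype.ext h))
  choose e he using this
  exact ⟨e, he⟩

variable {X}

/-- The code of a sequence is a time `i < l` at which it is in `Y`, its value then, and the labels
of the next `l` steps. The factors of the bound count these three data. -/
theorem cyclicWalk_through {d l : ℕ} (hl : 0 < l) (hd : ∀ v, X.degree v ≤ d) {Q : Set (ℕ → V)}
    (hQ : ∀ s ∈ Q, IsCyclicWalk X l s) {Y : Set V} (hY : Y.Finite) :
    {s ∈ Q | ∃ j, s j ∈ Y}.Finite ∧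
      {s ∈ Q | ∃ j, s j ∈ Y}.ncard ≤ l * (d + 1) ^ l * Y.ncard := by
  classical
  obtain ⟨e, he⟩ := exists_neighbor_code X hd
  have hfin : Finite Y := hY
  let A := {s ∈ Q | ∃ j, s j ∈ Y}
  have hA : ∀ s : A, ∃ i : Fin l, s.1 i ∈ Y := by
    rintro ⟨s, hs, j, hj⟩
    refine ⟨⟨j % l, Nat.mod_lt _ hl⟩, ?_⟩
    change s (j % l) ∈ Y
    rwa [(hQ s hs).mod]
  choose i hi using hA
  let code : A → (Fin l × (Fin l → Fin (d + 1))) × Y := fun s =>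
    ((i s, fun k => e (s.1 (i s + k)) (s.1 (i s + k + 1))), ⟨s.1 (i s), hi s⟩)
  have hinj : Function.Injective code := by
    intro s t hst
    have h1 : i s = i t := congrArg (fun p => p.1.1) hst
    have h2 : s.1 (i s) = t.1 (i t) := congrArg (fun p => (p.2 : V)) hst
    have h3 : ∀ k : Fin l, e (s.1 (i s + k)) (s.1 (i s + k + 1))
        = e (t.1 (i t + k)) (t.1 (i t + k + 1)) :=
      fun k => congrFun (congrArg (fun p => p.1.2) hst) k
    have hs := hQ s.1 s.2.1
    have ht := hQ t.1 t.2.1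
    rw [← h1] at h2 h3
    have h4 : ∀ k, k ≤ l → s.1 (i s + k) = t.1 (i s + k) := by
      intro k
      induction k with
      | zero => intro _; exact h2
      | succ k ih =>
        intro hk
        have h5 := h3 ⟨k, hk⟩
        have h6 := ih (by omega)
        simp only at h5
        rw [← h6] at h5
        refine he (s.1 (i s + k)) _ _ (hs.2 _) ?_ h5
        rw [h6]
        exact ht.2 _
    apply Subtype.ext
    funext j
    have h7 := (i s).2
    rw [← hs.mod, ← ht.mod]
    have hr := Nat.mod_lt j hl
    set r := j % l
    -- The sequences agree on the window from `i` to `i + l`; a residue before `i` is reached after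
    -- adding one period.
    rcases le_or_gt (i s : ℕ) r with h | h
    · have := h4 (r - i s) (by omega)
      rwa [Nat.add_sub_cancel' h] at this
    · have := h4 (r + l - i s) (by omega)
      rw [Nat.add_sub_cancel' (by omega), hs.1, ht.1] at this
      exact this
  have hAfin : Finite A := Finite.of_injective code hinj
  refine ⟨hAfin, ?_⟩
  have := Nat.card_le_card_of_injective code hinj
  rw [Nat.card_prod, Nat.card_prod, Nat.card_fun] at this
  simpa [Nat.card_coe_set_eq] using this

theorem seqCount_finite {d l : ℕ} (hl : 0 < l) (hd : ∀ v, X.degree v ≤ d) {Q : Set (ℕ → V)}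
    (hQ : ∀ s ∈ Q, IsCyclicWalk X l s) {W : Set V} (hW : W.Finite) :
    {s ∈ Q | ∀ j, s j ∈ W}.Finite :=
  (cyclicWalk_through hl hd hQ hW).1.subset fun _ hs => ⟨hs.1, 0, hs.2 0⟩

theorem seqCount_le {d l : ℕ} (hl : 0 < l) (hd : ∀ v, X.degree v ≤ d) {Q : Set (ℕ → V)}
    (hQ : ∀ s ∈ Q, IsCyclicWalk X l s) {W : Set V} (hW : W.Finite) :
    seqCount Q W ≤ l * (d + 1) ^ l * W.ncard := by
  have h := cyclicWalk_through hl hd hQ hW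
  have hsub : {s ∈ Q | ∀ j, s j ∈ W} ⊆ {s ∈ Q | ∃ j, s j ∈ W} := fun _ hs => ⟨hs.1, 0, hs.2 0⟩
  exact (Set.ncard_le_ncard hsub h.1).trans h.2

theorem seqCount_diff {d l : ℕ} (hl : 0 < l) (hd : ∀ v, X.degree v ≤ d) {Q : Set (ℕ → V)}
    (hQ : ∀ s ∈ Q, IsCyclicWalk X l s) {W Y : Set V} (hW : W.Finite) (hY : Y.Finite) :
    seqCount Q (W \ Y) ≤ seqCount Q W ∧
      seqCount Q W ≤ seqCount Q (W \ Y) + l * (d + 1) ^ l * Y.ncard := by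
  have hf := seqCount_finite hl hd hQ hW
  have hf' := seqCount_finite hl hd hQ (hW.sdiff (t := Y))
  have ht := cyclicWalk_through hl hd hQ hY
  constructor
  · exact Set.ncard_le_ncard (fun s hs => ⟨hs.1, fun j => (hs.2 j).1⟩) hf
  · refine le_trans ?_ (Nat.add_le_add_left ht.2 _)
    refine (Set.ncard_le_ncard ?_ (hf'.union ht.1)).trans (Set.ncard_union_le _ _)
    intro s hs
    by_cases h : ∃ j, s j ∈ Y
    · exact Or.inr ⟨hs.1, h⟩
    · push Not at h
      exact Or.inl ⟨hs.1, fun j => ⟨hs.2 j, h j⟩⟩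

end Through

/-! ### Densities of families of sequences invariant under the copies -/

namespace SelfSimilarData

variable {V : Type*} {X : SimpleGraph V}

/-- A family of sequences that is preserved and reflected by all the maps in `𝒢`. -/
def CopyInvariant (S : SelfSimilarData X) (Q : Set (ℕ → V)) : Prop :=
  ∀ n m, ∀ f ∈ S.copies n m, ∀ s : ℕ → ↥(S.K n : Set V),
    (fun j => f (s j)) ∈ Q ↔ (fun j => (s j : V)) ∈ Q

variable {S : SelfSimilarData X}

/-- A sequence that avoids the boundary cannot leave the copy in which it starts, since all
neighbours of a point off the invariant frontier stay in the copy. That copy is unique, since two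
copies overlap only in the boundary. -/
theorem seqCount_copies {l : ℕ} {Q : Set (ℕ → V)} (hQ : ∀ s ∈ Q, IsCyclicWalk X l s)
    (hinv : S.CopyInvariant Q) {n m : ℕ} (hnm : n ≤ m) :
    seqCount Q ((S.K m : Set V) \ S.copyBoundary n m) = (S.copies n m).ncard *
      {t : ℕ → ↥(S.K n : Set V) | (fun j => (t j : V)) ∈ Q ∧
        ∀ j, t j ∉ invariantFrontier X S.K S.gen n}.ncard := by
  rw [← Set.ncard_prod, seqCount]
  symm
  refine Set.ncard_congr (fun p _ => fun j => p.1 (p.2 j)) ?_ ?_ ?_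
  · rintro ⟨f, t⟩ ⟨hf, ht, htF⟩
    exact ⟨(hinv n m f hf t).2 ht, fun j => ⟨copies_mem hf _, fun h =>
      htF j ((copies_apply_mem_copyBoundary hf).1 h)⟩⟩
  · rintro ⟨f, t⟩ ⟨f', t'⟩ ⟨hf, ht, htF⟩ ⟨hf', ht', htF'⟩ h
    have h0 := congrFun h 0
    by_cases hff : f = f'
    · subst hff
      congr 1
      funext j
      exact copies_injective hf (congrFun h j)
    · exact absurd (mem_invariantFrontier_of_overlap hf hf' hff h0) (htF 0)
  · rintro s ⟨hs, hsm⟩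
    obtain ⟨f, hf, x, hx⟩ := copies_cover hnm (hsm 0).1
    have hr : ∀ j, ∃ y, f y = s j := by
      intro j
      induction j with
      | zero => exact ⟨x, hx⟩
      | succ j ih =>
        obtain ⟨y, hy⟩ := ih
        rcases (hQ s hs).2 j with h | h
        · exact ⟨y, hy.trans h⟩
        · rw [← hy] at h
          refine adj_mem_range_of_not_mem_invariantFrontier hf ?_ h
          intro hyF
          refine (hsm j).2 ?_
          rw [← hy]
          exact (copies_apply_mem_copyBoundary hf).2 hyF
    choose t ht using hr
    have hst : s = fun j => f (t j) := funext fun j => (ht j).symm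
    refine ⟨(f, t), ⟨hf, ?_, ?_⟩, hst.symm⟩
    · exact (hinv n m f hf t).1 (hst ▸ hs)
    · intro j hj
      refine (hsm j).2 ?_
      rw [← ht]
      exact (copies_apply_mem_copyBoundary hf).2 hj

theorem copies_self_ncard (n : ℕ) : (S.copies n n).ncard = 1 := by
  have : S.copies n n = {Subtype.val} := by
    ext f
    exact ⟨fun h => eq_val_of_copies_self h, fun h => h ▸ copies_self_mem n⟩
  rw [this, Set.ncard_singleton]

variable [X.LocallyFinite]

/-- `seqCount_copies` is applied to the pair `(n, m)` and to `(n, n)`. Both give the same inner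
count of sequences off the frontier, and the sequences lost are those through the boundary. -/
theorem abs_seqCount_sub_le {d l : ℕ} (hl : 0 < l) (hd : ∀ v, X.degree v ≤ d) {Q : Set (ℕ → V)}
    (hQ : ∀ s ∈ Q, IsCyclicWalk X l s) (hinv : S.CopyInvariant Q) {n m : ℕ} (hnm : n ≤ m) :
    |(seqCount Q (S.K m : Set V) : ℝ) - (S.copies n m).ncard * seqCount Q (S.K n : Set V)|
      ≤ (l * (d + 1) ^ l : ℕ) * ((S.copies n m).ncard *
        (invariantFrontier X S.K S.gen n).ncard) := by
  have h1 := seqCount_diff hl hd hQ (W := (S.K m : Set V)) (Finset.finite_toSet _)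
    (copyBoundary_finite (S := S) n m)
  have h2 := seqCount_diff hl hd hQ (W := (S.K n : Set V)) (Finset.finite_toSet _)
    (copyBoundary_finite (S := S) n n)
  rw [seqCount_copies hQ hinv hnm] at h1
  rw [seqCount_copies hQ hinv le_rfl, copies_self_ncard, one_mul] at h2
  have h3 := copyBoundary_ncard_le (S := S) n m
  have h4 := copyBoundary_ncard_le (S := S) n n
  rw [copies_self_ncard, one_mul] at h4
  set c := {t : ℕ → ↥(S.K n : Set V) | (fun j => (t j : V)) ∈ Q ∧
        ∀ j, t j ∉ invariantFrontier X S.K S.gen n}.ncard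
  set N := (S.copies n m).ncard
  set φ := (invariantFrontier X S.K S.gen n).ncard
  set C := l * (d + 1) ^ l
  have h5 : seqCount Q (S.K m : Set V) ≤ N * c + C * (N * φ) :=
    h1.2.trans (Nat.add_le_add_left (Nat.mul_le_mul_left _ h3) _)
  have h6 : seqCount Q (S.K n : Set V) ≤ c + C * φ :=
    h2.2.trans (Nat.add_le_add_left (Nat.mul_le_mul_left _ h4) _)
  have h7 := h1.1
  have h8 := Nat.mul_le_mul_left N h2.1
  have h9 := Nat.mul_le_mul_left N h6
  rw [abs_le]
  constructor
  · have : N * seqCount Q (S.K n : Set V) ≤ seqCount Q (S.K m : Set V) + C * (N * φ) := by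
      calc _ ≤ N * (c + C * φ) := h9
        _ = N * c + C * (N * φ) := by ring
        _ ≤ _ := Nat.add_le_add_right h7 _
    have : (N : ℝ) * seqCount Q (S.K n : Set V)
        ≤ seqCount Q (S.K m : Set V) + C * (N * φ) := by exact_mod_cast this
    linarith
  · have : seqCount Q (S.K m : Set V) ≤ N * seqCount Q (S.K n : Set V) + C * (N * φ) :=
      h5.trans (Nat.add_le_add_right h8 _)
    have : (seqCount Q (S.K m : Set V) : ℝ)
        ≤ N * seqCount Q (S.K n : Set V) + C * (N * φ) := by exact_mod_cast this
    linarith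

omit [X.LocallyFinite] in
theorem exists_subset_K (S : SelfSimilarData X) (t : Finset V) : ∃ n, t ⊆ S.K n := by
  classical
  induction t using Finset.induction_on with
  | empty => exact ⟨0, Finset.empty_subset _⟩
  | insert a t _ ih =>
    obtain ⟨n, hn⟩ := ih
    obtain ⟨k, hk⟩ := S.exhaust a
    exact ⟨max n k, Finset.insert_subset (S.mono (le_max_right n k) hk)
      (hn.trans (S.mono (le_max_left n k)))⟩

omit [X.LocallyFinite] in
theorem card_tendsto [Infinite V] (S : SelfSimilarData X) :
    Tendsto (fun n => (S.K n).card) atTop atTop := by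
  refine tendsto_atTop_mono' _ (Eventually.of_forall fun n => le_rfl) ?_
  refine tendsto_atTop_atTop_of_monotone (fun a b h => Finset.card_le_card (S.mono h)) ?_
  intro b
  obtain ⟨s, hs⟩ := Infinite.exists_subset_card_eq V b
  obtain ⟨n, hn⟩ := S.exists_subset_K s
  exact ⟨n, hs ▸ Finset.card_le_card hn⟩

/-- Vertices are the constant sequences, of period `1`, which `IsCyclicWalk` admits because it
allows consecutive terms to be equal. -/
theorem abs_card_sub_le {d : ℕ} (hd : ∀ v, X.degree v ≤ d) (S : SelfSimilarData X) {n m : ℕ}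
    (hnm : n ≤ m) :
    |((S.K m).card : ℝ) - (S.copies n m).ncard * (S.K n).card|
      ≤ (d + 1 : ℕ) * ((S.copies n m).ncard * (invariantFrontier X S.K S.gen n).ncard) := by
  let Q : Set (ℕ → V) := Set.range fun v _ => v
  have hQ : ∀ s ∈ Q, IsCyclicWalk X 1 s := by
    rintro _ ⟨v, rfl⟩
    exact ⟨fun _ => rfl, fun _ => Or.inl rfl⟩
  have hinv : S.CopyInvariant Q := by
    intro n m f hf s
    constructor
    · rintro ⟨v, hv⟩
      refine ⟨s 0, ?_⟩
      funext j
      have h0 := congrFun hv 0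
      have hj := congrFun hv j
      exact congrArg Subtype.val (copies_injective hf (h0.symm.trans hj))
    · rintro ⟨v, hv⟩
      refine ⟨f (s 0), ?_⟩
      funext j
      have h0 := congrFun hv 0
      have hj := congrFun hv j
      have : s 0 = s j := Subtype.ext (h0.symm.trans hj)
      rw [this]
  have hcount : ∀ n, seqCount Q (S.K n : Set V) = (S.K n).card := by
    intro n
    rw [seqCount, ← Set.ncard_coe_finset]
    symm
    refine Set.ncard_congr (fun v _ => fun _ => v) ?_ ?_ ?_
    · intro v hv
      exact ⟨⟨v, rfl⟩, fun _ => hv⟩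
    · intro v w _ _ h
      exact congrFun h 0
    · rintro _ ⟨⟨v, rfl⟩, hv⟩
      exact ⟨v, hv 0, rfl⟩
  have := abs_seqCount_sub_le (S := S) one_pos hd hQ hinv hnm
  simpa [hcount] using this

/-- The relative size of the invariant frontier. -/
noncomputable def frontierRatio (S : SelfSimilarData X) (n : ℕ) : ℝ :=
  ((invariantFrontier X S.K S.gen n).ncard : ℝ) / ((S.K n).card : ℝ)

omit [X.LocallyFinite] in
theorem copies_ncard_pos {n m : ℕ} (hnm : n ≤ m) (hm : 0 < (S.K m).card) :
    0 < (S.copies n m).ncard := by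
  obtain ⟨v, hv⟩ := Finset.card_pos.1 hm
  obtain ⟨f, hf, -⟩ := copies_cover hnm hv
  exact (Set.ncard_pos (copies_finite n m)).2 ⟨f, hf⟩

theorem abs_density_sub_le {d l : ℕ} (hl : 0 < l) (hd : ∀ v, X.degree v ≤ d) {Q : Set (ℕ → V)}
    (hQ : ∀ s ∈ Q, IsCyclicWalk X l s) (hinv : S.CopyInvariant Q) {n m : ℕ} (hnm : n ≤ m)
    (hn : 0 < (S.K n).card) (hε : (d + 1) * S.frontierRatio n ≤ 1 / 2) :
    |(seqCount Q (S.K m : Set V) : ℝ) / (S.K m).card - seqCount Q (S.K n : Set V) / (S.K n).card|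
      ≤ (2 * (l * (d + 1) ^ l : ℕ) * (d + 2)) * S.frontierRatio n := by
  have h1 := abs_seqCount_sub_le (S := S) hl hd hQ hinv hnm
  have h2 := abs_card_sub_le hd S hnm
  have hm : 0 < (S.K m).card := hn.trans_le (Finset.card_le_card (S.mono hnm))
  have hN := copies_ncard_pos hnm hm
  have h3 := seqCount_le hl hd hQ (W := (S.K n : Set V)) (Finset.finite_toSet _)
  rw [Set.ncard_coe_finset] at h3
  unfold frontierRatio at *
  set cm := seqCount Q (S.K m : Set V)
  set cn := seqCount Q (S.K n : Set V)
  set N := (S.copies n m).ncard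
  set φ := (invariantFrontier X S.K S.gen n).ncard
  set C := l * (d + 1) ^ l
  have hN' : (0 : ℝ) < N := by exact_mod_cast hN
  have hn' : (0 : ℝ) < (S.K n).card := by exact_mod_cast hn
  have hm' : (0 : ℝ) < (S.K m).card := by exact_mod_cast hm
  have h3' : (cn : ℝ) ≤ C * (S.K n).card := by exact_mod_cast h3
  set km : ℝ := ((S.K m).card : ℝ)
  set kn : ℝ := ((S.K n).card : ℝ)
  push_cast at h2
  have hφ : ((d : ℝ) + 1) * φ ≤ kn / 2 := by
    rw [mul_div_assoc', div_le_iff₀ hn'] at hε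
    linarith
  -- This is what the smallness of the frontier ratio is for: at least half of the points of the
  -- copies survive identification, so the denominator is of order `N * kn`.
  have hkm : N * kn / 2 ≤ km := by
    have := (abs_le.1 h2).1
    have h5 : (N : ℝ) * (((d : ℝ) + 1) * φ) ≤ N * (kn / 2) :=
      mul_le_mul_of_nonneg_left hφ hN'.le
    nlinarith
  have h6 : |cm * kn - cn * km| ≤ N * φ * kn * C * (d + 2) := by
    -- The difference of the ratios is split into the error in the count of sequences and the error
    -- in the count of vertices.
    have e : cm * kn - cn * km = (cm - N * cn) * kn - cn * (km - N * kn) := by ring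
    rw [e]
    refine (abs_sub _ _).trans ?_
    rw [abs_mul, abs_mul, abs_of_pos hn', Nat.abs_cast cn]
    calc _ ≤ (C * (N * φ)) * kn + (C * kn) * (((d : ℝ) + 1) * (N * φ)) := by gcongr
      _ = N * φ * kn * C * (d + 2) := by ring
  rw [div_sub_div _ _ hm'.ne' hn'.ne', abs_div, abs_of_pos (mul_pos hm' hn'),
    div_le_iff₀ (mul_pos hm' hn'), mul_comm km (cn : ℝ)]
  refine h6.trans ?_
  have e2 : 2 * (C : ℝ) * (d + 2) * (φ / kn) * (km * kn) = 2 * C * (d + 2) * φ * km := by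
    field_simp
  rw [e2]
  have h7 : (2 * C * (d + 2) * φ : ℝ) * (N * kn / 2) ≤ 2 * C * (d + 2) * φ * km :=
    mul_le_mul_of_nonneg_left hkm (by positivity)
  linarith

/-- The sequence is Cauchy by `abs_density_sub_le`. The quantifiers matter: `E` and `n₀` depend on
the period `l` and not on `Q`, which `exists_multiplicity` needs in order to add up infinitely many
classes. -/
theorem exists_density [Infinite V] {d : ℕ} (hd : ∀ v, X.degree v ≤ d) (S : SelfSimilarData X)
    {l : ℕ} (hl : 0 < l) :
    ∃ (E : ℕ → ℝ) (n₀ : ℕ), Tendsto E atTop (𝓝 0) ∧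
      ∀ Q : Set (ℕ → V), (∀ s ∈ Q, IsCyclicWalk X l s) → S.CopyInvariant Q → ∃ μ : ℝ,
        Tendsto (fun n => (seqCount Q (S.K n : Set V) : ℝ) / (S.K n).card) atTop (𝓝 μ) ∧
        ∀ n ≥ n₀, |μ - seqCount Q (S.K n : Set V) / (S.K n).card| ≤ E n := by
  have hε : Tendsto S.frontierRatio atTop (𝓝 0) := S.small_frontier
  have hE : Tendsto (fun n => (2 * (l * (d + 1) ^ l : ℕ) * (d + 2) : ℝ) * S.frontierRatio n) atTop
      (𝓝 0) := by
    simpa using hε.const_mul (2 * (l * (d + 1) ^ l : ℕ) * (d + 2) : ℝ)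
  have h1 : ∀ᶠ n in atTop, 0 < (S.K n).card ∧ ((d : ℝ) + 1) * S.frontierRatio n ≤ 1 / 2 := by
    refine (S.card_tendsto.eventually_gt_atTop 0).and ?_
    have : Tendsto (fun n => ((d : ℝ) + 1) * S.frontierRatio n) atTop (𝓝 0) := by
      simpa using hε.const_mul ((d : ℝ) + 1)
    exact (this.eventually_lt_const (by norm_num : (0 : ℝ) < 1 / 2)).mono fun _ h => h.le
  obtain ⟨n₀, hn₀⟩ := eventually_atTop.1 h1
  refine ⟨_, n₀, hE, ?_⟩
  intro Q hQ hinv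
  have hc : CauchySeq (fun n => (seqCount Q (S.K n : Set V) : ℝ) / (S.K n).card) := by
    rw [Metric.cauchySeq_iff']
    intro ε hεpos
    obtain ⟨n, ⟨hn1, hn2⟩, hn3⟩ := (h1.and (hE.eventually_lt_const hεpos)).exists
    refine ⟨n, fun m hm => ?_⟩
    rw [Real.dist_eq]
    exact (abs_density_sub_le hl hd hQ hinv hm hn1 hn2).trans_lt hn3
  obtain ⟨μ, hμ⟩ := cauchySeq_tendsto_of_complete hc
  refine ⟨μ, hμ, ?_⟩
  intro n hn₁
  have hn := hn₀ n hn₁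
  refine le_of_tendsto ((hμ.sub_const _).abs) ?_
  filter_upwards [eventually_ge_atTop n] with m hm
  exact abs_density_sub_le hl hd hQ hinv hm hn.1 hn.2

/-! ### Degrees -/

omit [X.LocallyFinite] in
theorem copies_ncard_tendsto [Infinite V] (S : SelfSimilarData X) (n : ℕ) :
    Tendsto (fun m => (S.copies n m).ncard) atTop atTop := by
  have h : ∀ m ≥ n, (S.K m).card ≤ (S.copies n m).ncard * (S.K n).card := by
    intro m hm
    rw [← Set.ncard_coe_finset, ← Set.ncard_coe_finset (S.K n), ← Nat.card_coe_set_eq (S.K n : Set V), ← Set.ncard_univ,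
      ← Set.ncard_prod]
    have hfin := (copies_finite (S := S) n m).prod (Set.toFinite (Set.univ : Set ↥(S.K n : Set V)))
    refine (Set.ncard_le_ncard (t := (fun p : (↥(S.K n : Set V) → V) × ↥(S.K n : Set V) => p.1 p.2)
      '' (S.copies n m ×ˢ Set.univ)) ?_ (hfin.image _)).trans (Set.ncard_image_le hfin)
    intro v hv
    obtain ⟨f, hf, x, rfl⟩ := copies_cover hm (v := v) hv
    exact ⟨(f, x), ⟨hf, trivial⟩, rfl⟩
  rw [tendsto_atTop]
  intro b
  filter_upwards [S.card_tendsto.eventually_gt_atTop (b * (S.K n).card), eventually_ge_atTop n]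
    with m hm hnm
  by_contra hlt
  have := h m hnm
  have := Nat.mul_le_mul_right (S.K n).card (not_le.1 hlt).le
  omega

/-- All neighbours of `x` lie in `K n`, so `f` maps them injectively to neighbours of `f x`. A
further neighbour of `f x` must lie outside the copy, and exists exactly when `f x` is in the
frontier of the copy. -/
theorem degree_eq_of_not_frontier {n m : ℕ} {f : ↥(S.K n : Set V) → V} (hf : f ∈ S.copies n m)
    {x : ↥(S.K n : Set V)} (hx : ∀ w, X.Adj x w → w ∈ S.K n) :
    X.degree x ≤ X.degree (f x) ∧ (f x ∉ graphFrontier X (Set.range f) →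
      X.degree (f x) = X.degree x) ∧
      (f x ∈ graphFrontier X (Set.range f) → X.degree x < X.degree (f x)) := by
  classical
  let g : V → V := fun w => if h : w ∈ (S.K n : Set V) then f ⟨w, h⟩ else w
  have hg : ∀ w (h : w ∈ (S.K n : Set V)), g w = f ⟨w, h⟩ := fun w h => dif_pos h
  have hsub : (X.neighborFinset x).image g ⊆ X.neighborFinset (f x) := by
    intro w hw
    obtain ⟨y, hy, rfl⟩ := Finset.mem_image.1 hw
    rw [SimpleGraph.mem_neighborFinset] at hy ⊢
    rw [hg y (hx y hy), copies_adj hf]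
    exact hy
  have hcard : ((X.neighborFinset x).image g).card = X.degree x := by
    rw [Finset.card_image_of_injOn, X.card_neighborFinset_eq_degree]
    intro y hy z hz h
    have hy' := hx y (by simpa using hy)
    have hz' := hx z (by simpa using hz)
    rw [hg y hy', hg z hz'] at h
    exact congrArg Subtype.val (copies_injective hf h)
  refine ⟨?_, ?_, ?_⟩
  · rw [← hcard, ← X.card_neighborFinset_eq_degree]
    exact Finset.card_le_card hsub
  · intro hfr
    rw [← hcard, ← X.card_neighborFinset_eq_degree]
    refine congrArg _ (Finset.Subset.antisymm ?_ hsub)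
    intro w hw
    rw [SimpleGraph.mem_neighborFinset] at hw
    have : w ∈ Set.range f := by
      by_contra h
      exact hfr ⟨⟨x, rfl⟩, w, h, hw⟩
    obtain ⟨y, rfl⟩ := this
    rw [copies_adj hf] at hw
    refine Finset.mem_image.2 ⟨y, by simpa using hw, ?_⟩
    rw [hg y y.2]
  · rintro ⟨-, w, hw, hadj⟩
    rw [← hcard, ← X.card_neighborFinset_eq_degree]
    refine Finset.card_lt_card ⟨hsub, fun h => ?_⟩
    have := h (x := w) (by simpa using hadj)
    obtain ⟨y, hy, rfl⟩ := Finset.mem_image.1 this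
    rw [SimpleGraph.mem_neighborFinset] at hy
    exact hw ⟨⟨y, hx y hy⟩, (hg y (hx y hy)).symm⟩

/-- Take `x` of maximal degree among the finitely many vertices of degree above `q + 1`, and `n`
such that `K n` contains `x` and its neighbours. An image of `x` in the frontier of its copy would
have larger degree, against maximality. So all images of `x` have the degree of `x`, and images
under different maps of `𝒢(n,m)` are different. Their number tends to infinity with `m`, but
exceptional vertices are finite in number. -/
theorem degree_le_of_essentially_regular [Infinite V] (S : SelfSimilarData X) {q : ℕ}
    (hq : {v | X.degree v ≠ q + 1}.Finite) (v : V) : X.degree v ≤ q + 1 := by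
  classical
  by_contra hv
  let B : Finset V := hq.toFinset.filter fun v => q + 1 < X.degree v
  have hB : ∀ w, w ∈ B ↔ q + 1 < X.degree w := by
    intro w
    simp only [B, Finset.mem_filter, Set.Finite.mem_toFinset, Set.mem_ofPred_eq]
    constructor
    · exact fun h => h.2
    · exact fun h => ⟨h.ne', h⟩
  obtain ⟨x, hxB, hmax⟩ := B.exists_max_image (fun w => X.degree w)
    ⟨v, (hB v).2 (not_le.1 hv)⟩
  have hx := (hB x).1 hxB
  obtain ⟨n, hn⟩ := S.exists_subset_K (insert x (X.neighborFinset x))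
  have hxn : x ∈ (S.K n : Set V) := hn (Finset.mem_insert_self _ _)
  have hnb : ∀ w, X.Adj x w → w ∈ S.K n := fun w hw =>
    hn (Finset.mem_insert_of_mem (by simpa using hw))
  have hnot : ∀ m, ∀ f ∈ S.copies n m, f ⟨x, hxn⟩ ∉ graphFrontier X (Set.range f) := by
    intro m f hf hfr
    have h1 := (degree_eq_of_not_frontier hf (x := ⟨x, hxn⟩) hnb).2.2 hfr
    have h2 := hmax (f ⟨x, hxn⟩) ((hB _).2 (hx.trans h1))
    exact absurd h1 (not_lt.2 h2)
  have hbound : ∀ m, (S.copies n m).ncard ≤ B.card := by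
    intro m
    rw [← Set.ncard_coe_finset]
    refine Set.ncard_le_ncard_of_injOn (fun f => f ⟨x, hxn⟩) ?_ ?_ (Finset.finite_toSet _)
    · intro f hf
      refine (hB _).2 ?_
      rw [(degree_eq_of_not_frontier hf (x := ⟨x, hxn⟩) hnb).2.1 (hnot m f hf)]
      exact hx
    · intro f hf f' hf' h
      by_contra hne
      obtain ⟨k, g, hg, hgfr⟩ := mem_invariantFrontier_of_overlap hf hf' hne h
      exact hnot k g hg hgfr
  obtain ⟨m, hm⟩ := ((S.copies_ncard_tendsto n).eventually_gt_atTop B.card).exists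
  exact absurd (hbound m) (not_le.2 hm)

end SelfSimilarData

theorem SimpleGraph.Connected.degree_pos_of_infinite {V : Type*} [Infinite V] {X : SimpleGraph V}
    [X.LocallyFinite] (hconn : X.Connected) (v : V) : 0 < X.degree v := by
  have : Nontrivial V := inferInstance
  exact hconn.preconnected.degree_pos_of_nontrivial v

/-- If `q = 0` every vertex has at most one neighbour, and a connected graph of this kind has at
most two vertices. -/
theorem one_le_of_essentially_regular {V : Type*} [Infinite V] {X : SimpleGraph V}
    [X.LocallyFinite] (hconn : X.Connected) {q : ℕ} (hdeg : ∀ v, X.degree v ≤ q + 1) : 1 ≤ q := by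
  classical
  by_contra hq
  obtain rfl : q = 0 := by omega
  obtain ⟨v⟩ : Nonempty V := inferInstance
  have h1 : ∀ v w w', X.Adj v w → X.Adj v w' → w = w' := by
    intro v w w' hw hw'
    have := hdeg v
    rw [← X.card_neighborFinset_eq_degree, zero_add, Finset.card_le_one] at this
    exact this w (by simpa using hw) w' (by simpa using hw')
  obtain ⟨w, hw⟩ := (X.degree_pos_iff_exists_adj v).1 (hconn.degree_pos_of_infinite v)
  have hall : ∀ u, u ∈ ({v, w} : Set V) := by
    intro u
    obtain ⟨p⟩ := hconn.preconnected v u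
    have : ∀ a b, X.Walk a b → a ∈ ({v, w} : Set V) → b ∈ ({v, w} : Set V) := by
      intro a b p
      induction p with
      | nil => exact id
      | cons hadj _ ih =>
        intro ha
        apply ih
        rcases ha with rfl | rfl
        · exact Or.inr (h1 _ _ _ hadj hw)
        · exact Or.inl (h1 _ _ _ hadj hw.symm)
    exact this v u p (Or.inl rfl)
  exact Set.infinite_univ (((Set.finite_singleton w).insert v).subset fun u _ => hall u)

/-! ### Matrices of a finite graph indexed by vertices and darts -/

namespace SimpleGraph

open Matrix Polynomial

section DartMatrices

variable {α : Type*} [Fintype α] [DecidableEq α] (G : SimpleGraph α) [DecidableRel G.Adj]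

/-- The incidence matrix of initial vertices. -/
def startMatrix : Matrix α G.Dart ℝ := Matrix.of fun x e => if e.fst = x then 1 else 0

/-- The incidence matrix of terminal vertices. -/
def endMatrix : Matrix G.Dart α ℝ := Matrix.of fun e y => if e.snd = y then 1 else 0

/-- The matrix of the reversal of darts. -/
def flipMatrix : Matrix G.Dart G.Dart ℝ := Matrix.of fun e e' => if e' = e.symm then 1 else 0

/-- The nonbacktracking (Hashimoto) matrix. -/
def dartMatrix : Matrix G.Dart G.Dart ℝ := G.endMatrix * G.startMatrix - G.flipMatrix

/-- The deviation of the degrees from `q + 1`. -/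
def excess (q : ℕ) (x : α) : ℝ := (G.degree x : ℝ) - (q + 1)

/-- The matrix counting nonbacktracking walks by initial and terminal vertex. -/
def walkMatrix (j : ℕ) : Matrix α α ℝ := G.startMatrix * G.dartMatrix ^ j * G.endMatrix

theorem flipMatrix_mul_self : G.flipMatrix * G.flipMatrix = 1 := by
  ext e e'
  simp only [flipMatrix, Matrix.mul_apply, Matrix.of_apply, ite_mul, one_mul, zero_mul,
    Finset.sum_ite_eq', Finset.mem_univ, if_true, Dart.symm_symm, Matrix.one_apply]
  simp only [eq_comm]

theorem start_mul_end : G.startMatrix * G.endMatrix = G.adjMatrix ℝ := by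
  ext x y
  simp only [startMatrix, endMatrix, Matrix.mul_apply, Matrix.of_apply, adjMatrix_apply]
  by_cases h : G.Adj x y
  · rw [if_pos h, Finset.sum_eq_single (⟨(x, y), h⟩ : G.Dart)]
    · simp
    · intro e _ he
      by_cases h1 : e.fst = x
      · by_cases h2 : e.snd = y
        · exact absurd (Dart.ext _ _ (Prod.ext h1 h2)) he
        · simp [h2]
      · simp [h1]
    · simp
  · rw [if_neg h]
    refine Finset.sum_eq_zero fun e _ => ?_
    by_cases h1 : e.fst = x
    · by_cases h2 : e.snd = y
      · exact absurd (h1 ▸ h2 ▸ e.adj) h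
      · simp [h2]
    · simp [h1]

theorem sum_dart_snd (x : α) :
    ∑ e : G.Dart, (if e.snd = x then (1 : ℝ) else 0) = G.degree x := by
  rw [← G.dart_fst_fiber_card_eq_degree x, Finset.sum_boole]
  congr 1
  refine Finset.card_bij (fun e _ => e.symm) ?_ ?_ ?_
  · intro e he
    simpa using he
  · intro e _ e' _ h
    exact Dart.symm_involutive.injective h
  · intro e he
    exact ⟨e.symm, by simpa using he, e.symm_symm⟩

theorem start_mul_flip :
    G.startMatrix * G.flipMatrix = Matrix.of fun x e => if e.snd = x then 1 else 0 := by
  ext x e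
  simp only [startMatrix, flipMatrix, Matrix.mul_apply, Matrix.of_apply]
  rw [Finset.sum_eq_single e.symm]
  · simp
  · intro e' _ he'
    have : e ≠ e'.symm := fun h => he' (by rw [h, Dart.symm_symm])
    simp [this]
  · simp

/-- The product is the degree matrix, split into its regular part and the deviation. -/
theorem start_mul_flip_mul_end (q : ℕ) :
    G.startMatrix * G.flipMatrix * G.endMatrix
      = ((q : ℝ) + 1) • 1 + Matrix.diagonal (G.excess q) := by
  rw [start_mul_flip]
  ext x y
  simp only [endMatrix, Matrix.mul_apply, Matrix.of_apply, Matrix.add_apply, Matrix.smul_apply,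
    smul_eq_mul]
  by_cases h : x = y
  · subst h
    simp only [mul_ite, mul_one, mul_zero, Matrix.one_apply_eq, Matrix.diagonal_apply_eq, excess]
    rw [← G.sum_dart_snd x]
    have : ∀ e : G.Dart, (if e.snd = x then if e.snd = x then (1 : ℝ) else 0 else 0)
        = if e.snd = x then 1 else 0 := fun e => by split_ifs <;> rfl
    simp only [this]
    ring
  · rw [Matrix.one_apply_ne h, Matrix.diagonal_apply_ne _ h, mul_zero, add_zero]
    refine Finset.sum_eq_zero fun e _ => ?_
    by_cases h1 : e.snd = x
    · have : e.snd ≠ y := fun h2 => h (h1.symm.trans h2)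
      simp [this]
    · simp [h1]

theorem trace_flipMatrix : Matrix.trace G.flipMatrix = 0 := by
  refine Finset.sum_eq_zero fun e _ => ?_
  simp only [Matrix.diag_apply, flipMatrix, Matrix.of_apply, ite_eq_right_iff]
  intro h
  exact absurd h.symm e.symm_ne

theorem trace_dartMatrix_mul_flip : Matrix.trace (G.dartMatrix * G.flipMatrix) = 0 := by
  -- The value `q = 0` is arbitrary: only the trace of the degree matrix is needed, which is the
  -- number of darts.
  rw [dartMatrix, Matrix.sub_mul, flipMatrix_mul_self, Matrix.trace_sub, Matrix.mul_assoc,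
    Matrix.trace_mul_comm, start_mul_flip_mul_end G 0, Matrix.trace_add, Matrix.trace_smul,
    Matrix.trace_one, Matrix.trace_one, Matrix.trace_diagonal]
  have h1 := G.sum_degrees_eq_twice_card_edges
  have h2 := G.dart_card_eq_twice_card_edges
  have h3 : ∑ x, (G.degree x : ℝ) = Fintype.card G.Dart := by
    rw [h2, ← h1]; push_cast; rfl
  simp only [excess, Finset.sum_sub_distrib, h3]
  simp

/-- A dart that ends at `x` and is reversed leaves from `x`; prescribing the first dart leaves
`degree - 1 = q + excess` choices for it. -/
theorem start_mul_dart (q : ℕ) : G.startMatrix * G.flipMatrix * G.dartMatrix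
    = (q : ℝ) • G.startMatrix + Matrix.diagonal (G.excess q) * G.startMatrix := by
  rw [dartMatrix, Matrix.mul_sub, ← Matrix.mul_assoc, start_mul_flip_mul_end G q,
    Matrix.mul_assoc G.startMatrix, flipMatrix_mul_self, Matrix.mul_one, Matrix.add_mul,
    Matrix.smul_mul, Matrix.one_mul, add_smul, one_smul]
  abel

theorem dart_mul_flip_mul_dart (q : ℕ) : G.dartMatrix * G.flipMatrix * G.dartMatrix
    = (q : ℝ) • (G.endMatrix * G.startMatrix)
      + G.endMatrix * (Matrix.diagonal (G.excess q) * G.startMatrix) - G.dartMatrix := by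
  conv_lhs => rw [dartMatrix, Matrix.sub_mul, Matrix.sub_mul, flipMatrix_mul_self, Matrix.one_mul,
    ← dartMatrix, Matrix.mul_assoc, Matrix.mul_assoc, ← Matrix.mul_assoc G.startMatrix,
    start_mul_dart G q, Matrix.mul_add, Matrix.mul_smul]

theorem walkMatrix_zero : G.walkMatrix 0 = G.adjMatrix ℝ := by
  rw [walkMatrix, pow_zero, Matrix.mul_one, start_mul_end]

theorem start_mul_dartMatrix : G.startMatrix * G.dartMatrix
    = G.adjMatrix ℝ * G.startMatrix - G.startMatrix * G.flipMatrix := by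
  rw [dartMatrix, Matrix.mul_sub, ← Matrix.mul_assoc, start_mul_end]

theorem walkMatrix_one (q : ℕ) : G.walkMatrix 1
    = G.adjMatrix ℝ * G.adjMatrix ℝ - ((q : ℝ) + 1) • 1 - Matrix.diagonal (G.excess q) := by
  rw [walkMatrix, pow_one, start_mul_dartMatrix, Matrix.sub_mul, start_mul_flip_mul_end G q,
    Matrix.mul_assoc, start_mul_end, sub_sub]

/-- `walkMatrix j` counts walks of length `j + 1`. Prepending an arbitrary edge to a nonbacktracking
walk gives the product with the adjacency matrix; the extensions that backtrack at once are removed,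
and there are `degree - 1` of them for each walk shorter by one edge. -/
theorem walkMatrix_add_two (q j : ℕ) : G.walkMatrix (j + 2)
    = G.adjMatrix ℝ * G.walkMatrix (j + 1) - (q : ℝ) • G.walkMatrix j
      - Matrix.diagonal (G.excess q) * G.walkMatrix j := by
  simp only [walkMatrix]
  rw [show j + 2 = j + 1 + 1 by ring, pow_succ' _ (j + 1), ← Matrix.mul_assoc,
    start_mul_dartMatrix, Matrix.sub_mul, Matrix.sub_mul, sub_sub]
  congr 1
  · simp only [Matrix.mul_assoc]
  · rw [pow_succ', ← Matrix.mul_assoc, start_mul_dart G q]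
    simp only [Matrix.add_mul, Matrix.smul_mul, Matrix.mul_assoc]

/-- One factor `T` is written as `R L - J`. The first part closes a nonbacktracking walk without a
condition at its origin. The second subtracts those with a tail there, and `T J T` strips the
outermost edge of the tail, which leaves shorter walks with `q + excess` choices, minus the ones
counted by `T ^ (m + 1)`. -/
theorem trace_dart_pow_add_three (q m : ℕ) : Matrix.trace (G.dartMatrix ^ (m + 3))
    = Matrix.trace (G.dartMatrix ^ (m + 1)) + Matrix.trace (G.walkMatrix (m + 2))
      - q * Matrix.trace (G.walkMatrix m)
      - Matrix.trace (G.walkMatrix m * Matrix.diagonal (G.excess q)) := by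
  set T := G.dartMatrix with hT
  set L := G.startMatrix with hL
  set R := G.endMatrix with hR
  set J := G.flipMatrix with hJ
  have e1 : Matrix.trace (T ^ (m + 3))
      = Matrix.trace (T ^ (m + 2) * (R * L)) - Matrix.trace (T ^ (m + 2) * J) := by
    rw [← Matrix.trace_sub, ← Matrix.mul_sub, show R * L - J = T from rfl, ← pow_succ]
  have e2 : ∀ k, Matrix.trace (T ^ k * (R * L)) = Matrix.trace (G.walkMatrix k) := by
    intro k
    rw [walkMatrix, ← Matrix.mul_assoc, Matrix.trace_mul_comm, ← Matrix.mul_assoc]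
  have e3 : Matrix.trace (T ^ (m + 2) * J) = Matrix.trace (T ^ m * (T * J * T)) := by
    rw [show m + 2 = 1 + m + 1 by ring, pow_succ, pow_add, pow_one, Matrix.mul_assoc,
      Matrix.mul_assoc, Matrix.trace_mul_comm, Matrix.mul_assoc]
  have e4 : Matrix.trace (T ^ m * (R * (Matrix.diagonal (G.excess q) * L)))
      = Matrix.trace (G.walkMatrix m * Matrix.diagonal (G.excess q)) := by
    rw [walkMatrix, ← Matrix.mul_assoc, ← Matrix.mul_assoc, Matrix.trace_mul_comm,
      ← Matrix.mul_assoc, ← Matrix.mul_assoc]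
  rw [e1, e2, e3, hT, dart_mul_flip_mul_dart G q, ← hT, Matrix.mul_sub, Matrix.mul_add,
    Matrix.mul_smul, Matrix.trace_sub, Matrix.trace_add, Matrix.trace_smul, e2, e4, ← pow_succ,
    smul_eq_mul]
  ring

/-! ### Entrywise bounds -/

end DartMatrices

section Bounds

variable {ι κ ν : Type*} [Fintype ι] [Fintype κ] [Fintype ν]

omit [Fintype ι] in
theorem sum_abs_mul_row_le {M : Matrix ι κ ℝ} {N : Matrix κ ν ℝ} {a b : ℝ} (hb : 0 ≤ b)
    (hM : ∀ i, ∑ k, |M i k| ≤ a) (hN : ∀ k, ∑ j, |N k j| ≤ b) (i : ι) :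
    ∑ j, |(M * N) i j| ≤ a * b := by
  calc ∑ j, |(M * N) i j| ≤ ∑ j, ∑ k, |M i k| * |N k j| := by
        refine Finset.sum_le_sum fun j _ => ?_
        rw [Matrix.mul_apply]
        refine (Finset.abs_sum_le_sum_abs _ _).trans (le_of_eq ?_)
        simp only [abs_mul]
    _ = ∑ k, |M i k| * ∑ j, |N k j| := by
        rw [Finset.sum_comm]; simp only [Finset.mul_sum]
    _ ≤ ∑ k, |M i k| * b :=
        Finset.sum_le_sum fun k _ => mul_le_mul_of_nonneg_left (hN k) (abs_nonneg _)
    _ = (∑ k, |M i k|) * b := by rw [Finset.sum_mul]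
    _ ≤ a * b := mul_le_mul_of_nonneg_right (hM i) hb

/-- The entrywise `ℓ¹` norm of a matrix. -/
def entrySum (M : Matrix ι κ ℝ) : ℝ := ∑ i, ∑ k, |M i k|

theorem entrySum_sub_le (M N : Matrix ι κ ℝ) : entrySum (M - N) ≤ entrySum M + entrySum N := by
  simp only [entrySum, ← Finset.sum_add_distrib, Matrix.sub_apply]
  exact Finset.sum_le_sum fun i _ => Finset.sum_le_sum fun k _ => abs_sub _ _

theorem entrySum_smul (c : ℝ) (M : Matrix ι κ ℝ) : entrySum (c • M) = |c| * entrySum M := by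
  simp only [entrySum, Finset.mul_sum, Matrix.smul_apply, smul_eq_mul, abs_mul]

theorem abs_trace_le_entrySum (M : Matrix ι ι ℝ) : |Matrix.trace M| ≤ entrySum M := by
  refine (Finset.abs_sum_le_sum_abs _ _).trans (Finset.sum_le_sum fun i _ => ?_)
  exact Finset.single_le_sum (f := fun k => |M i k|) (fun k _ => abs_nonneg _) (Finset.mem_univ i)

theorem entrySum_mul_le {M : Matrix ι κ ℝ} {N : Matrix κ ν ℝ} {a : ℝ}
    (hM : ∀ k, ∑ i, |M i k| ≤ a) : entrySum (M * N) ≤ a * entrySum N := by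
  calc entrySum (M * N) ≤ ∑ i, ∑ j, ∑ k, |M i k| * |N k j| := by
        refine Finset.sum_le_sum fun i _ => Finset.sum_le_sum fun j _ => ?_
        rw [Matrix.mul_apply]
        refine (Finset.abs_sum_le_sum_abs _ _).trans (le_of_eq ?_)
        simp only [abs_mul]
    _ = ∑ k, (∑ i, |M i k|) * ∑ j, |N k j| := by
        simp only [Finset.sum_mul_sum]
        rw [Finset.sum_comm (s := (Finset.univ : Finset κ))]
        refine Finset.sum_congr rfl fun i _ => ?_
        rw [Finset.sum_comm]
    _ ≤ ∑ k, a * ∑ j, |N k j| := Finset.sum_le_sum fun k _ =>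
        mul_le_mul_of_nonneg_right (hM k) (Finset.sum_nonneg fun _ _ => abs_nonneg _)
    _ = a * entrySum N := by rw [entrySum, Finset.mul_sum]

theorem entrySum_diagonal_mul_le [DecidableEq ι] {δ : ι → ℝ} {N : Matrix ι κ ℝ} {b : ℝ}
    (hN : ∀ k, ∑ j, |N k j| ≤ b) :
    entrySum (Matrix.diagonal δ * N) ≤ b * ∑ i, |δ i| := by
  rw [Finset.mul_sum]
  refine Finset.sum_le_sum fun i _ => ?_
  simp only [Matrix.diagonal_mul, abs_mul, ← Finset.mul_sum]
  rw [mul_comm]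
  exact mul_le_mul_of_nonneg_right (hN i) (abs_nonneg _)

end Bounds

section GraphBounds

variable {α : Type*} [Fintype α] [DecidableEq α] (G : SimpleGraph α) [DecidableRel G.Adj]

/-- The total deviation of the degrees from `q + 1`. -/
def totalExcess (q : ℕ) : ℝ := ∑ x, |G.excess q x|

omit [DecidableEq α] in
theorem totalExcess_nonneg (q : ℕ) : 0 ≤ G.totalExcess q :=
  Finset.sum_nonneg fun _ _ => abs_nonneg _

variable {d : ℕ} (hd : ∀ x, G.degree x ≤ d)

include hd

theorem sum_abs_startMatrix_le (x : α) : ∑ e, |G.startMatrix x e| ≤ d := by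
  have : ∀ e : G.Dart, |G.startMatrix x e| = if e.fst = x then (1 : ℝ) else 0 := by
    intro e
    simp only [startMatrix, Matrix.of_apply]
    split_ifs <;> simp
  simp only [this, Finset.sum_boole]
  rw [dart_fst_fiber_card_eq_degree]
  exact_mod_cast hd x

omit [DecidableRel G.Adj] hd in
theorem sum_abs_endMatrix_le (e : G.Dart) : ∑ x, |G.endMatrix e x| ≤ 1 := by
  have : ∀ x, |G.endMatrix e x| = if e.snd = x then (1 : ℝ) else 0 := by
    intro x
    simp only [endMatrix, Matrix.of_apply]
    split_ifs <;> simp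
  simp [this]

omit hd in
theorem sum_abs_flipMatrix_le (e : G.Dart) : ∑ e', |G.flipMatrix e e'| ≤ 1 := by
  have : ∀ e', |G.flipMatrix e e'| = if e' = e.symm then (1 : ℝ) else 0 := by
    intro x
    simp only [flipMatrix, Matrix.of_apply]
    split_ifs <;> simp
  simp [this]

theorem sum_abs_dartMatrix_le (e : G.Dart) : ∑ e', |G.dartMatrix e e'| ≤ d + 1 := by
  calc ∑ e', |G.dartMatrix e e'|
      ≤ ∑ e', (|(G.endMatrix * G.startMatrix) e e'| + |G.flipMatrix e e'|) :=
        Finset.sum_le_sum fun e' _ => abs_sub _ _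
    _ ≤ 1 * d + 1 := by
        rw [Finset.sum_add_distrib]
        exact add_le_add (sum_abs_mul_row_le (Nat.cast_nonneg _) G.sum_abs_endMatrix_le
          (G.sum_abs_startMatrix_le hd) e) (G.sum_abs_flipMatrix_le e)
    _ = d + 1 := by rw [one_mul]

theorem sum_abs_walkMatrix_le (j : ℕ) (x : α) :
    ∑ y, |G.walkMatrix j x y| ≤ d * (d + 1 : ℝ) ^ j := by
  have h : ∀ e, ∑ y, |(G.dartMatrix ^ j * G.endMatrix) e y| ≤ (d + 1 : ℝ) ^ j := by
    induction j with
    | zero => intro e; simpa using G.sum_abs_endMatrix_le e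
    | succ j ih =>
      intro e
      rw [pow_succ', Matrix.mul_assoc, pow_succ']
      exact sum_abs_mul_row_le (by positivity) (G.sum_abs_dartMatrix_le hd) ih e
  rw [walkMatrix, Matrix.mul_assoc]
  exact sum_abs_mul_row_le (by positivity) (G.sum_abs_startMatrix_le hd) h x

omit [DecidableEq α] in
theorem sum_abs_adjMatrix_le (y : α) : ∑ x, |G.adjMatrix ℝ x y| ≤ d := by
  have : ∀ x, |G.adjMatrix ℝ x y| = if G.Adj y x then (1 : ℝ) else 0 := by
    intro x
    simp only [adjMatrix_apply, G.adj_comm x y]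
    split_ifs <;> simp
  simp only [this, Finset.sum_boole]
  rw [← G.neighborFinset_eq_filter, G.card_neighborFinset_eq_degree]
  exact_mod_cast hd y

end GraphBounds

/-- The polynomials expressing nonbacktracking walks of a `(q+1)`-regular graph by powers of the
adjacency matrix. -/
noncomputable def walkPoly (q : ℕ) : ℕ → ℝ[X]
  | 0 => X
  | 1 => X ^ 2 - C ((q : ℝ) + 1)
  | j + 2 => X * walkPoly q (j + 1) - C (q : ℝ) * walkPoly q j

/-- Both sides satisfy `f (m + 2) = X f (m + 1) - q f m` and agree for `m = 0, 1`; the induction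
carries two consecutive cases. This is the trace recursion of the nonbacktracking matrix with the
excess left out. -/
theorem dickson_add_three_sub (q : ℕ) (m : ℕ) :
    dickson 1 (q : ℝ) (m + 3) - dickson 1 (q : ℝ) (m + 1)
      = walkPoly q (m + 2) - C (q : ℝ) * walkPoly q m := by
  have h0 : dickson 1 (q : ℝ) 0 = 2 := by rw [dickson_zero]; norm_num
  have key : ∀ m, (dickson 1 (q : ℝ) (m + 3) - dickson 1 (q : ℝ) (m + 1)
      = walkPoly q (m + 2) - C (q : ℝ) * walkPoly q m) ∧
      (dickson 1 (q : ℝ) (m + 4) - dickson 1 (q : ℝ) (m + 2)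
      = walkPoly q (m + 3) - C (q : ℝ) * walkPoly q (m + 1)) := by
    intro m
    induction m with
    | zero =>
      simp only [dickson_add_two, dickson_one, zero_add, h0, walkPoly, C_add, C_1]
      constructor <;> ring
    | succ m ih =>
      refine ⟨ih.2, ?_⟩
      have e1 : dickson 1 (q : ℝ) (m + 5) = X * dickson 1 (q : ℝ) (m + 4)
        - C (q : ℝ) * dickson 1 (q : ℝ) (m + 3) := dickson_add_two 1 (q : ℝ) (m + 3)
      have e2 : dickson 1 (q : ℝ) (m + 3) = X * dickson 1 (q : ℝ) (m + 2)
        - C (q : ℝ) * dickson 1 (q : ℝ) (m + 1) := dickson_add_two 1 (q : ℝ) (m + 1)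
      have e3 : walkPoly q (m + 4) = X * walkPoly q (m + 3) - C (q : ℝ) * walkPoly q (m + 2) := rfl
      have e4 : walkPoly q (m + 2) = X * walkPoly q (m + 1) - C (q : ℝ) * walkPoly q m := rfl
      change dickson 1 (q : ℝ) (m + 5) - dickson 1 (q : ℝ) (m + 3)
        = walkPoly q (m + 4) - C (q : ℝ) * walkPoly q (m + 2)
      linear_combination e1 - e2 + X * ih.2 - C (q : ℝ) * ih.1 - e3 + C (q : ℝ) * e4
  exact (key m).1

-- Comparison of nonbacktracking counts with polynomials in the adjacency matrix

universe u

/-- The recursions for `walkMatrix` and `walkPoly` differ by terms with the factor `diagonal (excess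
q)`, whose entrywise norm is at most a row sum bound times the total excess. The constant is chosen
before the graph, so that it serves all `K n` at once. -/
theorem exists_entrySum_walkMatrix_sub_le (d q : ℕ) (j : ℕ) :
    ∃ c : ℝ, 0 ≤ c ∧ ∀ {α : Type u} [Fintype α] [DecidableEq α] (G : SimpleGraph α)
      [DecidableRel G.Adj], (∀ x, G.degree x ≤ d) →
      entrySum (G.walkMatrix j - aeval (G.adjMatrix ℝ) (walkPoly q j)) ≤ c * G.totalExcess q := by
  induction j using Nat.twoStepInduction with
  | zero =>
    refine ⟨0, le_rfl, ?_⟩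
    intro α _ _ G _ _
    simp [walkMatrix_zero, walkPoly, entrySum]
  | one =>
    refine ⟨1, zero_le_one, ?_⟩
    intro α _ _ G _ _
    have : G.walkMatrix 1 - aeval (G.adjMatrix ℝ) (walkPoly q 1)
        = (0 : Matrix α α ℝ) - Matrix.diagonal (G.excess q) * 1 := by
      rw [walkMatrix_one G q, walkPoly, map_sub, map_pow, aeval_X, aeval_C, pow_two,
        Algebra.algebraMap_eq_smul_one, Matrix.mul_one]
      abel
    rw [this]
    refine (entrySum_sub_le _ _).trans ?_
    have h0 : entrySum (0 : Matrix α α ℝ) = 0 := by simp [entrySum]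
    rw [h0, zero_add]
    refine entrySum_diagonal_mul_le ?_
    intro k
    have : ∀ j, |(1 : Matrix α α ℝ) k j| = if k = j then 1 else 0 := by
      intro j
      rw [Matrix.one_apply]
      split_ifs <;> simp
    simp [this]
  | more j ih1 ih2 =>
    obtain ⟨c1, hc1, h1⟩ := ih1
    obtain ⟨c2, hc2, h2⟩ := ih2
    refine ⟨d * c2 + q * c1 + d * (d + 1 : ℝ) ^ j, by positivity, ?_⟩
    intro α _ _ G _ hd
    have e : G.walkMatrix (j + 2) - aeval (G.adjMatrix ℝ) (walkPoly q (j + 2))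
        = G.adjMatrix ℝ * (G.walkMatrix (j + 1) - aeval (G.adjMatrix ℝ) (walkPoly q (j + 1)))
          - (q : ℝ) • (G.walkMatrix j - aeval (G.adjMatrix ℝ) (walkPoly q j))
          - Matrix.diagonal (G.excess q) * G.walkMatrix j := by
      rw [walkMatrix_add_two G q, walkPoly, map_sub, map_mul, map_mul, aeval_X, aeval_C,
        Algebra.algebraMap_eq_smul_one, Matrix.smul_mul, Matrix.one_mul, Matrix.mul_sub, smul_sub]
      abel
    rw [e]
    refine (entrySum_sub_le _ _).trans ((add_le_add (entrySum_sub_le _ _) le_rfl).trans ?_)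
    rw [entrySum_smul, Nat.abs_cast, add_mul, add_mul, mul_assoc, mul_assoc]
    refine add_le_add (add_le_add ?_ ?_) ?_
    · exact (entrySum_mul_le (G.sum_abs_adjMatrix_le hd)).trans
        (mul_le_mul_of_nonneg_left (h2 G hd) (Nat.cast_nonneg _))
    · exact mul_le_mul_of_nonneg_left (h1 G hd) (Nat.cast_nonneg _)
    · exact entrySum_diagonal_mul_le (G.sum_abs_walkMatrix_le hd j)

theorem abs_trace_mul_diagonal_le {α : Type*} [Fintype α] [DecidableEq α] {M : Matrix α α ℝ}
    {b : ℝ} (hM : ∀ x, ∑ y, |M x y| ≤ b) (δ : α → ℝ) :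
    |Matrix.trace (M * Matrix.diagonal δ)| ≤ b * ∑ x, |δ x| := by
  rw [Matrix.trace_mul_comm]
  exact (abs_trace_le_entrySum _).trans (entrySum_diagonal_mul_le hM)

/-- The correction term `q - 1` for even lengths. -/
def evenTerm (q m : ℕ) : ℝ := if Even m then (q : ℝ) - 1 else 0

/-- The step of two follows from `trace_dart_pow_add_three` and `dickson_add_three_sub`. The term `q
- 1` arises at length two, where `X ^ 2 - (q + 1)` for the walks faces `X ^ 2 - 2 q` for the Dickson
polynomial, and the step of two carries it to all even lengths. -/
theorem exists_trace_dart_pow_sub_le (d q : ℕ) (m : ℕ) :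
    ∃ c : ℝ, 0 ≤ c ∧ ∀ {α : Type u} [Fintype α] [DecidableEq α] (G : SimpleGraph α)
      [DecidableRel G.Adj], (∀ x, G.degree x ≤ d) →
      |Matrix.trace (G.dartMatrix ^ (m + 1))
        - (Matrix.trace (aeval (G.adjMatrix ℝ) (dickson 1 (q : ℝ) (m + 1)))
          + evenTerm q (m + 1) * Fintype.card α)| ≤ c * G.totalExcess q := by
  induction m using Nat.twoStepInduction with
  | zero =>
    refine ⟨0, le_rfl, ?_⟩
    intro α _ _ G _ _
    rw [zero_add, pow_one, dickson_one, aeval_X, dartMatrix, Matrix.trace_sub, trace_flipMatrix,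
      Matrix.trace_mul_comm, start_mul_end]
    simp [evenTerm]
  | one =>
    obtain ⟨c, hc, h⟩ := exists_entrySum_walkMatrix_sub_le d q 1
    refine ⟨c, hc, ?_⟩
    intro α _ _ G _ hd
    refine le_trans ?_ ((abs_trace_le_entrySum _).trans (h G hd))
    refine le_of_eq (congrArg _ ?_)
    have e1 : Matrix.trace (G.dartMatrix ^ (1 + 1)) = Matrix.trace (G.walkMatrix 1) := by
      rw [pow_succ, pow_one]
      conv_lhs => rw [dartMatrix, Matrix.mul_sub, ← dartMatrix, Matrix.trace_sub,
        trace_dartMatrix_mul_flip, sub_zero, ← Matrix.mul_assoc, Matrix.trace_mul_comm,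
        ← Matrix.mul_assoc]
      rw [walkMatrix, pow_one]
    rw [e1, Matrix.trace_sub, dickson_add_two, zero_add, dickson_one, dickson_zero, walkPoly]
    congr 1
    simp only [map_sub, map_mul, map_pow, aeval_X, aeval_C, evenTerm, Matrix.trace_sub,
      Algebra.algebraMap_eq_smul_one, Matrix.trace_smul, Matrix.trace_one,
      Nat.cast_one, map_ofNat, map_one]
    -- The Dickson polynomial of index `0` is by definition `3 - k` with `k = 1`, which is why the
    -- constant `2` appears as `3 - 1`.
    rw [pow_two, show ((3 : Matrix α α ℝ) - 1) = (2 : ℝ) • 1 by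
      rw [ofNat_smul_eq_nsmul, two_nsmul]; norm_num, Matrix.mul_smul, Matrix.mul_one,
      Matrix.trace_smul, Matrix.trace_smul, Matrix.trace_one]
    simp
    ring
  | more m ih1 _ =>
    obtain ⟨c, hc, h⟩ := ih1
    obtain ⟨c2, hc2, h2⟩ := exists_entrySum_walkMatrix_sub_le d q (m + 2)
    obtain ⟨c0, hc0, h0⟩ := exists_entrySum_walkMatrix_sub_le d q m
    refine ⟨c + c2 + q * c0 + d * (d + 1 : ℝ) ^ m, by positivity, ?_⟩
    intro α _ _ G _ hd
    have hh := h G hd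
    have hh2 := (abs_trace_le_entrySum _).trans (h2 G hd)
    have hh0 := (abs_trace_le_entrySum _).trans (h0 G hd)
    have hhd := abs_trace_mul_diagonal_le (G.sum_abs_walkMatrix_le hd m) (G.excess q)
    rw [Matrix.trace_sub] at hh2 hh0
    have hdick : Matrix.trace (aeval (G.adjMatrix ℝ) (dickson 1 (q : ℝ) (m + 3)))
        = Matrix.trace (aeval (G.adjMatrix ℝ) (dickson 1 (q : ℝ) (m + 1)))
          + Matrix.trace (aeval (G.adjMatrix ℝ) (walkPoly q (m + 2)))
          - q * Matrix.trace (aeval (G.adjMatrix ℝ) (walkPoly q m)) := by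
      have := congrArg (fun p => Matrix.trace (aeval (G.adjMatrix ℝ) p)) (dickson_add_three_sub q m)
      simp only [map_sub, map_mul, aeval_C, Matrix.trace_sub, Algebra.algebraMap_eq_smul_one,
        Matrix.smul_mul, Matrix.one_mul, Matrix.trace_smul, smul_eq_mul] at this
      linarith
    have heven : evenTerm q (m + 3) = evenTerm q (m + 1) := by
      simp [evenTerm, Nat.even_add, parity_simps]
    change |Matrix.trace (G.dartMatrix ^ (m + 3))
        - (Matrix.trace (aeval (G.adjMatrix ℝ) (dickson 1 (q : ℝ) (m + 3)))
          + evenTerm q (m + 3) * Fintype.card α)| ≤ _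
    rw [trace_dart_pow_add_three G q, hdick, heven]
    change |_| ≤ d * (d + 1 : ℝ) ^ m * G.totalExcess q at hhd
    have hq0 : (0 : ℝ) ≤ q := Nat.cast_nonneg _
    rw [abs_le] at *
    have a1 := mul_le_mul_of_nonneg_left hh0.1 hq0
    have a2 := mul_le_mul_of_nonneg_left hh0.2 hq0
    constructor <;> linarith [hh.1, hh.2, hh2.1, hh2.2, hhd.1, hhd.2]

end SimpleGraph

/-! ### Traces of powers and periodic sequences -/

section RelationMatrix

variable {α : Type*} [Fintype α] [DecidableEq α] (r : α → α → Prop) [DecidableRel r]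

theorem relMatrix_pow_apply (m : ℕ) (i j : α) :
    ((Matrix.of fun i j => if r i j then (1 : ℝ) else 0) ^ m) i j
      = ((Finset.univ.filter fun p : Fin (m + 1) → α => p 0 = i ∧ p (Fin.last m) = j ∧
          ∀ k : Fin m, r (p k.castSucc) (p k.succ)).card : ℝ) := by
  induction m generalizing i with
  | zero =>
    rw [pow_zero, Matrix.one_apply]
    split_ifs with h
    · subst h
      have : (Finset.univ.filter fun p : Fin 1 → α => p 0 = i ∧ p (Fin.last 0) = i ∧
          ∀ k : Fin 0, r (p k.castSucc) (p k.succ)) = {fun _ => i} := by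
        ext p
        simp only [Finset.mem_filter, Finset.mem_univ, true_and, Finset.mem_singleton]
        constructor
        · rintro ⟨h, -⟩
          funext k
          rw [Fin.fin_one_eq_zero k, h]
        · rintro rfl
          exact ⟨rfl, rfl, fun k => k.elim0⟩
      refine Eq.trans ?_ (congrArg (fun s : Finset (Fin 1 → α) => (s.card : ℝ)) this.symm)
      simp
    · symm
      rw [Nat.cast_eq_zero, Finset.card_eq_zero, Finset.filter_eq_empty_iff]
      rintro p - ⟨h1, h2, -⟩
      exact h (h1.symm.trans h2)
  | succ m ih =>
    rw [pow_succ', Matrix.mul_apply]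
    simp only [ih, Matrix.of_apply, ite_mul, one_mul, zero_mul]
    rw [← Finset.sum_filter, ← Nat.cast_sum, ← Finset.card_sigma]
    congr 1
    refine Finset.card_bij' (fun x _ => Fin.cons i x.2) (fun p _ => ⟨p 1, Fin.tail p⟩) ?_ ?_ ?_ ?_
    · rintro ⟨k, p⟩ hp
      simp only [Finset.mem_sigma, Finset.mem_filter, Finset.mem_univ, true_and] at hp ⊢
      obtain ⟨hik, h0, hl, hr⟩ := hp
      refine ⟨Fin.cons_zero _ _, ?_, ?_⟩
      · rw [← Fin.succ_last, Fin.cons_succ]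
        exact hl
      · intro k'
        refine Fin.cases ?_ (fun k' => ?_) k'
        · rw [Fin.castSucc_zero, Fin.cons_zero, Fin.cons_succ, h0]
          exact hik
        · rw [← Fin.succ_castSucc, Fin.cons_succ, Fin.cons_succ]
          exact hr k'
    · intro p hp
      simp only [Finset.mem_sigma, Finset.mem_filter, Finset.mem_univ, true_and] at hp ⊢
      obtain ⟨h0, hl, hr⟩ := hp
      refine ⟨?_, rfl, ?_, ?_⟩
      · rw [← h0]
        exact hr 0
      · rw [← hl]
        rfl
      · intro k
        exact hr k.succ
    · rintro ⟨k, p⟩ hp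
      simp only [Finset.mem_sigma, Finset.mem_filter, Finset.mem_univ, true_and] at hp
      obtain ⟨hik, h0, hl, hr⟩ := hp
      subst h0
      simp only [Fin.tail_cons, Sigma.mk.injEq, heq_eq_eq, and_true]
      rfl
    · intro p hp
      simp only [Finset.mem_filter, Finset.mem_univ, true_and] at hp
      rw [← hp.1]
      exact Fin.cons_self_tail p

/-- A diagonal entry counts strings of `m + 1` terms with equal ends, which unroll to periodic
sequences. The relation is general so that it covers both adjacency of vertices and admissible
succession of darts. -/
theorem trace_relMatrix_pow {m : ℕ} (hm : 0 < m) :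
    Matrix.trace ((Matrix.of fun i j => if r i j then (1 : ℝ) else 0) ^ m)
      = ({s : ℕ → α | (∀ j, s (j + m) = s j) ∧ ∀ j, r (s j) (s (j + 1))}.ncard : ℝ) := by
  have h1 : Matrix.trace ((Matrix.of fun i j => if r i j then (1 : ℝ) else 0) ^ m)
      = ((Finset.univ.filter fun p : Fin (m + 1) → α => p (Fin.last m) = p 0 ∧
          ∀ k : Fin m, r (p k.castSucc) (p k.succ)).card : ℝ) := by
    simp only [Matrix.trace, Matrix.diag_apply, relMatrix_pow_apply]
    rw [← Nat.cast_sum]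
    congr 1
    rw [Finset.card_eq_sum_card_fiberwise (f := fun p => p 0) (t := Finset.univ)
      (fun _ _ => Finset.mem_coe.2 (Finset.mem_univ _))]
    refine Finset.sum_congr rfl fun i _ => ?_
    congr 1
    ext p
    simp only [Finset.mem_filter, Finset.mem_univ, true_and]
    constructor
    · rintro ⟨h0, hl, hr⟩
      exact ⟨⟨hl.trans h0.symm, hr⟩, h0⟩
    · rintro ⟨⟨hl, hr⟩, h0⟩
      exact ⟨h0, hl.trans h0, hr⟩
  rw [h1, ← Set.ncard_coe_finset]
  congr 1
  have hper : ∀ s : ℕ → α, (∀ j, s (j + m) = s j) → ∀ j, s (j % m) = s j := by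
    intro s hs
    have : ∀ k r, s (r + m * k) = s r := by
      intro k
      induction k with
      | zero => intro r; rfl
      | succ k ih => intro r; rw [Nat.mul_succ, ← add_assoc, hs, ih]
    intro j
    conv_rhs => rw [← Nat.mod_add_div j m, this]
  have hlt : ∀ j, j % m < m + 1 := fun j => (Nat.mod_lt j hm).trans (Nat.lt_succ_self m)
  refine Set.ncard_congr (fun p _ => fun j => p ⟨j % m, hlt j⟩) ?_ ?_ ?_
  · intro p hp
    obtain ⟨hl, hr⟩ := (Finset.mem_filter.1 hp).2
    refine ⟨fun j => by simp only [Nat.add_mod_right], fun j => ?_⟩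
    have hj := Nat.mod_lt j hm
    have := hr ⟨j % m, hj⟩
    have e2 : p (Fin.succ ⟨j % m, hj⟩) = p ⟨(j + 1) % m, hlt _⟩ := by
      -- At the end of a period the string shows its last entry and the sequence its first; the
      -- closing condition identifies them.
      by_cases h : j % m + 1 = m
      · have e : (j + 1) % m = 0 := by
          rw [← Nat.mod_add_mod, h, Nat.mod_self]
        have e3 : (⟨(j + 1) % m, hlt _⟩ : Fin (m + 1)) = 0 := Fin.ext e
        have e4 : Fin.succ ⟨j % m, hj⟩ = Fin.last m := Fin.ext h
        rw [e3, e4, hl]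
      · congr 1
        apply Fin.ext
        change j % m + 1 = (j + 1) % m
        rw [← Nat.mod_add_mod, Nat.mod_eq_of_lt (by omega : j % m + 1 < m)]
    rw [e2] at this
    exact this
  · intro p p' hp hp' h
    obtain ⟨hl, -⟩ := (Finset.mem_filter.1 hp).2
    obtain ⟨hl', -⟩ := (Finset.mem_filter.1 hp').2
    have key : ∀ k : ℕ, (hk : k < m) → p ⟨k, hk.trans (Nat.lt_succ_self m)⟩
        = p' ⟨k, hk.trans (Nat.lt_succ_self m)⟩ := by
      intro k hk
      have := congrFun h k
      simp only [Nat.mod_eq_of_lt hk] at this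
      exact this
    funext ⟨k, hk⟩
    rcases Nat.lt_succ_iff_lt_or_eq.1 hk with h' | rfl
    · exact key k h'
    · exact hl.trans ((key 0 hm).trans hl'.symm)
  · rintro s ⟨hs, hr⟩
    refine ⟨fun k => s k, Finset.mem_coe.2 (Finset.mem_filter.2 ⟨Finset.mem_univ _, ?_, ?_⟩), ?_⟩
    · change s m = s 0
      have := hs 0
      rwa [zero_add] at this
    · intro k
      exact hr k
    · funext j
      exact hper s hs j

end RelationMatrix

/-- Closed walks of length `l`, as periodic sequences. -/
def closedSeqs {V : Type*} (X : SimpleGraph V) (l : ℕ) : Set (ℕ → V) :=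
  {s | (∀ j, s (j + l) = s j) ∧ ∀ j, X.Adj (s j) (s (j + 1))}

/-- Reduced closed walks of length `l`, as periodic sequences. -/
def reducedSeqs {V : Type*} (X : SimpleGraph V) (l : ℕ) : Set (ℕ → V) :=
  {s | s ∈ closedSeqs X l ∧ ∀ j, s j ≠ s (j + 2)}

theorem isCyclicWalk_of_mem_closedSeqs {V : Type*} {X : SimpleGraph V} {l : ℕ} :
    ∀ s ∈ closedSeqs X l, IsCyclicWalk X l s :=
  fun _ hs => ⟨hs.1, fun j => Or.inr (hs.2 j)⟩

section InducedGraph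

variable {V : Type*} (X : SimpleGraph V) (W : Set V) [Fintype W] [DecidableEq W]
  [DecidableRel (X.induce W).Adj]

theorem trace_adjMatrix_induce_pow {m : ℕ} (hm : 0 < m) :
    Matrix.trace ((X.induce W).adjMatrix ℝ ^ m) = seqCount (closedSeqs X m) W := by
  have e : (X.induce W).adjMatrix ℝ
      = Matrix.of fun i j => if (X.induce W).Adj i j then (1 : ℝ) else 0 := by
    ext i j
    simp only [SimpleGraph.adjMatrix_apply, Matrix.of_apply]
  rw [e, trace_relMatrix_pow _ hm]
  congr 1
  refine Set.ncard_congr (fun s _ => fun j => (s j : V)) ?_ ?_ ?_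
  · rintro s ⟨h1, h2⟩
    exact ⟨⟨fun j => congrArg Subtype.val (h1 j), h2⟩, fun j => (s j).2⟩
  · intro s t _ _ h
    funext j
    exact Subtype.ext (congrFun h j)
  · rintro s ⟨⟨h1, h2⟩, hW⟩
    exact ⟨fun j => ⟨s j, hW j⟩, ⟨fun j => Subtype.ext (h1 j), h2⟩, rfl⟩

/-- The matrix is the indicator of "`e'` follows `e` and is not its reversal". A periodic chain of
darts is determined by its initial vertices, and the nonreversal condition becomes `s j ≠ s (j +
2)`. -/
theorem trace_dartMatrix_induce_pow {m : ℕ} (hm : 0 < m) :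
    Matrix.trace ((X.induce W).dartMatrix ^ m) = seqCount (reducedSeqs X m) W := by
  have e : (X.induce W).dartMatrix = Matrix.of fun e e' : (X.induce W).Dart =>
      if e.snd = e'.fst ∧ e.fst ≠ e'.snd then (1 : ℝ) else 0 := by
    ext e e'
    simp only [SimpleGraph.dartMatrix, SimpleGraph.endMatrix, SimpleGraph.startMatrix,
      SimpleGraph.flipMatrix, Matrix.sub_apply, Matrix.mul_apply, Matrix.of_apply, ite_mul, one_mul,
      zero_mul, Finset.sum_ite_eq, Finset.mem_univ, if_true]
    by_cases h : e.snd = e'.fst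
    · by_cases h' : e.fst = e'.snd
      · have : e' = e.symm := SimpleGraph.Dart.ext _ _ (Prod.ext h.symm h'.symm)
        simp [this]
      · have : e' ≠ e.symm := by
          rintro rfl
          exact h' rfl
        simp [this, h, h']
    · have : e' ≠ e.symm := by
        rintro rfl
        exact h rfl
      simp [this, h, Ne.symm h]
  rw [e, trace_relMatrix_pow _ hm]
  congr 1
  refine Set.ncard_congr (fun s _ => fun j => ((s j).fst : V)) ?_ ?_ ?_
  · rintro s ⟨h1, h2⟩
    refine ⟨⟨⟨fun j => ?_, fun j => ?_⟩, fun j => ?_⟩, fun j => (s j).fst.2⟩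
    · simp only [h1 j]
    · simp only [← (h2 j).1]
      exact (s j).adj
    · have h3 := (h2 j).2
      rw [(h2 (j + 1)).1] at h3
      exact fun h => h3 (Subtype.ext h)
  · rintro s t ⟨-, hs⟩ ⟨-, ht⟩ h
    funext j
    refine SimpleGraph.Dart.ext _ _ (Prod.ext (Subtype.ext (congrFun h j)) ?_)
    rw [(hs j).1, (ht j).1]
    exact Subtype.ext (congrFun h (j + 1))
  · rintro s ⟨⟨⟨h1, h2⟩, h3⟩, hW⟩
    refine ⟨fun j => ⟨(⟨s j, hW j⟩, ⟨s (j + 1), hW (j + 1)⟩), h2 j⟩, ⟨fun j => ?_, fun j => ?_⟩, rfl⟩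
    · refine SimpleGraph.Dart.ext _ _ (Prod.ext (Subtype.ext (h1 j)) (Subtype.ext ?_))
      change s (j + m + 1) = s (j + 1)
      rw [show j + m + 1 = j + 1 + m by ring, h1]
    · exact ⟨rfl, fun h => h3 j (congrArg Subtype.val h)⟩

end InducedGraph

/-! ### Counts per vertex along the exhaustion -/

namespace SelfSimilarData

variable {V : Type*} {X : SimpleGraph V} [X.LocallyFinite] (S : SelfSimilarData X)

omit [X.LocallyFinite] in
theorem copyInvariant_closedSeqs (l : ℕ) : S.CopyInvariant (closedSeqs X l) := by
  intro n m f hf s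
  simp only [closedSeqs, Set.mem_ofPred_eq, (copies_injective hf).eq_iff, copies_adj hf,
    ← Subtype.ext_iff]

omit [X.LocallyFinite] in
theorem copyInvariant_reducedSeqs (l : ℕ) : S.CopyInvariant (reducedSeqs X l) := by
  intro n m f hf s
  simp only [reducedSeqs, closedSeqs, Set.mem_ofPred_eq, (copies_injective hf).eq_iff,
    copies_adj hf, ← Subtype.ext_iff, Ne]

theorem degree_induce_le' (W : Set V) [Fintype W] [DecidableRel (X.induce W).Adj] (x : W) :
    (X.induce W).degree x ≤ X.degree x := by
  rw [← SimpleGraph.card_neighborFinset_eq_degree, ← SimpleGraph.card_neighborFinset_eq_degree]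
  refine Finset.card_le_card_of_injOn Subtype.val ?_ Subtype.val_injective.injOn
  intro y hy
  simpa using hy

theorem degree_induce_eq (W : Set V) [Fintype W] [DecidableRel (X.induce W).Adj] (x : W)
    (hx : (x : V) ∉ graphFrontier X W) : (X.induce W).degree x = X.degree x := by
  rw [← SimpleGraph.card_neighborFinset_eq_degree, ← SimpleGraph.card_neighborFinset_eq_degree]
  refine Finset.card_bij (fun y _ => (y : V)) ?_ ?_ ?_
  · intro y hy
    simpa using hy
  · intro y _ z _ h
    exact Subtype.ext h
  · intro y hy
    have hy' : X.Adj x y := by simpa using hy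
    have hyW : y ∈ W := by
      by_contra h
      exact hx ⟨x.2, y, h, hy'⟩
    exact ⟨⟨y, hyW⟩, by simpa using hy', rfl⟩

-- Inside `K n` the degree is `q + 1` except at frontier vertices and at the finitely many
-- exceptional vertices, and each of these contributes at most `d + q + 1`.
open Classical in
theorem totalExcess_tendsto [Infinite V] {d q : ℕ} (hd : ∀ v, X.degree v ≤ d)
    (hq : {v | X.degree v ≠ q + 1}.Finite) :
    Tendsto (fun n => (X.induce (S.K n : Set V)).totalExcess q / (S.K n).card) atTop (𝓝 0) := by
  have hb : ∀ n, (X.induce (S.K n : Set V)).totalExcess q / (S.K n).card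
      ≤ (d + (q + 1)) * (((graphFrontier X (S.K n : Set V)).ncard : ℝ) / (S.K n).card
        + ({v | X.degree v ≠ q + 1}.ncard : ℝ) / (S.K n).card) := by
    intro n
    rw [← add_div, mul_div_assoc']
    refine div_le_div_of_nonneg_right ?_ (Nat.cast_nonneg _)
    let B : Finset ↥(S.K n : Set V) := Finset.univ.filter fun x =>
      (x : V) ∈ graphFrontier X (S.K n : Set V) ∪ {v | X.degree v ≠ q + 1}
    have h1 : ∀ x ∉ B, |(X.induce (S.K n : Set V)).excess q x| = 0 := by
      intro x hx
      simp only [B, Finset.mem_filter, Finset.mem_univ, true_and, Set.mem_union, not_or,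
        Set.mem_ofPred_eq, not_not] at hx
      rw [SimpleGraph.excess, degree_induce_eq _ _ hx.1, hx.2]
      simp
    have h2 : ∀ x, |(X.induce (S.K n : Set V)).excess q x| ≤ d + (q + 1) := by
      intro x
      have h3 := (degree_induce_le' (S.K n : Set V) x).trans (hd x)
      have h4 : ((X.induce (S.K n : Set V)).degree x : ℝ) ≤ d := by exact_mod_cast h3
      rw [SimpleGraph.excess, abs_le]
      have h5 : (0 : ℝ) ≤ (X.induce (S.K n : Set V)).degree x := Nat.cast_nonneg _
      have h6 : (0 : ℝ) ≤ d := Nat.cast_nonneg _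
      have h7 : (0 : ℝ) ≤ q := Nat.cast_nonneg _
      constructor <;> linarith
    have h3 : (X.induce (S.K n : Set V)).totalExcess q ≤ B.card * ((d : ℝ) + (q + 1)) := by
      rw [SimpleGraph.totalExcess, ← Finset.sum_subset (Finset.subset_univ B) fun x _ hx => h1 x hx,
        ← nsmul_eq_mul]
      exact Finset.sum_le_card_nsmul _ _ _ fun x _ => h2 x
    have hfr : (graphFrontier X (S.K n : Set V)).Finite :=
      (Finset.finite_toSet (S.K n)).subset fun v hv => hv.1
    have h4 : B.card ≤ (graphFrontier X (S.K n : Set V)).ncard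
        + {v | X.degree v ≠ q + 1}.ncard := by
      refine le_trans ?_ (Set.ncard_union_le _ _)
      rw [← Set.ncard_coe_finset]
      refine Set.ncard_le_ncard_of_injOn Subtype.val ?_ Subtype.val_injective.injOn (hfr.union hq)
      intro x hx
      exact (Finset.mem_filter.1 hx).2
    have h4' : (B.card : ℝ) ≤ (graphFrontier X (S.K n : Set V)).ncard
        + {v | X.degree v ≠ q + 1}.ncard := by exact_mod_cast h4
    calc _ ≤ _ := h3
      _ ≤ ((graphFrontier X (S.K n : Set V)).ncard
        + {v | X.degree v ≠ q + 1}.ncard : ℝ) * ((d : ℝ) + (q + 1)) :=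
          mul_le_mul_of_nonneg_right h4' (by positivity)
      _ = _ := by ring
  refine squeeze_zero (fun n => div_nonneg (SimpleGraph.totalExcess_nonneg _ _)
    (Nat.cast_nonneg _)) hb ?_
  have h1 : Tendsto (fun n => ({v | X.degree v ≠ q + 1}.ncard : ℝ) / (S.K n).card) atTop (𝓝 0) :=
    tendsto_const_nhds.div_atTop (tendsto_natCast_atTop_atTop.comp S.card_tendsto)
  simpa using (S.amenable.add h1).const_mul ((d : ℝ) + (q + 1))

/-- By the handshake identity `|V| - |E|` differs from `(1 - q)/2 * |V|` by half the sum of the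
excesses. -/
theorem eulerChar_tendsto [Infinite V] {d q : ℕ} (hd : ∀ v, X.degree v ≤ d)
    (hq : {v | X.degree v ≠ q + 1}.Finite) :
    Tendsto (fun n => S.eulerChar n / ((S.K n).card : ℝ)) atTop (𝓝 ((1 - (q : ℝ)) / 2)) := by
  classical
  have h1 : ∀ n, |S.eulerChar n - (1 - (q : ℝ)) / 2 * (S.K n).card|
      ≤ (X.induce (S.K n : Set V)).totalExcess q := by
    intro n
    have h2 := (X.induce (S.K n : Set V)).sum_degrees_eq_twice_card_edges
    have h3 : (X.induce (S.K n : Set V)).edgeSet.ncard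
        = (X.induce (S.K n : Set V)).edgeFinset.card := by
      rw [← SimpleGraph.coe_edgeFinset, Set.ncard_coe_finset]
    have h4 : ∑ x, (X.induce (S.K n : Set V)).excess q x
        = 2 * ((X.induce (S.K n : Set V)).edgeSet.ncard : ℝ) - (S.K n).card * (q + 1) := by
      simp only [SimpleGraph.excess, Finset.sum_sub_distrib, Finset.sum_const, nsmul_eq_mul]
      rw [h3, ← Nat.cast_sum, h2]
      simp
    have h5 : S.eulerChar n - (1 - (q : ℝ)) / 2 * (S.K n).card
        = -(1 / 2 * ∑ x, (X.induce (S.K n : Set V)).excess q x) := by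
      rw [h4, eulerChar]; ring
    rw [h5, abs_neg, abs_mul]
    have h6 : |∑ x, (X.induce (S.K n : Set V)).excess q x|
        ≤ (X.induce (S.K n : Set V)).totalExcess q := Finset.abs_sum_le_sum_abs _ _
    have h7 := SimpleGraph.totalExcess_nonneg (X.induce (S.K n : Set V)) q
    rw [abs_of_pos (by norm_num : (0 : ℝ) < 1 / 2)]
    linarith
  have h2 := S.totalExcess_tendsto hd hq
  rw [tendsto_iff_norm_sub_tendsto_zero]
  refine squeeze_zero' (Eventually.of_forall fun n => norm_nonneg _) ?_ h2
  filter_upwards [S.card_tendsto.eventually_gt_atTop 0] with n hn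
  have hn' : (0 : ℝ) < (S.K n).card := by exact_mod_cast hn
  rw [Real.norm_eq_abs, div_sub' hn'.ne', abs_div, abs_of_pos hn', mul_comm]
  exact div_le_div_of_nonneg_right (h1 n) hn'.le

/-- The density of reduced closed walks is a trace of a Dickson polynomial. -/
theorem exists_walk_density [Infinite V] {d q : ℕ} (hd : ∀ v, X.degree v ≤ d)
    (hq : {v | X.degree v ≠ q + 1}.Finite) :
    ∃ a : ℕ → ℝ, a 0 = 1 ∧
      (∀ k, 0 < k → Tendsto (fun n => (seqCount (closedSeqs X k) (S.K n : Set V) : ℝ) / (S.K n).card)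
        atTop (𝓝 (a k))) ∧
      ∀ m, 0 < m → Tendsto (fun n => (seqCount (reducedSeqs X m) (S.K n : Set V) : ℝ)
        / (S.K n).card) atTop
        (𝓝 (((Polynomial.dickson 1 (q : ℝ) m).sum fun k c => c * a k)
          + SimpleGraph.evenTerm q m)) := by
  classical
  -- The moment of index `0` is set to `1` by hand: for `l = 0` periodicity is no condition and
  -- `closedSeqs X 0` does not count vertices.
  have h1 : ∀ k, ∃ a : ℝ, (k = 0 → a = 1) ∧ (0 < k →
      Tendsto (fun n => (seqCount (closedSeqs X k) (S.K n : Set V) : ℝ) / (S.K n).card)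
        atTop (𝓝 a)) := by
    intro k
    rcases Nat.eq_zero_or_pos k with rfl | hk
    · exact ⟨1, fun _ => rfl, fun h => absurd h (lt_irrefl _)⟩
    · obtain ⟨E, n₀, -, hE⟩ := exists_density hd S hk
      obtain ⟨a, ha, -⟩ := hE _ isCyclicWalk_of_mem_closedSeqs (S.copyInvariant_closedSeqs k)
      exact ⟨a, fun h => absurd h hk.ne', fun _ => ha⟩
  choose a ha0 ha using h1
  refine ⟨a, ha0 0 rfl, ha, ?_⟩
  have htr : ∀ k, Tendsto (fun n => Matrix.trace ((X.induce (S.K n : Set V)).adjMatrix ℝ ^ k)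
      / ((S.K n).card : ℝ)) atTop (𝓝 (a k)) := by
    intro k
    rcases Nat.eq_zero_or_pos k with rfl | hk
    · rw [ha0 0 rfl]
      refine tendsto_const_nhds.congr' ?_
      filter_upwards [S.card_tendsto.eventually_gt_atTop 0] with n hn
      have hn' : (0 : ℝ) < (S.K n).card := by exact_mod_cast hn
      rw [pow_zero, Matrix.trace_one]
      simp [hn'.ne']
    · simp only [trace_adjMatrix_induce_pow X _ hk]
      exact ha k hk
  have hpoly : ∀ p : Polynomial ℝ, Tendsto (fun n => Matrix.trace (Polynomial.aeval
      ((X.induce (S.K n : Set V)).adjMatrix ℝ) p) / ((S.K n).card : ℝ)) atTop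
      (𝓝 (p.sum fun k c => c * a k)) := by
    intro p
    have : ∀ n, Matrix.trace (Polynomial.aeval ((X.induce (S.K n : Set V)).adjMatrix ℝ) p)
        / ((S.K n).card : ℝ) = ∑ k ∈ p.support, p.coeff k *
          (Matrix.trace ((X.induce (S.K n : Set V)).adjMatrix ℝ ^ k) / ((S.K n).card : ℝ)) := by
      intro n
      rw [Polynomial.aeval_eq_sum_range, Matrix.trace_sum, Finset.sum_div]
      symm
      refine (Finset.sum_subset (Polynomial.supp_subset_range (Nat.lt_succ_self _)) ?_).trans
        (Finset.sum_congr rfl ?_)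
      · intro k _ hk
        rw [Polynomial.notMem_support_iff.1 hk, zero_mul]
      · intro k _
        rw [Matrix.trace_smul, smul_eq_mul, mul_div_assoc]
    simp only [this]
    exact tendsto_finsetSum _ fun k _ => (htr k).const_mul _
  intro m hm
  obtain ⟨m, rfl⟩ : ∃ m', m = m' + 1 := ⟨m - 1, by omega⟩
  obtain ⟨c, hc, hcb⟩ := SimpleGraph.exists_trace_dart_pow_sub_le d q m
  have hlim := (hpoly (Polynomial.dickson 1 (q : ℝ) (m + 1))).add_const
    (SimpleGraph.evenTerm q (m + 1))
  refine tendsto_of_tendsto_of_dist hlim ?_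
  have h2 : Tendsto (fun n => c * ((X.induce (S.K n : Set V)).totalExcess q / (S.K n).card))
      atTop (𝓝 0) := by
    simpa using (S.totalExcess_tendsto hd hq).const_mul c
  refine squeeze_zero' (Eventually.of_forall fun n => dist_nonneg) ?_ h2
  filter_upwards [S.card_tendsto.eventually_gt_atTop 0] with n hn
  have hn' : (0 : ℝ) < (S.K n).card := by exact_mod_cast hn
  have h3 := hcb (X.induce (S.K n : Set V)) fun x => (degree_induce_le' _ x).trans (hd x)
  rw [trace_dartMatrix_induce_pow X _ hm] at h3
  have hcard : (Fintype.card ↥(S.K n : Set V) : ℝ) = (S.K n).card := by simp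
  rw [hcard] at h3
  rw [dist_comm, Real.dist_eq, ← mul_div_assoc, div_add' _ _ _ hn'.ne', ← sub_div, abs_div,
    abs_of_pos hn']
  exact div_le_div_of_nonneg_right h3 hn'.le

end SelfSimilarData

/-! ### Closed paths as periodic sequences -/

/-- The shift of a sequence. -/
def seqShift {V : Type*} (s : ℕ → V) : ℕ → V := fun j => s (j + 1)

theorem seqShift_iterate {V : Type*} (k : ℕ) (s : ℕ → V) :
    seqShift^[k] s = fun j => s (j + k) := by
  induction k with
  | zero => rfl
  | succ k ih =>
    rw [Function.iterate_succ_apply', ih]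
    funext j
    change s (j + 1 + k) = s (j + (k + 1))
    congr 1
    ring

theorem isPeriodicPt_seqShift {V : Type*} {k : ℕ} {s : ℕ → V} :
    Function.IsPeriodicPt seqShift k s ↔ ∀ j, s (j + k) = s j := by
  rw [Function.IsPeriodicPt, Function.IsFixedPt, seqShift_iterate, funext_iff]

/-- Primitive reduced closed walks of length `l`, as periodic sequences. -/
def primeSeqs {V : Type*} (X : SimpleGraph V) (l : ℕ) : Set (ℕ → V) :=
  {s | s ∈ reducedSeqs X l ∧ Function.minimalPeriod seqShift s = l}

namespace ClosedPath

variable {V : Type*} {X : SimpleGraph V}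

instance (C : ClosedPath X) : NeZero C.len := ⟨C.len_pos.ne'⟩

/-- The periodic sequence of the vertices of a closed path. -/
def seq (C : ClosedPath X) : ℕ → V := fun j => C.vert (j : ZMod C.len)

theorem seq_mem (C : ClosedPath X) : C.seq ∈ closedSeqs X C.len := by
  refine ⟨fun _ => ?_, fun j => ?_⟩
  · simp [seq]
  · have := C.adj (j : ZMod C.len)
    simpa [seq] using this

theorem vert_eq_seq (C : ClosedPath X) (i : ZMod C.len) : C.vert i = C.seq i.val := by
  rw [seq, ZMod.natCast_zmod_val]

theorem ext_seq {C D : ClosedPath X} (hl : C.len = D.len) (hs : C.seq = D.seq) : C = D := by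
  obtain ⟨l, hlp, v, hv⟩ := C
  obtain ⟨l', hlp', v', hv'⟩ := D
  obtain rfl : l = l' := hl
  have : v = v' := by
    funext i
    have h1 := vert_eq_seq ⟨l, hlp, v, hv⟩ i
    have h2 := vert_eq_seq ⟨l, hlp, v', hv'⟩ i
    rw [← hs] at h2
    exact h1.trans h2.symm
  subst this
  rfl

theorem inSet_iff (C : ClosedPath X) (W : Set V) : C.InSet W ↔ ∀ j, C.seq j ∈ W :=
  ⟨fun h _ => h _, fun h i => C.vert_eq_seq i ▸ h _⟩

theorem mod_of_mem_closedSeqs {l : ℕ} {s : ℕ → V} (hs : s ∈ closedSeqs X l) (j : ℕ) :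
    s (j % l) = s j :=
  (isCyclicWalk_of_mem_closedSeqs s hs).mod j

/-- The closed path with a given periodic sequence of vertices. -/
def ofSeq {l : ℕ} (hl : 0 < l) {s : ℕ → V} (hs : s ∈ closedSeqs X l) : ClosedPath X where
  len := l
  len_pos := hl
  vert i := s i.val
  adj i := by
    have : NeZero l := ⟨hl.ne'⟩
    have h : s (i + 1).val = s (i.val + 1) := by
      rw [← mod_of_mem_closedSeqs hs (i.val + 1), ← ZMod.val_natCast, Nat.cast_succ,
        ZMod.natCast_zmod_val]
    rw [h]
    exact hs.2 _

theorem seq_ofSeq {l : ℕ} (hl : 0 < l) {s : ℕ → V} (hs : s ∈ closedSeqs X l) :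
    (ofSeq hl hs).seq = s := by
  funext j
  change s ((j : ZMod l)).val = s j
  rw [ZMod.val_natCast, mod_of_mem_closedSeqs hs]

theorem hasBacktracking_iff (C : ClosedPath X) : C.HasBacktracking ↔
    ∃ i : ℕ, 1 ≤ i ∧ i + 1 ≤ C.len ∧ C.seq (i - 1) = C.seq (i + 1) := by
  refine exists_congr fun i => and_congr_right fun hi => and_congr_right fun _ => ?_
  rw [seq, seq, Nat.cast_sub hi]
  push_cast
  rfl

theorem hasTail_iff (C : ClosedPath X) : C.HasTail ↔
    ∃ k : ℕ, 1 ≤ k ∧ k + 1 ≤ C.len / 2 ∧ ∀ j : ℕ, 1 ≤ j → j ≤ k → C.seq j = C.seq (C.len - j) := by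
  refine exists_congr fun k => and_congr_right fun hk => and_congr_right fun hk' =>
    forall_congr' fun j => forall_congr' fun hj => forall_congr' fun hjk => ?_
  rw [seq, seq, Nat.cast_sub (by omega), ZMod.natCast_self, zero_sub]

/-- In cyclic terms, the definition of backtracking leaves out one position, the origin.
Backtracking there is a tail with `k = 1`, so the two conditions together say `s j ≠ s (j + 2)` for
all `j`. -/
theorem reduced_iff (C : ClosedPath X) : C.Reduced ↔ C.seq ∈ reducedSeqs X C.len := by
  have hper := C.seq_mem.1
  have hadj := C.seq_mem.2
  have hlen := C.len_pos
  constructor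
  · rintro ⟨h1, h2⟩
    refine ⟨C.seq_mem, ?_⟩
    rw [hasBacktracking_iff] at h1
    rw [hasTail_iff] at h2
    push Not at h1 h2
    have hmod := fun j => mod_of_mem_closedSeqs C.seq_mem j
    intro j hj
    have e1 : C.seq (j % C.len) = C.seq (j % C.len + 2) := by
      have e : (j % C.len + 2) % C.len = (j + 2) % C.len := by rw [Nat.mod_add_mod]
      rw [hmod, ← hmod (j % C.len + 2), e, hmod, hj]
    have hr := Nat.mod_lt j hlen
    set r := j % C.len
    by_cases h : r + 2 ≤ C.len
    · exact h1 (r + 1) (by omega) (by omega) e1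
    · have hr1 : r = C.len - 1 := by omega
      -- The definition admits no tail in length below `4`. In these cases backtracking at the
      -- origin is impossible in lengths `1` and `3`, which would need a loop, and in length `2` it
      -- is also backtracking at `v_1`.
      by_cases hl4 : 4 ≤ C.len
      · obtain ⟨i, hi1, hi2, hne⟩ := h2 1 le_rfl (by omega)
        obtain rfl : i = 1 := by omega
        apply hne
        rw [← hr1, e1, show r + 2 = 1 + C.len by omega, hper]
      · have h1' := C.seq_mem.2 1
        have h0' := C.seq_mem.2 0
        have : C.len = 1 ∨ C.len = 2 ∨ C.len = 3 := by omega
        rcases this with h | h | h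
        · have := hper 0
          rw [h] at this
          rw [this] at h0'
          exact X.loopless.irrefl _ h0'
        · refine h1 1 le_rfl (by omega) ?_
          have := hper 0
          rw [h] at this
          exact this.symm
        · have hr2 : r = 2 := by omega
          rw [hr2] at e1
          have h4 := hper 1
          rw [h] at h4
          rw [show 2 + 2 = 1 + 3 from rfl, h4] at e1
          rw [e1] at h1'
          exact X.loopless.irrefl _ h1'
  · rintro ⟨-, h⟩
    rw [Reduced, hasBacktracking_iff, hasTail_iff]
    constructor
    · rintro ⟨i, hi, -, he⟩
      have := h (i - 1)
      rw [show i - 1 + 2 = i + 1 by omega] at this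
      exact this he
    · rintro ⟨k, hk, hk2, hj⟩
      have h1 := hj 1 le_rfl hk
      have := h (C.len - 1)
      rw [show C.len - 1 + 2 = 1 + C.len by omega, hper] at this
      exact this h1.symm

/-- The minimal period divides the length, and a proper divisor gives a shorter closed path which is
traversed several times. -/
theorem primitive_iff (C : ClosedPath X) :
    C.Primitive ↔ Function.minimalPeriod seqShift C.seq = C.len := by
  have hp : Function.IsPeriodicPt seqShift C.len C.seq := isPeriodicPt_seqShift.2 C.seq_mem.1
  have hdvd := hp.minimalPeriod_dvd
  have hpos := hp.minimalPeriod_pos C.len_pos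
  constructor
  · intro h
    by_contra hne
    obtain ⟨n, hn⟩ := hdvd
    have hm : C.seq ∈ closedSeqs X (Function.minimalPeriod seqShift C.seq) :=
      ⟨isPeriodicPt_seqShift.1 (Function.isPeriodicPt_minimalPeriod _ _), C.seq_mem.2⟩
    refine h ⟨n, ofSeq hpos hm, ?_, ?_, fun j => ?_⟩
    · have := C.len_pos
      rcases n with _ | _ | n
      · omega
      · omega
      · omega
    · rw [mul_comm]; exact hn
    · exact (congrFun (seq_ofSeq hpos hm) j).symm
  · rintro h ⟨n, D, hn, hl, hs⟩
    have hs' : C.seq = D.seq := funext hs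
    have hD : Function.IsPeriodicPt seqShift D.len C.seq :=
      isPeriodicPt_seqShift.2 (hs' ▸ D.seq_mem.1)
    have := Nat.le_of_dvd D.len_pos hD.minimalPeriod_dvd
    have := D.len_pos
    rw [h, hl] at *
    nlinarith

theorem shift_iff (C D : ClosedPath X) :
    C.Shift D ↔ C.len = D.len ∧ ∃ k : ℕ, ∀ j, D.seq j = C.seq (j + k) := by
  refine and_congr_right fun _ => exists_congr fun k => forall_congr' fun j => ?_
  rw [seq, seq, Nat.cast_add]

theorem shift_equivalence : Equivalence (Shift (X := X)) where
  refl C := (shift_iff C C).2 ⟨rfl, 0, fun _ => rfl⟩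
  symm := by
    intro C D h
    obtain ⟨hl, k, hk⟩ := (shift_iff C D).1 h
    -- The shift `C.len * k - k` is a natural number congruent to `-k` modulo the length.
    refine (shift_iff D C).2 ⟨hl.symm, C.len * k - k, fun j => ?_⟩
    have h1 : k ≤ C.len * k := Nat.le_mul_of_pos_left k C.len_pos
    rw [hk, show j + (C.len * k - k) + k = j + C.len * k by omega,
      ← mod_of_mem_closedSeqs C.seq_mem (j + _), Nat.add_mul_mod_self_left,
      mod_of_mem_closedSeqs C.seq_mem]
  trans := by
    intro C D E h h'
    obtain ⟨hl, k, hk⟩ := (shift_iff C D).1 h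
    obtain ⟨hl', k', hk'⟩ := (shift_iff D E).1 h'
    refine (shift_iff C E).2 ⟨hl.trans hl', k' + k, fun j => ?_⟩
    rw [hk', hk, add_assoc]

end ClosedPath

namespace PrimePath

variable {V : Type*} {X : SimpleGraph V}

theorem seq_mem (C : PrimePath X) : C.1.seq ∈ primeSeqs X C.1.len :=
  ⟨C.1.reduced_iff.1 C.2.1, C.1.primitive_iff.1 C.2.2⟩

/-- The prime path with a given periodic sequence of vertices. -/
def ofSeq {l : ℕ} (hl : 0 < l) {s : ℕ → V} (hs : s ∈ primeSeqs X l) : PrimePath X :=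
  ⟨ClosedPath.ofSeq hl hs.1.1, by
    constructor
    · rw [ClosedPath.reduced_iff, ClosedPath.seq_ofSeq]
      exact hs.1
    · rw [ClosedPath.primitive_iff, ClosedPath.seq_ofSeq]
      exact hs.2⟩

theorem seq_ofSeq {l : ℕ} (hl : 0 < l) {s : ℕ → V} (hs : s ∈ primeSeqs X l) :
    (ofSeq hl hs).1.seq = s :=
  ClosedPath.seq_ofSeq hl hs.1.1

theorem ext_seq {C D : PrimePath X} (hl : C.1.len = D.1.len) (hs : C.1.seq = D.1.seq) : C = D :=
  Subtype.ext (ClosedPath.ext_seq hl hs)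

theorem seqShift_iterate_mem {l : ℕ} {s : ℕ → V} (hs : s ∈ primeSeqs X l) (k : ℕ) (hl : 0 < l) :
    seqShift^[k] s ∈ primeSeqs X l := by
  refine ⟨?_, ?_⟩
  · rw [seqShift_iterate]
    refine ⟨⟨fun j => ?_, fun j => ?_⟩, fun j => ?_⟩
    · change s (j + l + k) = s (j + k)
      rw [show j + l + k = j + k + l by ring, hs.1.1.1]
    · change X.Adj (s (j + k)) (s (j + 1 + k))
      rw [show j + 1 + k = j + k + 1 by ring]
      exact hs.1.1.2 _
    · change s (j + k) ≠ s (j + 2 + k)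
      rw [show j + 2 + k = j + k + 2 by ring]
      exact hs.1.2 _
  · rw [Function.minimalPeriod_apply_iterate, hs.2]
    exact ⟨l, hl, isPeriodicPt_seqShift.2 hs.1.1.1⟩

/-- The prime cycle of a prime path. -/
def cycle (C : PrimePath X) : PrimeCycle X := Quot.mk _ C

theorem cycle_eq_iff (C D : PrimePath X) : C.cycle = D.cycle ↔ C.1.Shift D.1 := by
  have e : Equivalence (fun C D : PrimePath X => C.1.Shift D.1) :=
    ⟨fun C => ClosedPath.shift_equivalence.refl C.1,
      fun h => ClosedPath.shift_equivalence.symm h,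
      fun h h' => ClosedPath.shift_equivalence.trans h h'⟩
  exact Quot.eq.trans e.eqvGen_iff

end PrimePath

namespace PrimeCycle

variable {V : Type*} {X : SimpleGraph V}

/-- A representative of a prime cycle. -/
noncomputable def out (c : PrimeCycle X) : PrimePath X := Quot.out c

theorem cycle_out (c : PrimeCycle X) : c.out.cycle = c := Quot.out_eq c

theorem inSet_cycle (C : PrimePath X) (W : Set V) : C.cycle.InSet W ↔ ∀ j, C.1.seq j ∈ W := by
  constructor
  · rintro ⟨D, hD, hW⟩
    have h : D.1.Shift C.1 := (PrimePath.cycle_eq_iff D C).1 hD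
    obtain ⟨-, k, hk⟩ := (ClosedPath.shift_iff _ _).1 h
    intro j
    rw [hk]
    exact (D.1.inSet_iff W).1 hW _
  · intro h
    exact ⟨C, rfl, (C.1.inSet_iff W).2 h⟩

/-- The sequences of the paths in a set of prime cycles. -/
def seqs (𝒞 : Set (PrimeCycle X)) : Set (ℕ → V) :=
  {s | ∃ C : PrimePath X, C.cycle ∈ 𝒞 ∧ C.1.seq = s}

/-- A prime cycle of length `l` has exactly `l` sequences, the shifts of one of them by less than
its minimal period `l`. -/
theorem seqCount_seqs {l : ℕ} {𝒞 : Set (PrimeCycle X)} (h𝒞 : ∀ c ∈ 𝒞, c.len = l) (hl : 0 < l)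
    (W : Set V) : seqCount (seqs 𝒞) W = l * {c | c ∈ 𝒞 ∧ c.InSet W}.ncard := by
  have hcard : l * {c | c ∈ 𝒞 ∧ c.InSet W}.ncard
      = ({c | c ∈ 𝒞 ∧ c.InSet W} ×ˢ (Set.univ : Set (Fin l))).ncard := by
    rw [Set.ncard_prod, Set.ncard_univ, Nat.card_fin, mul_comm]
  rw [hcard]
  symm
  have hlen : ∀ c ∈ 𝒞, c.out.1.len = l := by
    intro c hc
    rw [← h𝒞 c hc]
    conv_rhs => rw [← c.cycle_out]
    rfl
  refine Set.ncard_congr (fun p _ => fun j => p.1.out.1.seq (j + p.2)) ?_ ?_ ?_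
  · rintro ⟨c, k⟩ ⟨⟨hc, hcW⟩, -⟩
    have hl' := hlen c hc
    have hm := PrimePath.seqShift_iterate_mem c.out.seq_mem k c.out.1.len_pos
    constructor
    · refine ⟨PrimePath.ofSeq c.out.1.len_pos hm, ?_, ?_⟩
      · have : (PrimePath.ofSeq c.out.1.len_pos hm).cycle = c := by
          conv_rhs => rw [← c.cycle_out]
          symm
          rw [PrimePath.cycle_eq_iff, ClosedPath.shift_iff]
          refine ⟨rfl, k, fun j => ?_⟩
          rw [PrimePath.seq_ofSeq, seqShift_iterate]
        rw [this]
        exact hc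
      · rw [PrimePath.seq_ofSeq, seqShift_iterate]
    · intro j
      rw [← c.cycle_out, inSet_cycle] at hcW
      exact hcW _
  · rintro ⟨c, k⟩ ⟨c', k'⟩ ⟨⟨hc, -⟩, -⟩ ⟨⟨hc', -⟩, -⟩ h
    have hm := PrimePath.seqShift_iterate_mem c.out.seq_mem k c.out.1.len_pos
    have h0 : c.out.1.Shift (ClosedPath.ofSeq c.out.1.len_pos hm.1.1) := by
      rw [ClosedPath.shift_iff]
      refine ⟨rfl, k, fun j => ?_⟩
      rw [ClosedPath.seq_ofSeq, seqShift_iterate]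
    have h1 : c'.out.1.Shift (ClosedPath.ofSeq c.out.1.len_pos hm.1.1) := by
      rw [ClosedPath.shift_iff]
      refine ⟨(hlen c' hc').trans (hlen c hc).symm, k', fun j => ?_⟩
      rw [ClosedPath.seq_ofSeq, seqShift_iterate]
      exact congrFun h j
    have hcc : c = c' := by
      rw [← c.cycle_out, ← c'.cycle_out, PrimePath.cycle_eq_iff]
      exact ClosedPath.shift_equivalence.trans h0 (ClosedPath.shift_equivalence.symm h1)
    subst hcc
    have hmin := c.out.seq_mem.2
    rw [hlen c hc] at hmin
    have hinj := Function.iterate_injOn_Iio_minimalPeriod (f := seqShift) (x := c.out.1.seq)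
    have hkk : (k : ℕ) = k' := by
      refine hinj ?_ ?_ ?_
      · rw [hmin]; exact k.2
      · rw [hmin]; exact k'.2
      · simp only [seqShift_iterate]; exact h
    rw [Fin.ext hkk]
  · rintro s ⟨⟨C, hC, rfl⟩, hW⟩
    have hsh : C.cycle.out.1.Shift C.1 := (PrimePath.cycle_eq_iff _ _).1 C.cycle.cycle_out
    obtain ⟨hlC, k, hk⟩ := (ClosedPath.shift_iff _ _).1 hsh
    have hl' := hlen _ hC
    refine ⟨(C.cycle, ⟨k % l, Nat.mod_lt _ hl⟩), ⟨⟨hC, (inSet_cycle C W).2 hW⟩, trivial⟩, ?_⟩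
    funext j
    have hmod := fun j => ClosedPath.mod_of_mem_closedSeqs C.cycle.out.1.seq_mem j
    rw [hl'] at hmod
    change C.cycle.out.1.seq (j + k % l) = C.1.seq j
    rw [hk, ← hmod, Nat.add_mod_mod, hmod]

end PrimeCycle

/-! ### Average multiplicities -/

namespace SelfSimilarData

variable {V : Type*} {X : SimpleGraph V} (S : SelfSimilarData X)

theorem copyInvariant_primeSeqs (l : ℕ) : S.CopyInvariant (primeSeqs X l) := by
  intro n m f hf s
  have h1 := S.copyInvariant_reducedSeqs l n m f hf s
  have h2 : Function.minimalPeriod seqShift (fun j => f (s j))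
      = Function.minimalPeriod seqShift (fun j => (s j : V)) := by
    rw [Function.minimalPeriod_eq_minimalPeriod_iff]
    intro k
    simp only [isPeriodicPt_seqShift, (copies_injective hf).eq_iff, Subtype.ext_iff]
  simp only [primeSeqs, Set.mem_ofPred_eq, h1, h2]

/-- The sequences of the prime paths in a set of `𝒢`-classes. -/
def classSeqs (𝒦 : Set (PrimeClass S)) : Set (ℕ → V) :=
  PrimeCycle.seqs {c | c.toClass S ∈ 𝒦}

variable {S}

theorem toClass_eq_of_move {C D : PrimePath X} (h : C.1.Move S D.1) :
    C.cycle.toClass S = D.cycle.toClass S :=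
  Quot.sound ⟨C, D, rfl, rfl, h⟩

theorem move_of_seq {C D : PrimePath X} (hl : C.1.len = D.1.len) {n m : ℕ}
    {f : ↥(S.K n : Set V) → V} (hf : f ∈ S.copies n m) {s : ℕ → ↥(S.K n : Set V)}
    (hC : C.1.seq = fun j => (s j : V)) (hD : D.1.seq = fun j => f (s j)) : C.1.Move S D.1 := by
  have h : C.1.InSet (S.K n : Set V) := by
    rw [ClosedPath.inSet_iff, hC]
    exact fun j => (s j).2
  refine ⟨hl, n, m, f, hf, h, fun j => ?_⟩
  refine (congrFun hD j).trans ?_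
  congr 1
  exact Subtype.ext (congrFun hC j).symm

theorem classSeqs_subset {l : ℕ} {𝒦 : Set (PrimeClass S)} (h𝒦 : ∀ κ ∈ 𝒦, κ.len = l) :
    classSeqs S 𝒦 ⊆ primeSeqs X l := by
  rintro _ ⟨C, hC, rfl⟩
  rw [← h𝒦 _ hC]
  exact C.seq_mem

theorem classSeqs_len {l : ℕ} (hl : 0 < l) : classSeqs S {κ | κ.len = l} = primeSeqs X l := by
  refine Set.Subset.antisymm (classSeqs_subset fun κ h => h) ?_
  intro s hs
  exact ⟨PrimePath.ofSeq hl hs, rfl, PrimePath.seq_ofSeq hl hs⟩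

/-- Maps of `𝒢` preserve and reflect primitive reduced walks, and a walk and its image are in the
same class by definition of the classes. Hence `exists_density` applies to any union of classes of
one length. -/
theorem copyInvariant_classSeqs {l : ℕ} (hl : 0 < l) {𝒦 : Set (PrimeClass S)}
    (h𝒦 : ∀ κ ∈ 𝒦, κ.len = l) : S.CopyInvariant (classSeqs S 𝒦) := by
  intro n m f hf s
  have hinv := S.copyInvariant_primeSeqs l n m f hf s
  constructor
  · rintro ⟨D, hD, hs⟩
    have hDl : D.1.len = l := h𝒦 _ hD
    have hm : (fun j => f (s j)) ∈ primeSeqs X l := by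
      rw [← hs, ← hDl]
      exact D.seq_mem
    have hm' := hinv.1 hm
    refine ⟨PrimePath.ofSeq hl hm', ?_, PrimePath.seq_ofSeq hl hm'⟩
    change (PrimePath.ofSeq hl hm').cycle.toClass S ∈ 𝒦
    rwa [toClass_eq_of_move (move_of_seq (C := PrimePath.ofSeq hl hm') (D := D) hDl.symm hf
      (PrimePath.seq_ofSeq hl hm') hs)]
  · rintro ⟨C, hC, hs⟩
    have hCl : C.1.len = l := h𝒦 _ hC
    have hm : (fun j => (s j : V)) ∈ primeSeqs X l := by
      rw [← hs, ← hCl]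
      exact C.seq_mem
    have hm' := hinv.2 hm
    refine ⟨PrimePath.ofSeq hl hm', ?_, PrimePath.seq_ofSeq hl hm'⟩
    change (PrimePath.ofSeq hl hm').cycle.toClass S ∈ 𝒦
    rwa [← toClass_eq_of_move (move_of_seq (C := C) (D := PrimePath.ofSeq hl hm') hCl hf hs
      (PrimePath.seq_ofSeq hl hm'))]

theorem seqCount_classSeqs_singleton (κ : PrimeClass S) (hl : 0 < κ.len) (n : ℕ) :
    seqCount (classSeqs S {κ}) (S.K n : Set V) = κ.len * κ.count n := by
  rw [classSeqs, PrimeCycle.seqCount_seqs (l := κ.len) _ hl]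
  · rfl
  · rintro c rfl
    rfl

theorem _root_.PrimeClass.len_pos (κ : PrimeClass S) : 0 < κ.len := by
  obtain ⟨c, rfl⟩ := Quot.exists_rep κ
  obtain ⟨C, rfl⟩ := Quot.exists_rep c
  exact C.1.len_pos

variable [X.LocallyFinite]

theorem seqCount_classSeqs_finset {d l : ℕ} (hd : ∀ v, X.degree v ≤ d) (hl : 0 < l)
    (t : Finset (PrimeClass S)) (ht : ∀ κ ∈ t, κ.len = l) (W : Set V) (hW : W.Finite) :
    seqCount (classSeqs S (t : Set (PrimeClass S))) W = ∑ κ ∈ t, seqCount (classSeqs S {κ}) W := by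
  classical
  induction t using Finset.induction_on with
  | empty =>
    have : classSeqs S ((∅ : Finset (PrimeClass S)) : Set (PrimeClass S)) = ∅ := by
      ext s
      simp [classSeqs, PrimeCycle.seqs]
    rw [Finset.sum_empty, this]
    simp [seqCount]
  | insert κ t hκ ih =>
    rw [Finset.sum_insert hκ, ← ih fun κ' h => ht κ' (Finset.mem_insert_of_mem h)]
    have hfin : ∀ 𝒦 : Set (PrimeClass S), (∀ κ ∈ 𝒦, κ.len = l) →
        {s ∈ classSeqs S 𝒦 | ∀ j, s j ∈ W}.Finite := by
      intro 𝒦 h𝒦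
      exact seqCount_finite hl hd
        (fun s hs => isCyclicWalk_of_mem_closedSeqs s ((classSeqs_subset h𝒦) hs).1.1) hW
    have h1 : ∀ κ' ∈ ({κ} : Set (PrimeClass S)), κ'.len = l := by
      rintro _ rfl
      exact ht _ (Finset.mem_insert_self _ _)
    have h2 : ∀ κ' ∈ (t : Set (PrimeClass S)), κ'.len = l :=
      fun κ' h => ht κ' (Finset.mem_insert_of_mem h)
    rw [seqCount, seqCount, seqCount, ← Set.ncard_union_eq _ (hfin _ h1) (hfin _ h2)]
    · congr 1
      ext s
      simp only [classSeqs, PrimeCycle.seqs, Set.mem_ofPred_eq, Set.mem_union, Finset.coe_insert,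
        Set.mem_insert_iff, Set.mem_singleton_iff]
      constructor
      · rintro ⟨⟨C, hC | hC, rfl⟩, hW⟩
        · exact Or.inl ⟨⟨C, hC, rfl⟩, hW⟩
        · exact Or.inr ⟨⟨C, hC, rfl⟩, hW⟩
      · rintro (⟨⟨C, hC, rfl⟩, hW⟩ | ⟨⟨C, hC, rfl⟩, hW⟩)
        · exact ⟨⟨C, Or.inl hC, rfl⟩, hW⟩
        · exact ⟨⟨C, Or.inr hC, rfl⟩, hW⟩
    · rw [Set.disjoint_left]
      rintro s ⟨⟨C, hC, rfl⟩, -⟩ ⟨⟨D, hD, hs⟩, -⟩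
      have hCl : C.1.len = l := h1 _ hC
      have hDl : D.1.len = l := h2 _ hD
      have : C = D := PrimePath.ext_seq (hCl.trans hDl.symm) hs.symm
      subst this
      rw [← Set.mem_singleton_iff.1 hC] at hκ
      exact hκ hD

/-- The average multiplicities exist, and those of the classes of length `l` add up to the density
of the prime closed walks of length `l`. -/
theorem exists_multiplicity [Infinite V] {d : ℕ} (hd : ∀ v, X.degree v ≤ d)
    (S : SelfSimilarData X) :
    ∃ μ : PrimeClass S → ℝ, (∀ κ : PrimeClass S, κ.HasMultiplicity (μ κ)) ∧
      (∀ κ : PrimeClass S, 0 ≤ μ κ) ∧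
      ∀ l, 0 < l → ∃ p : ℝ,
        Tendsto (fun n => (seqCount (primeSeqs X l) (S.K n : Set V) : ℝ) / (S.K n).card) atTop
          (𝓝 p) ∧
        HasSum (fun κ : {κ : PrimeClass S // κ.len = l} => l * μ κ) p := by
  classical
  have hcyc : ∀ {l : ℕ} {𝒦 : Set (PrimeClass S)}, (∀ κ ∈ 𝒦, κ.len = l) →
      ∀ s ∈ classSeqs S 𝒦, IsCyclicWalk X l s := fun h𝒦 s hs =>
    isCyclicWalk_of_mem_closedSeqs s ((classSeqs_subset h𝒦) hs).1.1
  have h1 : ∀ κ : PrimeClass S, ∃ m, κ.HasMultiplicity m := by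
    intro κ
    obtain ⟨E, n₀, -, hE⟩ := exists_density hd S κ.len_pos
    have hs : ∀ κ' ∈ ({κ} : Set (PrimeClass S)), κ'.len = κ.len := by rintro _ rfl; rfl
    obtain ⟨p, hp, -⟩ := hE _ (hcyc hs) (copyInvariant_classSeqs κ.len_pos hs)
    refine ⟨p / κ.len, (hp.div_const (κ.len : ℝ)).congr fun n => ?_⟩
    have : (κ.len : ℝ) ≠ 0 := by exact_mod_cast κ.len_pos.ne'
    rw [seqCount_classSeqs_singleton κ κ.len_pos]
    push_cast
    field_simp
  choose μ hμ using h1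
  -- With nonnegative terms, the sum over the classes is the least upper bound of its finite partial
  -- sums; this is how the claim is proved below.
  have hμ0 : ∀ κ, 0 ≤ μ κ := fun κ => ge_of_tendsto' (hμ κ) fun n => by positivity
  refine ⟨μ, hμ, hμ0, ?_⟩
  intro l hl
  obtain ⟨E, n₀, hE0, hE⟩ := exists_density hd S hl
  have hp := hE (classSeqs S {κ | κ.len = l}) (hcyc fun _ h => h)
    (copyInvariant_classSeqs hl fun _ h => h)
  rw [classSeqs_len hl] at hp
  obtain ⟨p, hp, hpE⟩ := hp
  refine ⟨p, hp, ?_⟩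
  have hcl : ∀ s ∈ primeSeqs X l, IsCyclicWalk X l s := fun s hs =>
    isCyclicWalk_of_mem_closedSeqs s hs.1.1
  have hsum : ∀ t : Finset (PrimeClass S), (∀ κ ∈ t, κ.len = l) →
      Tendsto (fun n => (seqCount (classSeqs S (t : Set (PrimeClass S))) (S.K n : Set V) : ℝ)
        / (S.K n).card) atTop (𝓝 (∑ κ ∈ t, l * μ κ)) := by
    intro t ht
    have : ∀ n, (seqCount (classSeqs S (t : Set (PrimeClass S))) (S.K n : Set V) : ℝ)
        / (S.K n).card = ∑ κ ∈ t, l * ((κ.count n : ℝ) / (S.K n).card) := by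
      intro n
      rw [seqCount_classSeqs_finset hd hl t ht _ (Finset.finite_toSet _), Nat.cast_sum,
        Finset.sum_div]
      refine Finset.sum_congr rfl fun κ hκ => ?_
      rw [seqCount_classSeqs_singleton κ κ.len_pos, ht κ hκ]
      push_cast
      ring
    simp only [this]
    exact tendsto_finsetSum _ fun κ _ => (hμ κ).const_mul _
  refine hasSum_of_isLUB_of_nonneg _ (fun κ => mul_nonneg (Nat.cast_nonneg _) (hμ0 _)) ⟨?_, ?_⟩
  · rintro _ ⟨t, rfl⟩
    have ht : ∀ κ ∈ t.map (Function.Embedding.subtype _), κ.len = l := by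
      intro κ hκ
      obtain ⟨κ', -, rfl⟩ := Finset.mem_map.1 hκ
      exact κ'.2
    have h2 := hsum _ ht
    rw [Finset.sum_map] at h2
    refine le_of_tendsto_of_tendsto' h2 hp fun n => ?_
    refine div_le_div_of_nonneg_right ?_ (Nat.cast_nonneg _)
    have h3 : seqCount (classSeqs S ((t.map (Function.Embedding.subtype _) :
        Finset (PrimeClass S)) : Set (PrimeClass S))) (S.K n : Set V)
        ≤ seqCount (primeSeqs X l) (S.K n : Set V) :=
      Set.ncard_le_ncard (fun s hs => ⟨classSeqs_subset ht hs.1, hs.2⟩)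
        (seqCount_finite hl hd hcl (Finset.finite_toSet _))
    exact_mod_cast h3
  · intro b hb
    -- Only finitely many classes of length `l` meet `K n`, and on `K n` their union has the same
    -- count as all prime walks.
    have hfin : ∀ n, ∃ t : Finset (PrimeClass S), (∀ κ ∈ t, κ.len = l) ∧
        seqCount (classSeqs S (t : Set (PrimeClass S))) (S.K n : Set V)
          = seqCount (primeSeqs X l) (S.K n : Set V) := by
      intro n
      have hf : {s ∈ primeSeqs X l | ∀ j, s j ∈ (S.K n : Set V)}.Finite :=
        seqCount_finite hl hd hcl (Finset.finite_toSet _)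
      -- `Option` supplies a value off the prime sequences without requiring that a class exist.
      let g : (ℕ → V) → Option (PrimeClass S) := fun s =>
        if hs : s ∈ primeSeqs X l then some ((PrimePath.ofSeq hl hs).cycle.toClass S) else none
      let t : Set (PrimeClass S) :=
        {κ | some κ ∈ g '' {s ∈ primeSeqs X l | ∀ j, s j ∈ (S.K n : Set V)}}
      have ht : t.Finite := (hf.image g).preimage (Option.some_injective _).injOn
      have htl : ∀ κ ∈ ht.toFinset, κ.len = l := by
        intro κ hκ
        obtain ⟨s, hs, hsκ⟩ := (Set.Finite.mem_toFinset ht).1 hκ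
        simp only [g, dif_pos hs.1, Option.some.injEq] at hsκ
        rw [← hsκ]
        rfl
      refine ⟨ht.toFinset, htl, ?_⟩
      rw [seqCount, seqCount]
      congr 1
      ext s
      constructor
      · rintro ⟨h, h'⟩
        exact ⟨classSeqs_subset htl h, h'⟩
      · rintro ⟨h, h'⟩
        refine ⟨⟨PrimePath.ofSeq hl h, ?_, PrimePath.seq_ofSeq hl h⟩, h'⟩
        refine (Set.Finite.mem_toFinset ht).2 ⟨s, ⟨h, h'⟩, ?_⟩
        exact dif_pos h
    -- The density of the finite family for `K n` is a partial sum, hence at most `b`. It and `p`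
    -- are both within `E n` of the same ratio on `K n`; here the uniformity of `E` in the family is
    -- used.
    have h3 : ∀ n ≥ n₀, p ≤ b + 2 * E n := by
      intro n hn
      obtain ⟨t, htl, ht⟩ := hfin n
      obtain ⟨p', hp', hp'E⟩ := hE (classSeqs S (t : Set (PrimeClass S))) (hcyc htl)
        (copyInvariant_classSeqs hl htl)
      have h4 := tendsto_nhds_unique hp' (hsum t htl)
      have h5 : p' ≤ b := by
        rw [h4]
        refine le_trans (le_of_eq ?_) (hb ⟨t.subtype (fun κ => κ.len = l), rfl⟩)
        symm
        refine Finset.sum_bij (fun κ _ => (κ : PrimeClass S)) ?_ ?_ ?_ ?_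
        · intro κ hκ
          exact Finset.mem_subtype.1 hκ
        · intro κ _ κ' _ h
          exact Subtype.ext h
        · intro κ hκ
          exact ⟨⟨κ, htl κ hκ⟩, Finset.mem_subtype.2 hκ, rfl⟩
        · intro κ _
          rfl
      have h6 := abs_le.1 (hpE n hn)
      have h7 := abs_le.1 (hp'E n hn)
      rw [ht] at h7
      linarith [h6.2, h7.1]
    have h8 : Tendsto (fun n => b + 2 * E n) atTop (𝓝 b) := by
      simpa using (hE0.const_mul 2).const_add b
    exact ge_of_tendsto h8 (eventually_atTop.2 ⟨n₀, h3⟩)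

omit [X.LocallyFinite] in
theorem reducedSeqs_eq {l : ℕ} (hl : 0 < l) (s : ℕ → V) :
    s ∈ reducedSeqs X l ↔ Function.minimalPeriod seqShift s ∈ l.divisors ∧
      s ∈ primeSeqs X (Function.minimalPeriod seqShift s) := by
  rw [Nat.mem_divisors]
  constructor
  · intro h
    have hp : Function.IsPeriodicPt seqShift l s := isPeriodicPt_seqShift.2 h.1.1
    exact ⟨⟨hp.minimalPeriod_dvd, hl.ne'⟩, ⟨⟨⟨isPeriodicPt_seqShift.1
      (Function.isPeriodicPt_minimalPeriod _ _), h.1.2⟩, h.2⟩, rfl⟩⟩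
  · rintro ⟨⟨hdvd, -⟩, h⟩
    refine ⟨⟨isPeriodicPt_seqShift.1 ?_, h.1.1.2⟩, h.1.2⟩
    exact (Function.isPeriodicPt_minimalPeriod _ _).trans_dvd hdvd

theorem seqCount_reducedSeqs {d l : ℕ} (hd : ∀ v, X.degree v ≤ d) (hl : 0 < l) {W : Set V}
    (hW : W.Finite) :
    seqCount (reducedSeqs X l) W = ∑ k ∈ l.divisors, seqCount (primeSeqs X k) W := by
  classical
  have hf : {s ∈ reducedSeqs X l | ∀ j, s j ∈ W}.Finite :=
    seqCount_finite hl hd (fun s hs => isCyclicWalk_of_mem_closedSeqs s hs.1) hW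
  rw [seqCount, Set.ncard_eq_toFinset_card _ hf, Finset.card_eq_sum_card_fiberwise
    (f := Function.minimalPeriod seqShift) (t := l.divisors)]
  · refine Finset.sum_congr rfl fun k hk => ?_
    rw [seqCount, ← Set.ncard_coe_finset]
    congr 1
    ext s
    simp only [Finset.coe_filter, Set.Finite.mem_toFinset, Set.mem_ofPred_eq, reducedSeqs_eq hl]
    constructor
    · rintro ⟨⟨⟨h1, h2⟩, h3⟩, rfl⟩
      exact ⟨h2, h3⟩
    · rintro ⟨h1, h2⟩
      have h3 := h1.2
      refine ⟨⟨⟨h3 ▸ hk, h3.symm ▸ h1⟩, h2⟩, h3⟩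
  · intro s hs
    exact ((reducedSeqs_eq hl s).1 ((Set.Finite.mem_toFinset hf).1 hs).1).1

end SelfSimilarData

/-! ### Multiplicities and sizes when copies share no cycle -/

namespace SelfSimilarData

variable {V : Type*} {X : SimpleGraph V} {S : SelfSimilarData X}

theorem gen_mem_copies {n : ℕ} {γ : X.induce (S.K n : Set V) ↪g X} (hγ : γ ∈ S.gen n) :
    (fun x : ↥(S.K n : Set V) => γ x) ∈ S.copies n (n + 1) :=
  IsCopyMap.step IsCopyMap.refl hγ fun x => x.2

theorem CycleSeparated.val_mem_copies (h : S.CycleSeparated) {n m : ℕ} (hnm : n ≤ m) :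
    (Subtype.val : ↥(S.K n : Set V) → V) ∈ S.copies n m := by
  induction m, hnm using Nat.le_induction with
  | base => exact copies_self_mem n
  | succ m hm ih =>
    obtain ⟨γ, hγ, hval⟩ := h.1 m
    have := IsCopyMap.step ih hγ (copies_mem ih)
    simp only [hval] at this
    exact this

theorem CycleSeparated.copies_mono (h : S.CycleSeparated) {n m k : ℕ} (hmk : m ≤ k)
    {f : ↥(S.K n : Set V) → V} (hf : f ∈ S.copies n m) : f ∈ S.copies n k :=
  copies_comp hf (h.val_mem_copies hmk) (copies_mem hf)

/-- Compare the last generators: if they differ, the walk lies in two distinct copies of `K m`,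
which is excluded; if they agree, cancel them and descend to the preimage of the walk. -/
theorem CycleSeparated.copies_eq (h : S.CycleSeparated) {a m l : ℕ} (hl : 0 < l)
    {f f' : ↥(S.K a : Set V) → V} (hf : f ∈ S.copies a m) (hf' : f' ∈ S.copies a m)
    {s : ℕ → V} (hs : s ∈ reducedSeqs X l) (hsf : ∀ j, s j ∈ Set.range f)
    (hsf' : ∀ j, s j ∈ Set.range f') : f = f' := by
  have ham := le_of_copies hf
  induction m, ham using Nat.le_induction generalizing f f' s with
  | base => rw [eq_val_of_copies_self hf, eq_val_of_copies_self hf']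
  | succ m hm ih =>
    obtain ⟨g, hg, γ, hγ, hr, rfl⟩ := copies_succ hm hf
    obtain ⟨g', hg', γ', hγ', hr', rfl⟩ := copies_succ hm hf'
    choose x hx using hsf
    choose y hy using hsf'
    by_cases hγγ : γ = γ'
    · subst hγγ
      have hxy : ∀ j, g (x j) = g' (y j) := fun j =>
        congrArg Subtype.val (γ.injective ((hx j).trans (hy j).symm))
      have hinv := (S.copyInvariant_reducedSeqs l) m (m + 1) _ (gen_mem_copies hγ)
        (fun j => ⟨g (x j), hr (x j)⟩)
      have h1 : (fun j => g (x j)) ∈ reducedSeqs X l := by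
        refine hinv.1 ?_
        convert hs using 1
        funext j
        exact hx j
      have := ih hg hg' h1 (fun j => ⟨x j, rfl⟩) (fun j => ⟨y j, (hxy j).symm⟩)
      subst this
      rfl
    · exfalso
      refine h.2 m γ hγ γ' hγ' hγγ (ClosedPath.ofSeq hl hs.1) ?_ ?_
      · rw [ClosedPath.reduced_iff, ClosedPath.seq_ofSeq]
        exact hs
      · rw [ClosedPath.inSet_iff, ClosedPath.seq_ofSeq]
        exact fun j => ⟨⟨_, hx j⟩, ⟨_, hy j⟩⟩

/-- If the target index `n` exceeds `a`, factor `g` through `K a`. The outer factor and the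
inclusion of `K a` then share the walk, so the outer factor is the inclusion. -/
theorem CycleSeparated.mem_copies_of_subset (h : S.CycleSeparated) {m n a l : ℕ} (hl : 0 < l)
    {g : ↥(S.K m : Set V) → V} (hg : g ∈ S.copies m n) {s : ℕ → V} (hs : s ∈ reducedSeqs X l)
    (hsg : ∀ j, s j ∈ Set.range g) (hsa : ∀ j, s j ∈ (S.K a : Set V)) (hma : m ≤ a) :
    g ∈ S.copies m a := by
  rcases le_total n a with hna | han
  · exact h.copies_mono hna hg
  · obtain ⟨g₁, hg₁, f, hf, hr, rfl⟩ := copies_factor hma han hg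
    have : f = Subtype.val := by
      refine h.copies_eq hl hf (h.val_mem_copies han) hs (fun j => ?_) (fun j => ⟨⟨_, hsa j⟩, rfl⟩)
      obtain ⟨x, hx⟩ := hsg j
      exact ⟨_, hx⟩
    subst this
    exact hg₁

/-- Raise both maps to a common target and factor `g` through `K a`. The outer factor shares the
walk with `f`, so it equals `f` and can be cancelled. -/
theorem CycleSeparated.exists_preimage (h : S.CycleSeparated) {m n a b l : ℕ} (hl : 0 < l)
    {f : ↥(S.K a : Set V) → V} (hf : f ∈ S.copies a b) {g : ↥(S.K m : Set V) → V}
    (hg : g ∈ S.copies m n) (hma : m ≤ a) {s : ℕ → ↥(S.K a : Set V)} {t : ℕ → ↥(S.K m : Set V)}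
    (hst : ∀ j, f (s j) = g (t j)) (hs : (fun j => f (s j)) ∈ reducedSeqs X l) :
    ∃ g₁ ∈ S.copies m a, ∀ j, (s j : V) = g₁ (t j) := by
  have hab := le_of_copies hf
  have hf' := h.copies_mono (le_max_right n b) hf
  obtain ⟨g₁, hg₁, f', hf'', hr, hgf⟩ := copies_factor hma (hab.trans (le_max_right n b))
    (h.copies_mono (le_max_left n b) hg)
  have hff : f = f' := by
    refine h.copies_eq hl hf' hf'' hs (fun j => ⟨_, rfl⟩) (fun j => ?_)
    rw [hst, hgf]
    exact ⟨_, rfl⟩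
  refine ⟨g₁, hg₁, fun j => ?_⟩
  have := hst j
  rw [hgf, ← hff] at this
  exact congrArg Subtype.val (copies_injective hf this)

/-- The size of a sequence: the least `m` such that it lies in a copy of `K m`. -/
noncomputable def seqSize (S : SelfSimilarData X) (s : ℕ → V) : ℕ :=
  sInf {m | ∃ k, ∃ f ∈ S.copies m k, ∀ j, s j ∈ Set.range f}

theorem seqSize_le {s : ℕ → V} {m k : ℕ} {f : ↥(S.K m : Set V) → V} (hf : f ∈ S.copies m k)
    (hs : ∀ j, s j ∈ Set.range f) : S.seqSize s ≤ m :=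
  Nat.sInf_le ⟨k, f, hf, hs⟩

theorem seqSize_spec {s : ℕ → V} {a : ℕ} (hs : ∀ j, s j ∈ (S.K a : Set V)) :
    ∃ k, ∃ f ∈ S.copies (S.seqSize s) k, ∀ j, s j ∈ Set.range f := by
  have hne : {m | ∃ k, ∃ f ∈ S.copies m k, ∀ j, s j ∈ Set.range f}.Nonempty :=
    ⟨a, a, _, copies_self_mem a, fun j => ⟨⟨_, hs j⟩, rfl⟩⟩
  exact Nat.sInf_mem hne

/-- A small copy containing the walk is carried forward by composition with `f` and backward by
`exists_preimage`, so the sizes bound each other. -/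
theorem CycleSeparated.seqSize_copy (h : S.CycleSeparated) {a b l : ℕ} (hl : 0 < l)
    {f : ↥(S.K a : Set V) → V} (hf : f ∈ S.copies a b) {s : ℕ → ↥(S.K a : Set V)}
    (hs : (fun j => (s j : V)) ∈ reducedSeqs X l) :
    S.seqSize (fun j => f (s j)) = S.seqSize (fun j => (s j : V)) := by
  have hfs := ((S.copyInvariant_reducedSeqs l) a b f hf s).2 hs
  have h1 : S.seqSize (fun j => f (s j)) ≤ a := seqSize_le hf fun j => ⟨_, rfl⟩
  have h2 : S.seqSize (fun j => (s j : V)) ≤ a :=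
    seqSize_le (copies_self_mem a) fun j => ⟨_, rfl⟩
  apply le_antisymm
  · obtain ⟨k, g, hg, hsg⟩ := seqSize_spec (S := S) (fun j => (s j).2)
    have hg' := h.mem_copies_of_subset hl hg hs hsg (fun j => (s j).2) h2
    refine seqSize_le (copies_comp hg' hf (copies_mem hg')) fun j => ?_
    obtain ⟨x, hx⟩ := hsg j
    exact ⟨x, congrArg f (Subtype.ext hx)⟩
  · obtain ⟨k, g, hg, hsg⟩ := seqSize_spec (S := S) (fun j => copies_mem hf (s j))
    choose t ht using hsg
    obtain ⟨g₁, hg₁, hst⟩ := h.exists_preimage hl hf hg h1 (fun j => (ht j).symm) hfs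
    exact seqSize_le hg₁ fun j => ⟨_, (hst j).symm⟩

theorem size_cycle (C : PrimePath X) : C.cycle.size S = S.seqSize C.1.seq := by
  simp only [PrimeCycle.size, seqSize, PrimeCycle.inSet_cycle]

end SelfSimilarData

/-- A prime path with shifted origin. -/
def PrimePath.shift {V : Type*} {X : SimpleGraph V} (C : PrimePath X) (k : ℕ) : PrimePath X :=
  PrimePath.ofSeq C.1.len_pos (PrimePath.seqShift_iterate_mem C.seq_mem k C.1.len_pos)

theorem PrimePath.seq_shift {V : Type*} {X : SimpleGraph V} (C : PrimePath X) (k j : ℕ) :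
    (C.shift k).1.seq j = C.1.seq (j + k) := by
  rw [PrimePath.shift, PrimePath.seq_ofSeq, seqShift_iterate]

theorem PrimePath.cycle_shift {V : Type*} {X : SimpleGraph V} (C : PrimePath X) (k : ℕ) :
    (C.shift k).cycle = C.cycle := by
  symm
  rw [PrimePath.cycle_eq_iff, ClosedPath.shift_iff]
  exact ⟨rfl, k, fun j => C.seq_shift k j⟩

theorem PrimePath.exists_shift_eq {V : Type*} {X : SimpleGraph V} {C D : PrimePath X}
    (h : C.cycle = D.cycle) : ∃ k, C.shift k = D := by
  rw [PrimePath.cycle_eq_iff, ClosedPath.shift_iff] at h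
  obtain ⟨hl, k, hk⟩ := h
  refine ⟨k, PrimePath.ext_seq hl ?_⟩
  funext j
  rw [PrimePath.seq_shift, hk]

namespace SelfSimilarData

variable {V : Type*} {X : SimpleGraph V} {S : SelfSimilarData X}

/-- The cycle `c` is the image of the sequence `t` under a map in `𝒢`. -/
def IsImage (S : SelfSimilarData X) {m : ℕ} (t : ℕ → ↥(S.K m : Set V)) (c : PrimeCycle X) : Prop :=
  ∃ n, ∃ g ∈ S.copies m n, ∃ C : PrimePath X, C.cycle = c ∧ ∀ j, C.1.seq j = g (t j)

/-- Size is what makes the factorizations possible: a move `f` has its source in some `K a`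
containing the cycle, and `a` is at least the size `m` of `t`. Forward, the map from `K m` has
target `K a` and is composed with `f`; backward, `exists_preimage` removes `f`. -/
theorem CycleSeparated.isImage_iff (h : S.CycleSeparated) {m l : ℕ} (hl : 0 < l)
    {t : ℕ → ↥(S.K m : Set V)} (ht : (fun j => (t j : V)) ∈ reducedSeqs X l)
    (hsize : S.seqSize (fun j => (t j : V)) = m) {C D : PrimePath X} (hmove : C.1.Move S D.1) :
    S.IsImage t C.cycle ↔ S.IsImage t D.cycle := by
  obtain ⟨hlen, a, b, f, hf, hCa, hfD⟩ := hmove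
  have hD : ∀ j, D.1.seq j = f ⟨C.1.seq j, (C.1.inSet_iff _).1 hCa j⟩ := hfD
  constructor
  · rintro ⟨n, g, hg, C', hC', hg'⟩
    obtain ⟨k, rfl⟩ := PrimePath.exists_shift_eq hC'.symm
    have hsz : S.seqSize (C.shift k).1.seq = m := by
      rw [funext hg', h.seqSize_copy hl hg ht, hsize]
    have hCk : ∀ j, (C.shift k).1.seq j ∈ (S.K a : Set V) := by
      intro j
      rw [C.seq_shift]
      exact (C.1.inSet_iff _).1 hCa _
    have hma : m ≤ a := by
      rw [← hsz]
      exact seqSize_le (copies_self_mem a) fun j => ⟨⟨_, hCk j⟩, rfl⟩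
    have hga : g ∈ S.copies m a :=
      h.mem_copies_of_subset (C.shift k).1.len_pos hg (C.shift k).seq_mem.1
        (fun j => ⟨_, (hg' j).symm⟩) hCk hma
    refine ⟨b, _, copies_comp hga hf (copies_mem hga), D.shift k, D.cycle_shift k, fun j => ?_⟩
    rw [D.seq_shift, hD]
    congr 1
    apply Subtype.ext
    change C.1.seq (j + k) = g (t j)
    rw [← C.seq_shift, hg']
  · rintro ⟨n, g, hg, D', hD', hg'⟩
    obtain ⟨k, rfl⟩ := PrimePath.exists_shift_eq hD'.symm
    have hsz : S.seqSize (D.shift k).1.seq = m := by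
      rw [funext hg', h.seqSize_copy hl hg ht, hsize]
    have hma : m ≤ a := by
      rw [← hsz]
      refine seqSize_le hf fun j => ?_
      rw [D.seq_shift, hD]
      exact ⟨_, rfl⟩
    have hst : ∀ j, f ⟨C.1.seq (j + k), (C.1.inSet_iff _).1 hCa _⟩ = g (t j) := by
      intro j
      rw [← hD, ← D.seq_shift, hg']
    have hred : (fun j => f ⟨C.1.seq (j + k), (C.1.inSet_iff _).1 hCa _⟩)
        ∈ reducedSeqs X (D.shift k).1.len := by
      have := (D.shift k).seq_mem.1
      rw [funext hg'] at this
      simpa only [hst] using this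
    obtain ⟨g₁, hg₁, hg₁t⟩ := h.exists_preimage (D.shift k).1.len_pos hf hg hma hst hred
    exact ⟨a, g₁, hg₁, C.shift k, C.cycle_shift k, fun j => (C.seq_shift k j).trans (hg₁t j)⟩

theorem CycleSeparated.isImage_of_toClass_eq (h : S.CycleSeparated) {m l : ℕ} (hl : 0 < l)
    {t : ℕ → ↥(S.K m : Set V)} (ht : (fun j => (t j : V)) ∈ reducedSeqs X l)
    (hsize : S.seqSize (fun j => (t j : V)) = m) {c d : PrimeCycle X}
    (hcd : c.toClass S = d.toClass S) (hc : S.IsImage t c) : S.IsImage t d := by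
  let φ : PrimeClass S → Prop := Quot.lift (S.IsImage t) (by
    rintro _ _ ⟨C, D, rfl, rfl, hmove⟩
    exact propext (h.isImage_iff hl ht hsize hmove))
  have : φ (c.toClass S) := hc
  rw [hcd] at this
  exact this

/-- Pull the cycle back to a sequence `t` in `K m`, with `m` its size. Then `g ↦ g ∘ t` is a
bijection from `𝒢(m,n)` to the cycles of the class in `K n`. It is injective by `copies_eq`, and
surjective because being an image of `t` is constant on the class. -/
theorem CycleSeparated.count_eq (h : S.CycleSeparated) (c : PrimeCycle X) {n : ℕ}
    (hn : c.size S ≤ n) : (c.toClass S).count n = (S.copies (c.size S) n).ncard := by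
  obtain ⟨C, rfl⟩ : ∃ C : PrimePath X, C.cycle = c := ⟨c.out, c.cycle_out⟩
  obtain ⟨a, ha⟩ : ∃ a, ∀ j, C.1.seq j ∈ (S.K a : Set V) := by
    have hfin : (Set.range C.1.seq).Finite := by
      refine ((Set.finite_Iio C.1.len).image C.1.seq).subset ?_
      rintro _ ⟨j, rfl⟩
      exact ⟨j % C.1.len, Nat.mod_lt _ C.1.len_pos, ClosedPath.mod_of_mem_closedSeqs C.1.seq_mem j⟩
    obtain ⟨a, ha⟩ := S.exists_subset_K hfin.toFinset
    exact ⟨a, fun j => ha (hfin.mem_toFinset.2 ⟨j, rfl⟩)⟩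
  rw [size_cycle] at hn ⊢
  have hspec := seqSize_spec ha
  generalize hm : S.seqSize C.1.seq = m at hn hspec ⊢
  obtain ⟨k, f, hf, hCf⟩ := hspec
  choose t ht using hCf
  have hl := C.1.len_pos
  set l := C.1.len with hl_def
  have hft : (fun j => f (t j)) ∈ primeSeqs X l := by
    rw [funext ht]; exact C.seq_mem
  have htp : (fun j => (t j : V)) ∈ primeSeqs X l := (S.copyInvariant_primeSeqs l m k f hf t).1 hft
  have hsize : S.seqSize (fun j => (t j : V)) = m := by
    rw [← h.seqSize_copy hl hf htp.1, funext ht, hm]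
  have himC : S.IsImage t C.cycle := ⟨k, f, hf, C, rfl, fun j => (ht j).symm⟩
  have hgp : ∀ {n'} {g : ↥(S.K m : Set V) → V}, g ∈ S.copies m n' →
      (fun j => g (t j)) ∈ primeSeqs X l := fun hg =>
    (S.copyInvariant_primeSeqs l m _ _ hg t).2 htp
  have hclass : ∀ {n'} {g : ↥(S.K m : Set V) → V} (hg : g ∈ S.copies m n'),
      (PrimePath.ofSeq hl (hgp hg)).cycle.toClass S
        = (PrimePath.ofSeq hl htp).cycle.toClass S := by
    intro n' g hg
    symm
    exact toClass_eq_of_move (move_of_seq (C := PrimePath.ofSeq hl htp)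
      (D := PrimePath.ofSeq hl (hgp hg)) rfl hg (PrimePath.seq_ofSeq hl htp)
      (PrimePath.seq_ofSeq hl (hgp hg)))
  have hCclass : C.cycle.toClass S = (PrimePath.ofSeq hl htp).cycle.toClass S := by
    rw [← hclass hf]
    congr 2
    refine PrimePath.ext_seq rfl ?_
    rw [PrimePath.seq_ofSeq, funext ht]
  rw [PrimeClass.count]
  symm
  refine Set.ncard_congr (fun g hg => (PrimePath.ofSeq hl (hgp hg)).cycle) ?_ ?_ ?_
  · intro g hg
    refine ⟨(hclass hg).trans hCclass.symm, ?_⟩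
    rw [PrimeCycle.inSet_cycle, PrimePath.seq_ofSeq]
    exact fun j => copies_mem hg _
  · intro g g' hg hg' heq
    obtain ⟨k', hk'⟩ := PrimePath.exists_shift_eq heq
    refine h.copies_eq hl hg hg' (hgp hg').1 (fun j => ?_) (fun j => ⟨_, rfl⟩)
    have h1 := (PrimePath.ofSeq hl (hgp hg)).seq_shift k' j
    rw [hk', PrimePath.seq_ofSeq, PrimePath.seq_ofSeq] at h1
    rw [h1]
    exact ⟨_, rfl⟩
  · rintro d ⟨hd, hdn⟩
    obtain ⟨n', g, hg, D, rfl, hD⟩ := h.isImage_of_toClass_eq hl htp.1 hsize hd.symm himC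
    rw [PrimeCycle.inSet_cycle] at hdn
    have hg' : g ∈ S.copies m n :=
      h.mem_copies_of_subset D.1.len_pos hg D.seq_mem.1 (fun j => ⟨_, (hD j).symm⟩) hdn hn
    refine ⟨g, hg', ?_⟩
    congr 1
    refine PrimePath.ext_seq ?_ ?_
    · have h1 : D.1.len = C.1.len := congrArg PrimeClass.len hd
      exact h1.symm
    · rw [PrimePath.seq_ofSeq]
      exact (funext hD).symm

theorem CycleSeparated.tendsto_copies (h : S.CycleSeparated) {μ : PrimeClass S → ℝ}
    (hμ : ∀ κ : PrimeClass S, κ.HasMultiplicity (μ κ)) (c : PrimeCycle X) :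
    Tendsto (fun n => ((S.copies (c.size S) n).ncard : ℝ) / ((S.K n).card : ℝ)) atTop
      (𝓝 (μ (c.toClass S))) := by
  refine (hμ (c.toClass S)).congr' ?_
  filter_upwards [eventually_ge_atTop (c.size S)] with n hn
  rw [h.count_eq c hn]

end SelfSimilarData

/-! ### The trace -/

section Basis

variable {V : Type*}

open Classical in
/-- The standard basis vector of `ℓ²(V)` at a vertex. -/
noncomputable def vertexBasis (v : V) : VertexSpace V := lp.single 2 v (1 : ℂ)

theorem vertexBasis_apply_self (v : V) : (vertexBasis v : V → ℂ) v = 1 := by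
  classical
  rw [vertexBasis]
  simp

theorem vertexBasis_apply_ne {v w : V} (h : w ≠ v) : (vertexBasis v : V → ℂ) w = 0 := by
  classical
  rw [vertexBasis]
  simp [lp.single_apply, h]

theorem norm_vertexBasis (v : V) : ‖vertexBasis v‖ = 1 := by
  classical
  rw [vertexBasis, lp.norm_single (by norm_num)]
  simp

theorem norm_apply_vertexBasis_le (T : VertexSpace V →L[ℂ] VertexSpace V) (v w : V) :
    ‖(T (vertexBasis v) : VertexSpace V) w‖ ≤ ‖T‖ := by
  refine (lp.norm_apply_le_norm (by norm_num) _ _).trans ?_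
  have := T.le_opNorm (vertexBasis v)
  rwa [norm_vertexBasis, mul_one] at this

theorem ext_vertexBasis {T T' : VertexSpace V →L[ℂ] VertexSpace V}
    (h : ∀ v, T (vertexBasis v) = T' (vertexBasis v)) : T = T' := by
  classical
  refine lp.ext_continuousLinearMap (by norm_num) fun v => ?_
  ext1
  have := h v
  rw [vertexBasis] at this
  simp only [ContinuousLinearMap.comp_apply]
  convert this using 2 <;> (simp [lp.singleContinuousLinearMap]; congr)

variable {X : SimpleGraph V} [X.LocallyFinite] {d : ℕ} (hd : ∀ v, X.degree v ≤ d)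

theorem weightedAdj_apply (c : V → ℂ) (hc : ∀ v, ‖c v‖ ≤ 1) (f : VertexSpace V) (x : V) :
    (weightedAdj X hd c hc f : VertexSpace V) x = c x * ∑ y ∈ X.neighborFinset x, f y := rfl

theorem norm_weightedAdj_le (c : V → ℂ) (hc : ∀ v, ‖c v‖ ≤ 1) : ‖weightedAdj X hd c hc‖ ≤ d :=
  LinearMap.mkContinuous_norm_le _ (Nat.cast_nonneg _) _

theorem weightedAdj_vertexBasis (c : V → ℂ) (hc : ∀ v, ‖c v‖ ≤ 1) (v : V) :
    weightedAdj X hd c hc (vertexBasis v) = ∑ y ∈ X.neighborFinset v, c y • vertexBasis y := by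
  classical
  ext x
  rw [weightedAdj_apply, lp.coeFn_sum, Finset.sum_apply]
  simp only [lp.coeFn_smul, Pi.smul_apply, smul_eq_mul]
  by_cases h : X.Adj v x
  · rw [Finset.sum_eq_single v, Finset.sum_eq_single x]
    · rw [vertexBasis_apply_self, vertexBasis_apply_self]
    · intro y _ hy
      rw [vertexBasis_apply_ne hy.symm, mul_zero]
    · intro hx
      exact absurd (by simpa using h) hx
    · intro y _ hy
      exact vertexBasis_apply_ne hy
    · intro hv
      exact absurd (by simpa using h.symm) hv
  · rw [Finset.sum_eq_zero, Finset.sum_eq_zero, mul_zero]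
    · intro y hy
      have : x ≠ y := by
        rintro rfl
        exact h (by simpa using hy)
      rw [vertexBasis_apply_ne this, mul_zero]
    · intro y hy
      refine vertexBasis_apply_ne ?_
      rintro rfl
      exact h (SimpleGraph.Adj.symm (by simpa using hy))

theorem adjOp_vertexBasis (v : V) :
    adjOp X hd (vertexBasis v) = ∑ y ∈ X.neighborFinset v, vertexBasis y := by
  rw [adjOp, weightedAdj_vertexBasis]
  simp

theorem walkOp_vertexBasis (v : V) : walkOp X hd (vertexBasis v)
    = ∑ y ∈ X.neighborFinset v, ((X.degree y : ℂ))⁻¹ • vertexBasis y := by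
  rw [walkOp, weightedAdj_vertexBasis]

end Basis

namespace SelfSimilarData

variable {V : Type*} {X : SimpleGraph V} (S : SelfSimilarData X)

/-- The normalized trace of the compression of an operator to `K n`. -/
noncomputable def avgTrace (n : ℕ) : (VertexSpace V →L[ℂ] VertexSpace V) →L[ℂ] ℂ :=
  LinearMap.mkContinuous
    { toFun := fun T => (∑ v ∈ S.K n, (T (vertexBasis v) : VertexSpace V) v) / ((S.K n).card : ℂ)
      map_add' := by
        intro T T'
        rw [← add_div, ← Finset.sum_add_distrib]
        rfl
      map_smul' := by
        intro c T
        rw [RingHom.id_apply, smul_eq_mul, mul_div_assoc', Finset.mul_sum]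
        rfl }
    1
    (by
      intro T
      change ‖(∑ v ∈ S.K n, (T (vertexBasis v) : VertexSpace V) v) / ((S.K n).card : ℂ)‖ ≤ 1 * ‖T‖
      rw [norm_div, Complex.norm_natCast, one_mul]
      refine div_le_of_le_mul₀ (Nat.cast_nonneg _) (norm_nonneg _) ?_
      refine (norm_sum_le _ _).trans ?_
      refine (Finset.sum_le_card_nsmul _ _ _ fun v _ => norm_apply_vertexBasis_le T v v).trans ?_
      rw [nsmul_eq_mul, mul_comm])

theorem avgTrace_apply (n : ℕ) (T : VertexSpace V →L[ℂ] VertexSpace V) : S.avgTrace n T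
    = (∑ v ∈ S.K n, (T (vertexBasis v) : VertexSpace V) v) / ((S.K n).card : ℂ) := rfl

theorem norm_avgTrace_le (n : ℕ) : ‖S.avgTrace n‖ ≤ 1 :=
  LinearMap.mkContinuous_norm_le _ zero_le_one _

theorem hasTrace_iff (T : VertexSpace V →L[ℂ] VertexSpace V) (t : ℂ) :
    S.HasTrace T t ↔ Tendsto (fun n => S.avgTrace n T) atTop (𝓝 t) := Iff.rfl

variable {S}

theorem HasTrace.add {T T' : VertexSpace V →L[ℂ] VertexSpace V} {t t' : ℂ} (h : S.HasTrace T t)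
    (h' : S.HasTrace T' t') : S.HasTrace (T + T') (t + t') := by
  rw [hasTrace_iff] at *
  simpa only [map_add] using Tendsto.add h h'

theorem HasTrace.smul {T : VertexSpace V →L[ℂ] VertexSpace V} {t : ℂ} (h : S.HasTrace T t)
    (c : ℂ) : S.HasTrace (c • T) (c * t) := by
  rw [hasTrace_iff] at *
  simpa only [map_smul, smul_eq_mul] using Tendsto.const_mul c h

theorem hasTrace_one [Infinite V] : S.HasTrace 1 1 := by
  rw [hasTrace_iff]
  refine tendsto_const_nhds.congr' ?_
  filter_upwards [S.card_tendsto.eventually_gt_atTop 0] with n hn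
  have hn' : ((S.K n).card : ℂ) ≠ 0 := by exact_mod_cast hn.ne'
  simp [avgTrace_apply, vertexBasis_apply_self, hn']

/-- Finitely many diagonal entries, all bounded by operator norms, do not change an average over
sets whose size tends to infinity. -/
theorem HasTrace.of_finite_ne [Infinite V] {T T' : VertexSpace V →L[ℂ] VertexSpace V} {t : ℂ}
    (h : S.HasTrace T t) (hf : {v | T' (vertexBasis v) ≠ T (vertexBasis v)}.Finite) :
    S.HasTrace T' t := by
  classical
  rw [hasTrace_iff] at *
  refine tendsto_of_tendsto_of_dist h ?_
  have h0 : Tendsto (fun n => (hf.toFinset.card * (‖T‖ + ‖T'‖)) / ((S.K n).card : ℝ)) atTop (𝓝 0) :=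
    tendsto_const_nhds.div_atTop (tendsto_natCast_atTop_atTop.comp S.card_tendsto)
  refine squeeze_zero (fun n => dist_nonneg) (fun n => ?_) h0
  rw [dist_eq_norm, avgTrace_apply, avgTrace_apply, ← sub_div, norm_div, Complex.norm_natCast,
    ← Finset.sum_sub_distrib]
  refine div_le_div_of_nonneg_right ?_ (Nat.cast_nonneg _)
  rw [← Finset.sum_filter_of_ne (p := fun v => v ∈ hf.toFinset)]
  · refine (norm_sum_le _ _).trans ?_
    refine (Finset.sum_le_card_nsmul _ _ (‖T‖ + ‖T'‖) fun v _ => (norm_sub_le _ _).trans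
      (add_le_add (norm_apply_vertexBasis_le T v v) (norm_apply_vertexBasis_le T' v v))).trans ?_
    rw [nsmul_eq_mul]
    refine mul_le_mul_of_nonneg_right ?_ (by positivity)
    exact_mod_cast Finset.card_le_card fun v hv => (Finset.mem_filter.1 hv).2
  · intro v _ hv
    rw [Set.Finite.mem_toFinset]
    intro heq
    exact hv (by rw [heq, sub_self])

variable [X.LocallyFinite]

open Classical in
/-- The vertices of `W` at which the powers of the adjacency operators of `X` and of the subgraph
differ. -/
noncomputable def powDefect {d : ℕ} (hd : ∀ v, X.degree v ≤ d) (W : Finset V) (k : ℕ) : Finset V :=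
  W.filter fun v => ∃ h : v ∈ (W : Set V), (adjOp X hd ^ k) (vertexBasis v)
    ≠ ∑ w : ↥(W : Set V), ((((X.induce (W : Set V)).adjMatrix ℝ ^ k) w ⟨v, h⟩ : ℝ) : ℂ) •
      vertexBasis (w : V)

/-- Passing from `k` to `k + 1`, a vertex off the frontier can become defective only if one of its
neighbours was; this gives the recursion `1 + c * d` for the constant. -/
theorem powDefect_card_le {d : ℕ} (hd : ∀ v, X.degree v ≤ d) (k : ℕ) :
    ∃ c : ℕ, ∀ W : Finset V, (powDefect hd W k).card
      ≤ c * (graphFrontier X (W : Set V)).ncard := by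
  classical
  induction k with
  | zero =>
    refine ⟨0, fun W => ?_⟩
    rw [zero_mul, Nat.le_zero, Finset.card_eq_zero, powDefect, Finset.filter_eq_empty_iff]
    rintro v - ⟨h, hne⟩
    apply hne
    rw [pow_zero, Finset.sum_eq_single (⟨v, h⟩ : ↥(W : Set V))]
    · simp
    · intro w _ hw
      simp [Matrix.one_apply_ne hw]
    · simp
  | succ k ih =>
    obtain ⟨c, hc⟩ := ih
    refine ⟨1 + c * d, fun W => ?_⟩
    have hfr : (graphFrontier X (W : Set V)).Finite :=
      (Finset.finite_toSet W).subset fun v hv => hv.1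
    have hsub : powDefect hd W (k + 1)
        ⊆ hfr.toFinset ∪ (powDefect hd W k).biUnion fun y => X.neighborFinset y := by
      intro v hv
      obtain ⟨hvW, h, hne⟩ := Finset.mem_filter.1 hv
      by_contra hnot
      rw [Finset.mem_union, not_or] at hnot
      obtain ⟨hF, hB⟩ := hnot
      rw [Set.Finite.mem_toFinset] at hF
      have hnb : ∀ y, X.Adj v y → y ∈ (W : Set V) := by
        intro y hy
        by_contra hyW
        exact hF ⟨h, y, hyW, hy⟩
      apply hne
      have hgood : ∀ y (hy : X.Adj v y), (adjOp X hd ^ k) (vertexBasis y)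
          = ∑ w : ↥(W : Set V), ((((X.induce (W : Set V)).adjMatrix ℝ ^ k) w ⟨y, hnb y hy⟩ : ℝ) : ℂ) •
            vertexBasis (w : V) := by
        intro y hy
        by_contra hyne
        refine hB (Finset.mem_biUnion.2 ⟨y, Finset.mem_filter.2 ⟨hnb y hy, hnb y hy, hyne⟩, ?_⟩)
        simpa using hy.symm
      rw [pow_succ, mul_apply_eq_comp, adjOp_vertexBasis, map_sum]
      have e1 : ∑ y ∈ X.neighborFinset v, (adjOp X hd ^ k) (vertexBasis y)
          = ∑ y : ↥(W : Set V), if X.Adj v y then (adjOp X hd ^ k) (vertexBasis (y : V)) else 0 := by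
        rw [← Finset.sum_filter]
        symm
        refine Finset.sum_bij (fun y _ => (y : V)) ?_ ?_ ?_ ?_
        · intro y hy
          simpa using hy
        · intro y _ z _ hyz
          exact Subtype.ext hyz
        · intro y hy
          have hy' : X.Adj v y := by simpa using hy
          exact ⟨⟨y, hnb y hy'⟩, by simpa using hy', rfl⟩
        · intro y _
          rfl
      rw [e1]
      have e2 : ∀ y : ↥(W : Set V),
          (if X.Adj v y then (adjOp X hd ^ k) (vertexBasis (y : V)) else 0)
          = ∑ w : ↥(W : Set V), ((((X.induce (W : Set V)).adjMatrix ℝ ^ k) w y *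
            (X.induce (W : Set V)).adjMatrix ℝ y ⟨v, h⟩ : ℝ) : ℂ) • vertexBasis (w : V) := by
        intro y
        by_cases hy : X.Adj v y
        · have hy' : (X.induce (W : Set V)).Adj y ⟨v, h⟩ := hy.symm
          rw [if_pos hy, hgood y hy]
          simp [SimpleGraph.adjMatrix_apply, hy.symm]
        · rw [if_neg hy]
          have hy' : ¬ X.Adj y v := fun h' => hy h'.symm
          simp [SimpleGraph.adjMatrix_apply, hy']
      simp only [e2]
      rw [Finset.sum_comm]
      refine Finset.sum_congr rfl fun w _ => ?_
      rw [← Finset.sum_smul, pow_succ, Matrix.mul_apply, Complex.ofReal_sum]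
    calc (powDefect hd W (k + 1)).card
        ≤ hfr.toFinset.card + ((powDefect hd W k).biUnion fun y => X.neighborFinset y).card :=
          (Finset.card_le_card hsub).trans (Finset.card_union_le _ _)
      _ ≤ (graphFrontier X (W : Set V)).ncard + (powDefect hd W k).card * d := by
          rw [Set.ncard_eq_toFinset_card _ hfr]
          refine Nat.add_le_add_left (Finset.card_biUnion_le_card_mul _ _ _ fun y _ => ?_) _
          rw [X.card_neighborFinset_eq_degree]
          exact hd y
      _ ≤ (graphFrontier X (W : Set V)).ncard
          + c * (graphFrontier X (W : Set V)).ncard * d :=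
          Nat.add_le_add_left (Nat.mul_le_mul_right _ (hc W)) _
      _ = _ := by ring

open Classical in
theorem abs_adjMatrix_pow_le {d : ℕ} (hd : ∀ v, X.degree v ≤ d) (W : Finset V) (k : ℕ)
    (v : ↥(W : Set V)) : |((X.induce (W : Set V)).adjMatrix ℝ ^ k) v v| ≤ (d : ℝ) ^ k := by
  have hd' : ∀ x, (X.induce (W : Set V)).degree x ≤ d := fun x =>
    (degree_induce_le' _ x).trans (hd x)
  have hrow : ∀ x, ∑ y, |(X.induce (W : Set V)).adjMatrix ℝ x y| ≤ d := by
    intro x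
    refine le_trans (le_of_eq (Finset.sum_congr rfl fun y _ => ?_))
      ((X.induce (W : Set V)).sum_abs_adjMatrix_le hd' x)
    rw [← (X.induce (W : Set V)).transpose_adjMatrix, Matrix.transpose_apply,
      (X.induce (W : Set V)).transpose_adjMatrix]
  have h : ∀ k x, ∑ y, |((X.induce (W : Set V)).adjMatrix ℝ ^ k) x y| ≤ (d : ℝ) ^ k := by
    intro k
    induction k with
    | zero =>
      intro x
      have : ∀ y, |(1 : Matrix ↥(W : Set V) ↥(W : Set V) ℝ) x y| = if x = y then 1 else 0 := by
        intro y
        rw [Matrix.one_apply]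
        split_ifs <;> simp
      simp [this]
    | succ k ih =>
      intro x
      rw [pow_succ', pow_succ']
      exact SimpleGraph.sum_abs_mul_row_le (by positivity) hrow ih x
  exact (Finset.single_le_sum (f := fun y => |((X.induce (W : Set V)).adjMatrix ℝ ^ k) v y|)
    (fun y _ => abs_nonneg _) (Finset.mem_univ v)).trans (h k v)

/-- Off the defect set, the diagonal entries of the operator power are those of the matrix power for
`K n`, whose trace counts closed walks. The defect set is at most a constant times the frontier,
hence negligible. -/
theorem hasTrace_adjOp_pow [Infinite V] {d : ℕ} (hd : ∀ v, X.degree v ≤ d) {k : ℕ} (hk : 0 < k)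
    {a : ℝ} (ha : Tendsto (fun n => (seqCount (closedSeqs X k) (S.K n : Set V) : ℝ)
      / (S.K n).card) atTop (𝓝 a)) : S.HasTrace (adjOp X hd ^ k) (a : ℂ) := by
  classical
  rw [hasTrace_iff]
  have ha' : Tendsto (fun n => (((seqCount (closedSeqs X k) (S.K n : Set V) : ℝ)
      / (S.K n).card : ℝ) : ℂ)) atTop (𝓝 (a : ℂ)) :=
    (Complex.continuous_ofReal.tendsto a).comp ha
  refine tendsto_of_tendsto_of_dist ha' ?_
  obtain ⟨c, hc⟩ := powDefect_card_le hd k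
  have h0 : Tendsto (fun n => (c * (‖adjOp X hd ^ k‖ + (d : ℝ) ^ k)) *
      (((graphFrontier X (S.K n : Set V)).ncard : ℝ) / ((S.K n).card : ℝ))) atTop (𝓝 0) := by
    simpa using S.amenable.const_mul (c * (‖adjOp X hd ^ k‖ + (d : ℝ) ^ k))
  refine squeeze_zero (fun n => dist_nonneg) (fun n => ?_) h0
  have e1 : ((seqCount (closedSeqs X k) (S.K n : Set V) : ℝ) : ℂ)
      = ∑ v : ↥(S.K n : Set V), ((((X.induce (S.K n : Set V)).adjMatrix ℝ ^ k) v v : ℝ) : ℂ) := by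
    rw [← trace_adjMatrix_induce_pow X _ hk, Matrix.trace, Complex.ofReal_sum]
    rfl
  have e2 : ∑ v ∈ S.K n, ((adjOp X hd ^ k) (vertexBasis v) : VertexSpace V) v
      = ∑ v : ↥(S.K n : Set V), ((adjOp X hd ^ k) (vertexBasis (v : V)) : VertexSpace V) v :=
    (Finset.sum_coe_sort (S.K n)
      fun v => ((adjOp X hd ^ k) (vertexBasis v) : VertexSpace V) v).symm
  rw [dist_eq_norm, avgTrace_apply, Complex.ofReal_div, e1, e2, Complex.ofReal_natCast, ← sub_div,
    norm_div, Complex.norm_natCast, ← Finset.sum_sub_distrib, mul_div_assoc']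
  refine div_le_div_of_nonneg_right ?_ (Nat.cast_nonneg _)
  let B : Finset ↥(S.K n : Set V) := Finset.univ.filter fun v => (v : V) ∈ powDefect hd (S.K n) k
  have hB : B.card ≤ (powDefect hd (S.K n) k).card :=
    Finset.card_le_card_of_injOn Subtype.val (fun v hv => (Finset.mem_filter.1 hv).2)
      Subtype.val_injective.injOn
  have hzero : ∀ v ∉ B, ((((X.induce (S.K n : Set V)).adjMatrix ℝ ^ k) v v : ℝ) : ℂ)
      - ((adjOp X hd ^ k) (vertexBasis (v : V)) : VertexSpace V) v = 0 := by
    intro v hv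
    have hgood : (adjOp X hd ^ k) (vertexBasis (v : V))
        = ∑ w : ↥(S.K n : Set V), ((((X.induce (S.K n : Set V)).adjMatrix ℝ ^ k) w v : ℝ) : ℂ) •
          vertexBasis (w : V) := by
      by_contra hne
      exact hv (Finset.mem_filter.2 ⟨Finset.mem_univ _, Finset.mem_filter.2 ⟨v.2, v.2, hne⟩⟩)
    rw [hgood, lp.coeFn_sum, Finset.sum_apply, Finset.sum_eq_single v]
    · rw [lp.coeFn_smul, Pi.smul_apply, vertexBasis_apply_self, smul_eq_mul, mul_one, sub_self]
    · intro w _ hw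
      have : (v : V) ≠ w := fun h => hw (Subtype.ext h.symm)
      rw [lp.coeFn_smul, Pi.smul_apply, vertexBasis_apply_ne this, smul_zero]
    · simp
  rw [← Finset.sum_subset (Finset.subset_univ B) fun v _ hv => hzero v hv]
  refine (norm_sum_le _ _).trans ?_
  refine (Finset.sum_le_card_nsmul _ _ (‖adjOp X hd ^ k‖ + (d : ℝ) ^ k) fun v _ =>
    (norm_sub_le _ _).trans ?_).trans ?_
  · rw [add_comm, Complex.norm_real, Real.norm_eq_abs]
    exact add_le_add (norm_apply_vertexBasis_le _ _ _) (abs_adjMatrix_pow_le hd _ k v)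
  · rw [nsmul_eq_mul]
    have h5 : (B.card : ℝ) ≤ c * (graphFrontier X (S.K n : Set V)).ncard := by
      exact_mod_cast hB.trans (hc _)
    calc _ ≤ (c * (graphFrontier X (S.K n : Set V)).ncard : ℝ)
          * (‖adjOp X hd ^ k‖ + (d : ℝ) ^ k) := mul_le_mul_of_nonneg_right h5 (by positivity)
      _ = _ := by ring

-- The operators differ at a basis vector for power `k + 1` only next to a difference for power `k`
-- or next to a vertex of degree other than `q + 1`; both sets of neighbours are finite.
omit [X.LocallyFinite] in
theorem finite_ne_walkOp_pow [X.LocallyFinite] {d q : ℕ} (hd : ∀ v, X.degree v ≤ d)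
    (hq : {v | X.degree v ≠ q + 1}.Finite) (k : ℕ) :
    {v | (walkOp X hd ^ k) (vertexBasis v)
      ≠ ((((q : ℂ) + 1)⁻¹ ^ k) • adjOp X hd ^ k) (vertexBasis v)}.Finite := by
  classical
  induction k with
  | zero =>
    convert Set.finite_empty (α := V)
    ext v
    simp
  | succ k ih =>
    have hnb : ∀ {s : Set V}, s.Finite → {v | ∃ y ∈ s, X.Adj v y}.Finite := by
      intro s hs
      refine (hs.biUnion fun y _ => (X.neighborFinset y).finite_toSet).subset ?_
      rintro v ⟨y, hy, hadj⟩
      exact Set.mem_biUnion hy (by simpa using hadj.symm)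
    refine ((hnb ih).union (hnb hq)).subset ?_
    intro v hv
    by_contra hnot
    rw [Set.mem_union, not_or] at hnot
    obtain ⟨h1, h2⟩ := hnot
    apply hv
    have h1' : ∀ y, X.Adj v y → (walkOp X hd ^ k) (vertexBasis y)
        = ((((q : ℂ) + 1)⁻¹ ^ k) • adjOp X hd ^ k) (vertexBasis y) := by
      intro y hy
      by_contra hne
      exact h1 ⟨y, hne, hy⟩
    have h2' : ∀ y, X.Adj v y → X.degree y = q + 1 := by
      intro y hy
      by_contra hne
      exact h2 ⟨y, hne, hy⟩
    rw [pow_succ, mul_apply_eq_comp, walkOp_vertexBasis, map_sum, pow_succ,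
      smul_apply, pow_succ (adjOp X hd), mul_apply_eq_comp,
      adjOp_vertexBasis, map_sum, Finset.smul_sum]
    refine Finset.sum_congr rfl fun y hy => ?_
    have hy' : X.Adj v y := by simpa using hy
    rw [map_smul, h1' y hy', h2' y hy', smul_apply, smul_smul]
    congr 1
    push_cast
    ring

theorem hasTrace_walkOp_pow [Infinite V] {d q : ℕ} (hd : ∀ v, X.degree v ≤ d)
    (hq : {v | X.degree v ≠ q + 1}.Finite) {k : ℕ} {a : ℂ} (ha : S.HasTrace (adjOp X hd ^ k) a) :
    S.HasTrace (walkOp X hd ^ k) (((q : ℂ) + 1)⁻¹ ^ k * a) :=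
  (ha.smul _).of_finite_ne (finite_ne_walkOp_pow hd hq k)

end SelfSimilarData

/-! ### Self-adjointness and diagonal conjugation -/

section Diagonal

variable {V : Type*}

theorem isSelfAdjoint_of_vertexBasis {T : VertexSpace V →L[ℂ] VertexSpace V}
    (h : ∀ v w, (T (vertexBasis v) : VertexSpace V) w
      = starRingEnd ℂ ((T (vertexBasis w) : VertexSpace V) v)) : IsSelfAdjoint T := by
  classical
  have hin : ∀ (v : V) (f : VertexSpace V), inner ℂ (vertexBasis v) f = f v := by
    intro v f
    have : vertexBasis v = lp.single 2 v (1 : ℂ) := by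
      rw [vertexBasis]
    rw [this, lp.inner_single_left]
    simp
  rw [ContinuousLinearMap.isSelfAdjoint_iff']
  refine ext_vertexBasis fun v => ?_
  ext w
  rw [← hin w, ContinuousLinearMap.adjoint_inner_right, ← inner_conj_symm, hin, h v w]

/-- Multiplication by a bounded function on `ℓ²(V)`. -/
noncomputable def diagOp (c : V → ℂ) (M : ℝ) (hc : ∀ v, ‖c v‖ ≤ M) :
    VertexSpace V →L[ℂ] VertexSpace V :=
  LinearMap.mkContinuous
    { toFun := fun f => ⟨fun x => c x * f x, ((lp.memℓp f).const_smul (M : ℂ)).mono' fun x => by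
        rw [norm_mul, Pi.smul_apply, norm_smul, Complex.norm_real, Real.norm_eq_abs]
        exact mul_le_mul_of_nonneg_right ((hc x).trans (le_abs_self _)) (norm_nonneg _)⟩
      map_add' := fun f g => by
        ext x
        exact mul_add (c x) (f x) (g x)
      map_smul' := fun a f => by
        ext x
        exact mul_left_comm (c x) a (f x) }
    |M| (fun f => by
      refine lp.norm_le_of_forall_sum_le (by norm_num) (by positivity) fun s => ?_
      have h2 : (2 : ENNReal).toReal = ((2 : ℕ) : ℝ) := by norm_num
      simp only [h2, Real.rpow_natCast]
      have h3 := lp.sum_rpow_le_norm_rpow (p := 2) (by norm_num) f s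
      simp only [h2, Real.rpow_natCast] at h3
      rw [mul_pow]
      refine le_trans ?_ (mul_le_mul_of_nonneg_left h3 (by positivity))
      rw [Finset.mul_sum]
      refine Finset.sum_le_sum fun x _ => ?_
      change ‖c x * f x‖ ^ 2 ≤ _
      rw [norm_mul, mul_pow]
      gcongr
      exact (hc x).trans (le_abs_self _))

theorem diagOp_apply (c : V → ℂ) (M : ℝ) (hc : ∀ v, ‖c v‖ ≤ M) (f : VertexSpace V) (x : V) :
    (diagOp c M hc f : VertexSpace V) x = c x * f x := rfl

theorem diagOp_vertexBasis (c : V → ℂ) (M : ℝ) (hc : ∀ v, ‖c v‖ ≤ M) (v : V) :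
    diagOp c M hc (vertexBasis v) = c v • vertexBasis v := by
  ext x
  rw [diagOp_apply, lp.coeFn_smul, Pi.smul_apply, smul_eq_mul]
  by_cases h : x = v
  · rw [h]
  · rw [vertexBasis_apply_ne h, mul_zero, mul_zero]

/-- Multiplication by an invertible bounded function with bounded inverse. -/
noncomputable def diagUnit (c : V → ℂ) (M M' : ℝ) (hc : ∀ v, ‖c v‖ ≤ M)
    (hc' : ∀ v, ‖(c v)⁻¹‖ ≤ M') (h0 : ∀ v, c v ≠ 0) : (VertexSpace V →L[ℂ] VertexSpace V)ˣ where
  val := diagOp c M hc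
  inv := diagOp (fun v => (c v)⁻¹) M' hc'
  val_inv := by
    ext f x
    rw [mul_apply_eq_comp, diagOp_apply, diagOp_apply, mul_inv_cancel_left₀ (h0 x)]
    rfl
  inv_val := by
    ext f x
    rw [mul_apply_eq_comp, diagOp_apply, diagOp_apply, inv_mul_cancel_left₀ (h0 x)]
    rfl

/-- A unit acting diagonally in the standard basis. -/
def IsDiagonalUnit (s : (VertexSpace V →L[ℂ] VertexSpace V)ˣ) : Prop :=
  ∃ c M M' hc hc' h0, s = diagUnit c M M' hc hc' h0

/-- The scalar `c v` and its inverse cancel in the diagonal entry, so conjugation by a diagonal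
operator changes no trace. -/
theorem IsDiagonalUnit.conj_apply {s : (VertexSpace V →L[ℂ] VertexSpace V)ˣ}
    (hs : IsDiagonalUnit s) (T : VertexSpace V →L[ℂ] VertexSpace V) (v : V) :
    ((↑s * T * ↑s⁻¹ : VertexSpace V →L[ℂ] VertexSpace V) (vertexBasis v) : VertexSpace V) v
      = (T (vertexBasis v) : VertexSpace V) v := by
  obtain ⟨c, M, M', hc, hc', h0, rfl⟩ := hs
  rw [mul_apply_eq_comp, mul_apply_eq_comp]
  change c v * (T (diagOp (fun v => (c v)⁻¹) M' hc' (vertexBasis v)) : VertexSpace V) v = _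
  rw [diagOp_vertexBasis, map_smul, lp.coeFn_smul, Pi.smul_apply, smul_eq_mul,
    mul_inv_cancel_left₀ (h0 v)]

theorem isDiagonalUnit_one : IsDiagonalUnit (1 : (VertexSpace V →L[ℂ] VertexSpace V)ˣ) := by
  refine ⟨fun _ => 1, 1, 1, by simp, by simp, by simp, ?_⟩
  ext f x
  change f x = 1 * f x
  rw [one_mul]

theorem SelfSimilarData.hasTrace_conj {X : SimpleGraph V} {S : SelfSimilarData X}
    {T : VertexSpace V →L[ℂ] VertexSpace V} {t : ℂ}
    {s : (VertexSpace V →L[ℂ] VertexSpace V)ˣ} (hs : IsDiagonalUnit s) :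
    S.HasTrace (↑s * T * ↑s⁻¹) t ↔ S.HasTrace T t := by
  simp only [hasTrace_iff, avgTrace_apply, hs.conj_apply]

variable {X : SimpleGraph V} [X.LocallyFinite] {d : ℕ} (hd : ∀ v, X.degree v ≤ d)

theorem isSelfAdjoint_adjOp : IsSelfAdjoint (adjOp X hd) := by
  classical
  refine isSelfAdjoint_of_vertexBasis fun v w => ?_
  have h : ∀ v w, (adjOp X hd (vertexBasis v) : VertexSpace V) w
      = if X.Adj v w then 1 else 0 := by
    intro v w
    rw [adjOp_vertexBasis, lp.coeFn_sum, Finset.sum_apply]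
    split_ifs with hvw
    · rw [Finset.sum_eq_single w, vertexBasis_apply_self]
      · intro y _ hy
        exact vertexBasis_apply_ne hy.symm
      · intro hw
        exact absurd (by simpa using hvw) hw
    · refine Finset.sum_eq_zero fun y hy => vertexBasis_apply_ne ?_
      rintro rfl
      exact hvw (by simpa using hy)
  rw [h, h, X.adj_comm w v]
  split_ifs <;> simp

/-- The inverse square root of the degree. -/
noncomputable def invSqrtDegree (X : SimpleGraph V) [X.LocallyFinite] (v : V) : ℝ :=
  (√(X.degree v))⁻¹

theorem invSqrtDegree_nonneg (v : V) : 0 ≤ invSqrtDegree X v := by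
  unfold invSqrtDegree
  positivity

theorem invSqrtDegree_sq (v : V) : invSqrtDegree X v ^ 2 = (X.degree v : ℝ)⁻¹ := by
  rw [invSqrtDegree, inv_pow, Real.sq_sqrt (Nat.cast_nonneg _)]

theorem norm_invSqrtDegree_le (v : V) : ‖(invSqrtDegree X v : ℂ)‖ ≤ 1 := by
  rw [Complex.norm_real, Real.norm_eq_abs, abs_of_nonneg (invSqrtDegree_nonneg v)]
  rcases Nat.eq_zero_or_pos (X.degree v) with h | h
  · simp [invSqrtDegree, h]
  · refine inv_le_one_of_one_le₀ ?_
    rw [Real.one_le_sqrt]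
    exact_mod_cast h

/-- The self-adjoint form of the transition operator. -/
noncomputable def symmWalkOp (X : SimpleGraph V) [X.LocallyFinite] {d : ℕ}
    (hd : ∀ v, X.degree v ≤ d) : VertexSpace V →L[ℂ] VertexSpace V :=
  weightedAdj X hd (fun v => (invSqrtDegree X v : ℂ)) norm_invSqrtDegree_le
    * diagOp (fun v => (invSqrtDegree X v : ℂ)) 1 norm_invSqrtDegree_le

theorem symmWalkOp_apply (f : VertexSpace V) (x : V) : (symmWalkOp X hd f : VertexSpace V) x
    = invSqrtDegree X x * ∑ y ∈ X.neighborFinset x, invSqrtDegree X y * f y := rfl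

theorem isSelfAdjoint_symmWalkOp : IsSelfAdjoint (symmWalkOp X hd) := by
  classical
  refine isSelfAdjoint_of_vertexBasis fun v w => ?_
  have h : ∀ v w, (symmWalkOp X hd (vertexBasis v) : VertexSpace V) w
      = if X.Adj w v then (invSqrtDegree X w : ℂ) * invSqrtDegree X v else 0 := by
    intro v w
    rw [symmWalkOp_apply]
    split_ifs with hvw
    · rw [Finset.sum_eq_single v, vertexBasis_apply_self, mul_one]
      · intro y _ hy
        rw [vertexBasis_apply_ne hy, mul_zero]
      · intro hw
        exact absurd (by simpa using hvw) hw
    · rw [Finset.sum_eq_zero, mul_zero]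
      intro y hy
      rw [vertexBasis_apply_ne, mul_zero]
      rintro rfl
      exact hvw (by simpa using hy)
  rw [h, h, X.adj_comm w v]
  split_ifs
  · rw [map_mul, Complex.conj_ofReal, Complex.conj_ofReal, mul_comm]
  · simp

/-- By the Cauchy–Schwarz inequality over the neighbours of `x`, the factor `1 / deg x` is absorbed;
after summation over `x` the weight `1 / deg y` is met at most `deg y` times. -/
theorem norm_symmWalkOp_le : ‖symmWalkOp X hd‖ ≤ 1 := by
  classical
  refine ContinuousLinearMap.opNorm_le_bound _ zero_le_one fun f => ?_
  refine lp.norm_le_of_forall_sum_le (by norm_num) (by positivity) fun s => ?_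
  have h2 : (2 : ENNReal).toReal = ((2 : ℕ) : ℝ) := by norm_num
  simp only [h2, Real.rpow_natCast]
  have h1 : ∀ x, ‖(symmWalkOp X hd f : VertexSpace V) x‖ ^ 2
      ≤ ∑ y ∈ X.neighborFinset x, (X.degree y : ℝ)⁻¹ * ‖f y‖ ^ 2 := by
    intro x
    rw [symmWalkOp_apply, norm_mul, mul_pow, Complex.norm_real, Real.norm_eq_abs, sq_abs,
      invSqrtDegree_sq]
    refine inv_mul_le_of_le_mul₀ (Nat.cast_nonneg _)
      (Finset.sum_nonneg fun _ _ => by positivity) ?_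
    calc ‖∑ y ∈ X.neighborFinset x, (invSqrtDegree X y : ℂ) * f y‖ ^ 2
        ≤ (∑ y ∈ X.neighborFinset x, ‖(invSqrtDegree X y : ℂ) * f y‖) ^ 2 := by
          gcongr
          exact norm_sum_le _ _
      _ ≤ ((X.neighborFinset x).card : ℝ)
          * ∑ y ∈ X.neighborFinset x, ‖(invSqrtDegree X y : ℂ) * f y‖ ^ 2 :=
          sq_sum_le_card_mul_sum_sq
      _ = _ := by
          rw [X.card_neighborFinset_eq_degree]
          congr 1
          refine Finset.sum_congr rfl fun y _ => ?_
          rw [norm_mul, mul_pow, Complex.norm_real, Real.norm_eq_abs, sq_abs, invSqrtDegree_sq]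
  refine (Finset.sum_le_sum fun x _ => h1 x).trans ?_
  rw [one_mul]
  set t := s.biUnion fun x => X.neighborFinset x with ht
  have e : ∑ x ∈ s, ∑ y ∈ X.neighborFinset x, (X.degree y : ℝ)⁻¹ * ‖f y‖ ^ 2
      = ∑ y ∈ t, ∑ x ∈ s.filter (fun x => X.Adj x y), (X.degree y : ℝ)⁻¹ * ‖f y‖ ^ 2 := by
    apply Finset.sum_comm'
    intro x y
    simp only [ht, Finset.mem_biUnion, Finset.mem_filter, SimpleGraph.mem_neighborFinset]
    constructor
    · rintro ⟨hx, hxy⟩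
      exact ⟨⟨hx, hxy⟩, x, hx, hxy⟩
    · rintro ⟨h, _⟩
      exact h
  rw [e]
  have h3 := lp.sum_rpow_le_norm_rpow (p := 2) (by norm_num) f t
  simp only [h2, Real.rpow_natCast] at h3
  refine le_trans (Finset.sum_le_sum fun y _ => ?_) h3
  rw [Finset.sum_const, nsmul_eq_mul, ← mul_assoc]
  refine mul_le_of_le_one_left (by positivity) ?_
  rw [← div_eq_mul_inv]
  refine div_le_one_of_le₀ ?_ (Nat.cast_nonneg _)
  rw [← X.card_neighborFinset_eq_degree]
  refine Nat.cast_le.2 (Finset.card_le_card fun x hx => ?_)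
  simpa using (Finset.mem_filter.1 hx).2.symm

/-- The transition operator is conjugate to its self-adjoint form. -/
theorem exists_walkOp_eq_conj (hpos : ∀ v, 0 < X.degree v) :
    ∃ s : (VertexSpace V →L[ℂ] VertexSpace V)ˣ, IsDiagonalUnit s ∧
      walkOp X hd = ↑s * symmWalkOp X hd * ↑s⁻¹ := by
  have h0 : ∀ v, invSqrtDegree X v ≠ 0 := by
    intro v
    have : (0 : ℝ) < X.degree v := by exact_mod_cast hpos v
    unfold invSqrtDegree
    positivity
  have h0' : ∀ v, (invSqrtDegree X v : ℂ) ≠ 0 := fun v => by exact_mod_cast h0 v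
  refine ⟨diagUnit (fun v => (invSqrtDegree X v : ℂ)) 1 (√d) norm_invSqrtDegree_le ?_ h0',
    ⟨_, _, _, _, _, _, rfl⟩, ?_⟩
  · intro v
    rw [invSqrtDegree, Complex.ofReal_inv, inv_inv, Complex.norm_real, Real.norm_eq_abs,
      abs_of_nonneg (Real.sqrt_nonneg _)]
    exact Real.sqrt_le_sqrt (by exact_mod_cast hd v)
  · ext f x
    rw [mul_apply_eq_comp, mul_apply_eq_comp]
    change ((X.degree x : ℂ))⁻¹ * ∑ y ∈ X.neighborFinset x, f y = (invSqrtDegree X x : ℂ) *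
      ((invSqrtDegree X x : ℂ) * ∑ y ∈ X.neighborFinset x,
        (invSqrtDegree X y : ℂ) * ((invSqrtDegree X y : ℂ)⁻¹ * f y))
    rw [← mul_assoc, ← sq, ← Complex.ofReal_pow, invSqrtDegree_sq, Complex.ofReal_inv,
      Complex.ofReal_natCast]
    congr 1
    exact Finset.sum_congr rfl fun y _ => (mul_inv_cancel_left₀ (h0' y) _).symm

end Diagonal

/-! ### Branches of the logarithm and contours -/

/-- The difference is continuous with values in `2πiℤ`, hence constant on a preconnected set. All
independence of branches rests on this. -/
theorem eqOn_add_of_exp_eq {α : Type*} [TopologicalSpace α] {s : Set α} (hs : IsPreconnected s)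
    {f g : α → ℂ} (hf : ContinuousOn f s) (hg : ContinuousOn g s)
    (h : ∀ z ∈ s, Complex.exp (f z) = Complex.exp (g z)) :
    ∃ k : ℤ, ∀ z ∈ s, f z = g z + k * (2 * Real.pi * Complex.I) := by
  rcases s.eq_empty_or_nonempty with rfl | ⟨z₀, hz₀⟩
  · exact ⟨0, fun z hz => hz.elim⟩
  have hint : ∀ z ∈ s, ∃ k : ℤ, f z = g z + k * (2 * Real.pi * Complex.I) := fun z hz =>
    Complex.exp_eq_exp_iff_exists_int.1 (h z hz)
  have him : ∀ z (k : ℤ), f z = g z + k * (2 * Real.pi * Complex.I) →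
      (f z - g z).im / (2 * Real.pi) = k := by
    intro z k hk
    rw [hk, add_sub_cancel_left]
    have : ((k : ℂ) * (2 * Real.pi * Complex.I)).im = k * (2 * Real.pi) := by simp
    rw [this, mul_div_assoc, div_self (by positivity), mul_one]
  obtain ⟨k₀, hk₀⟩ := hint z₀ hz₀
  have hdisc : IsDiscrete (Set.range ((↑) : ℤ → ℝ)) :=
    ⟨Int.isClosedEmbedding_coe_real.isEmbedding.toHomeomorph.symm.isEmbedding.discreteTopology⟩
  have hmaps : Set.MapsTo (fun z => (f z - g z).im / (2 * Real.pi)) s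
      (Set.range ((↑) : ℤ → ℝ)) := by
    intro z hz
    obtain ⟨k, hk⟩ := hint z hz
    exact ⟨k, (him z k hk).symm⟩
  refine ⟨k₀, fun z hz => ?_⟩
  obtain ⟨k, hk⟩ := hint z hz
  have hc : ContinuousOn (fun z => (f z - g z).im / (2 * Real.pi)) s :=
    (Complex.continuous_im.comp_continuousOn (hf.sub hg)).div_const _
  have := hs.constant_of_mapsTo hdisc hc hmaps hz hz₀
  simp only [him z k hk, him z₀ k₀ hk₀] at this
  rw [hk, Int.cast_inj.1 this]

/-- The branch of the logarithm on the disc of centre `c ≠ 0` and radius `‖c‖`. -/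
noncomputable def discLog (c z : ℂ) : ℂ := Complex.log (z / c) + Complex.log c

theorem div_mem_slitPlane {c z : ℂ} (h : z ∈ Metric.ball c ‖c‖) : z / c ∈ Complex.slitPlane := by
  have hc : 0 < ‖c‖ := (dist_nonneg.trans_lt (Metric.mem_ball.1 h))
  have hc0 : c ≠ 0 := norm_pos_iff.1 hc
  have : z / c = 1 + (z - c) / c := by field_simp; ring
  rw [this]
  refine Complex.mem_slitPlane_of_norm_lt_one ?_
  rw [norm_div, div_lt_one hc]
  simpa [dist_eq_norm] using h

theorem analyticAt_discLog {c z : ℂ} (h : z ∈ Metric.ball c ‖c‖) : AnalyticAt ℂ (discLog c) z :=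
  ((analyticAt_id.div_const).clog (div_mem_slitPlane h)).add analyticAt_const

theorem exp_discLog {c z : ℂ} (h : z ∈ Metric.ball c ‖c‖) : Complex.exp (discLog c z) = z := by
  have hc0 : c ≠ 0 := norm_pos_iff.1 (dist_nonneg.trans_lt (Metric.mem_ball.1 h))
  rw [discLog, Complex.exp_add, Complex.exp_log (Complex.slitPlane_ne_zero (div_mem_slitPlane h)),
    Complex.exp_log hc0, div_mul_cancel₀ _ hc0]

/-- A compact convex set that omits `0` lies in a disc that omits `0`. -/
theorem exists_ball_of_convex {K : Set ℂ} (hK : IsCompact K) (hconv : Convex ℝ K) (h0 : 0 ∉ K) :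
    ∃ (c : ℂ) (r : ℝ), 0 < r ∧ r < ‖c‖ ∧ K ⊆ Metric.ball c r := by
  obtain ⟨f, u, hu0, hu⟩ := geometric_hahn_banach_point_closed hconv hK.isClosed h0
  rw [map_zero] at hu0
  obtain ⟨M, hM⟩ := hK.isBounded.exists_norm_le
  set e : ℂ := ⟨f 1, f Complex.I⟩ with he
  have hf : ∀ z : ℂ, f z = z.re * e.re + z.im * e.im := by
    intro z
    conv_lhs => rw [← Complex.re_add_im z]
    rw [map_add, mul_comm (z.im : ℂ)]
    have h1 : f (z.re : ℂ) = z.re * f 1 := by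
      rw [← smul_eq_mul, ← map_smul]; simp
    have h2 : f (Complex.I * z.im) = z.im * f Complex.I := by
      rw [← smul_eq_mul (z.im), ← map_smul]; simp [mul_comm]
    rw [h1, h2]
  rcases K.eq_empty_or_nonempty with rfl | ⟨z₀, hz₀⟩
  · exact ⟨2, 1, one_pos, by norm_num, Set.empty_subset _⟩
  -- The centre is `s * e`, with `e` the normal of a separating line and `s` so large that `‖z - s
  -- e‖² = ‖z‖² - 2 s f z + ‖s e‖²` is at most `‖s e‖² - 2` on `K`. The radius has square `‖s e‖² -
  -- 1`, strictly between this and the squared distance to `0`.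
  set s : ℝ := (M ^ 2 + 2) / (2 * u) with hs
  have hs0 : 0 < s := by positivity
  have hsu : s * u = (M ^ 2 + 2) / 2 := by
    rw [hs]; field_simp
  have hdist : ∀ z ∈ K, ‖z - s * e‖ ^ 2 ≤ ‖(s * e : ℂ)‖ ^ 2 - 2 := by
    intro z hz
    have h1 : ‖z‖ ^ 2 ≤ M ^ 2 := by
      have := hM z hz
      gcongr
    have h2 : u < f z := hu z hz
    rw [hf z] at h2
    rw [← Complex.normSq_eq_norm_sq, Complex.normSq_apply] at h1 ⊢
    rw [← Complex.normSq_eq_norm_sq, Complex.normSq_apply]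
    simp only [Complex.sub_re, Complex.sub_im, Complex.mul_re, Complex.mul_im, Complex.ofReal_re,
      Complex.ofReal_im, zero_mul, sub_zero, add_zero]
    nlinarith [mul_lt_mul_of_pos_left h2 hs0]
  have hc2 : 2 ≤ ‖(s * e : ℂ)‖ ^ 2 := by
    nlinarith [hdist z₀ hz₀, sq_nonneg ‖z₀ - s * e‖]
  refine ⟨s * e, √(‖(s * e : ℂ)‖ ^ 2 - 1), Real.sqrt_pos.2 (by linarith), ?_, fun z hz => ?_⟩
  · rw [Real.sqrt_lt' (norm_pos_iff.2 fun h => by rw [h] at hc2; norm_num at hc2)]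
    linarith
  · rw [Metric.mem_ball, dist_eq_norm]
    refine Real.lt_sqrt_of_sq_lt ?_
    linarith [hdist z hz]

section ContourLog

variable {A : Type*} [CStarAlgebra A]

/-- The contour integral of a branch of the logarithm is the continuous functional calculus. -/
theorem contourLog_conj_eq_cfc {N : A} (hN : IsStarNormal N) (s : Aˣ) {c : ℂ} {r : ℝ} {φ : ℂ → ℂ}
    (hr : 0 < r) (hsp : spectrum ℂ N ⊆ Metric.ball c r)
    (hφ : AnalyticOnNhd ℂ φ (Metric.closedBall c r)) :
    contourLog (↑s * N * ↑s⁻¹) c r φ = ↑s * cfc φ N * ↑s⁻¹ := by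
  set f : ℝ → ℂ → ℂ := fun θ x => (2 * (Real.pi : ℂ) * Complex.I)⁻¹ •
    (deriv (circleMap c r) θ • (φ (circleMap c r θ) • (circleMap c r θ - x)⁻¹)) with hfdef
  have hne : ∀ θ x, x ∈ spectrum ℂ N → circleMap c r θ - x ≠ 0 := by
    intro θ x hx h
    have h1 := hsp hx
    rw [← sub_eq_zero.1 h, Metric.mem_ball, dist_eq_norm, circleMap_sub_center,
      norm_circleMap_zero, abs_of_pos hr] at h1
    exact lt_irrefl _ h1
  have hmem : ∀ θ, circleMap c r θ ∈ Metric.closedBall c r := fun θ =>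
    Metric.sphere_subset_closedBall (circleMap_mem_sphere c hr.le θ)
  have hφc : ContinuousOn φ (Metric.closedBall c r) := hφ.continuousOn
  have hcont : ContinuousOn (Function.uncurry f) (Set.univ ×ˢ spectrum ℂ N) := by
    have h1 : Continuous fun θ => φ (circleMap c r θ) :=
      hφc.comp_continuous (continuous_circleMap c r) hmem
    have h2 : Continuous fun θ => deriv (circleMap c r) θ := by
      simp only [deriv_circleMap]
      exact (continuous_circleMap 0 r).mul continuous_const
    have h3 : ContinuousOn (fun p : ℝ × ℂ => (circleMap c r p.1 - p.2)⁻¹)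
        (Set.univ ×ˢ spectrum ℂ N) := by
      refine ContinuousOn.inv₀ ?_ fun p hp => hne p.1 p.2 hp.2
      exact (((continuous_circleMap c r).comp continuous_fst).sub continuous_snd).continuousOn
    exact ((h2.comp continuous_fst).continuousOn.smul
      ((h1.comp continuous_fst).continuousOn.smul h3)).const_smul
      ((2 * (Real.pi : ℂ) * Complex.I)⁻¹)
  have hpi : (0 : ℝ) ≤ 2 * Real.pi := by positivity
  obtain ⟨M, hM⟩ := ((isCompact_Icc (a := (0 : ℝ)) (b := 2 * Real.pi)).prod
    (spectrum.isCompact (𝕜 := ℂ) N)).exists_bound_of_continuousOn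
      (hcont.mono (Set.prod_mono (Set.subset_univ _) subset_rfl))
  have hbound : ∀ᵐ θ ∂MeasureTheory.volume.restrict (Set.Ioc 0 (2 * Real.pi)),
      ∀ z ∈ spectrum ℂ N, ‖f θ z‖ ≤ M := by
    filter_upwards [MeasureTheory.ae_restrict_mem measurableSet_Ioc] with θ hθ z hz
    exact hM (θ, z) ⟨⟨hθ.1.le, hθ.2⟩, hz⟩
  have hcont' : ContinuousOn (Function.uncurry f) (Set.Ioc 0 (2 * Real.pi) ×ˢ spectrum ℂ N) :=
    hcont.mono (Set.prod_mono (Set.subset_univ _) subset_rfl)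
  have hfin : MeasureTheory.HasFiniteIntegral (fun _ : ℝ => M)
      (MeasureTheory.volume.restrict (Set.Ioc 0 (2 * Real.pi))) :=
    (MeasureTheory.integrable_const M).hasFiniteIntegral
  have hint := cfc_setIntegral measurableSet_Ioc f (fun _ => M) N hcont' hbound hfin
  have hintb := integrableOn_cfc measurableSet_Ioc f (fun _ => M) N hcont' hbound hfin
  -- Cauchy's formula holds at each point of the spectrum; `cfc_setIntegral` then moves the integral
  -- outside the functional calculus.
  have hcauchy : cfc φ N = cfc (fun x => ∫ θ in Set.Ioc 0 (2 * Real.pi), f θ x) N := by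
    refine cfc_congr fun x hx => ?_
    have hd : DiffContOnCl ℂ φ (Metric.ball c r) := by
      refine DifferentiableOn.diffContOnCl fun z hz => ?_
      rw [closure_ball c hr.ne'] at hz
      exact (hφ z hz).differentiableAt.differentiableWithinAt
    have h := hd.two_pi_i_inv_smul_circleIntegral_sub_inv_smul (hsp hx)
    rw [circleIntegral, intervalIntegral.integral_of_le hpi, ← MeasureTheory.integral_smul] at h
    rw [← h]
    refine MeasureTheory.integral_congr_ae (MeasureTheory.ae_of_all _ fun θ => ?_)
    simp only [hfdef, smul_eq_mul]
    ring
  -- Conjugation by `s` as a continuous linear map, so that it commutes with the integral.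
  let L : A →L[ℂ] A := (ContinuousLinearMap.mul ℂ A ↑s).comp
    ((ContinuousLinearMap.mul ℂ A).flip ↑s⁻¹)
  have hL : ∀ x, L x = ↑s * x * ↑s⁻¹ := fun x => (mul_assoc _ _ _).symm
  rw [hcauchy, hint, ← hL (∫ θ in Set.Ioc 0 (2 * Real.pi), cfc (f θ) N),
    ← L.integral_comp_comm hintb, contourLog, circleIntegral,
    intervalIntegral.integral_of_le hpi, ← MeasureTheory.integral_smul]
  refine MeasureTheory.integral_congr_ae (MeasureTheory.ae_of_all _ fun θ => ?_)
  have hinv : ContinuousOn (fun x => (circleMap c r θ - x)⁻¹) (spectrum ℂ N) :=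
    (continuousOn_const.sub continuousOn_id).inv₀ (hne θ)
  have hres : resolvent (↑s * N * ↑s⁻¹ : A) (circleMap c r θ)
      = ↑s * cfc (fun x => (circleMap c r θ - x)⁻¹) N * ↑s⁻¹ := by
    have e1 : cfc (fun x => circleMap c r θ - x) N = algebraMap ℂ A (circleMap c r θ) - N := by
      rw [cfc_sub (fun _ => circleMap c r θ) (fun x => x) N, cfc_const _ N, cfc_id' ℂ N]
    have e2 : (algebraMap ℂ A (circleMap c r θ) - N) * cfc (fun x => (circleMap c r θ - x)⁻¹) N
        = 1 := by
      rw [← e1, ← cfc_mul _ _ N (by fun_prop) hinv, ← cfc_one ℂ N]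
      exact cfc_congr fun x hx => mul_inv_cancel₀ (hne θ x hx)
    have e3 : cfc (fun x => (circleMap c r θ - x)⁻¹) N * (algebraMap ℂ A (circleMap c r θ) - N)
        = 1 := by
      rw [← e1, ← cfc_mul _ _ N hinv (by fun_prop), ← cfc_one ℂ N]
      exact cfc_congr fun x hx => inv_mul_cancel₀ (hne θ x hx)
    have e4 : algebraMap ℂ A (circleMap c r θ) - ↑s * N * ↑s⁻¹
        = ↑s * (algebraMap ℂ A (circleMap c r θ) - N) * ↑s⁻¹ := by
      rw [mul_sub, sub_mul, ← Algebra.commutes, mul_assoc (algebraMap ℂ A _), Units.mul_inv,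
        mul_one]
    rw [resolvent, e4]
    let U : Aˣ := ⟨_, _, e2, e3⟩
    have : ↑s * (algebraMap ℂ A (circleMap c r θ) - N) * ↑s⁻¹ = ((s * U * s⁻¹ : Aˣ) : A) := by
      simp [U]
    rw [this, Ring.inverse_unit]
    simp [U, mul_assoc]
  simp only [hfdef, smul_smul]
  rw [cfc_smul _ _ N hinv]
  rw [map_smul, hL, hres]

end ContourLog

/-! ### The spectral functional -/

/-- The real interval `[-R, R]` in the complex plane. -/
def realSegment (R : ℝ) : Set ℂ := (fun x : ℝ => (x : ℂ)) '' Set.Icc (-R) R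

theorem isCompact_realSegment (R : ℝ) : IsCompact (realSegment R) :=
  isCompact_Icc.image Complex.continuous_ofReal

instance (R : ℝ) : CompactSpace (realSegment R) :=
  isCompact_iff_compactSpace.1 (isCompact_realSegment R)

theorem convex_realSegment (R : ℝ) : Convex ℝ (realSegment R) :=
  (convex_Icc (-R) R).linear_image Complex.ofRealCLM.toLinearMap

theorem norm_le_of_mem_realSegment {R : ℝ} {x : ℂ} (hx : x ∈ realSegment R) : ‖x‖ ≤ R := by
  obtain ⟨t, ht, rfl⟩ := hx
  rw [Complex.norm_real, Real.norm_eq_abs]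
  exact abs_le.2 ht

theorem star_eq_of_mem_realSegment {R : ℝ} {x : ℂ} (hx : x ∈ realSegment R) : star x = x := by
  obtain ⟨t, ht, rfl⟩ := hx
  exact Complex.conj_ofReal t

theorem IsSelfAdjoint.spectrum_subset_realSegment {A : Type*} [CStarAlgebra A] {T : A}
    (hT : IsSelfAdjoint T) {R : ℝ} (h : ‖T‖ ≤ R) : spectrum ℂ T ⊆ realSegment R := by
  intro z hz
  refine ⟨z.re, ?_, (hT.mem_spectrum_eq_re hz).symm⟩
  rw [Set.mem_Icc, ← abs_le]
  rcases subsingleton_or_nontrivial A with hA | hA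
  · rw [spectrum.of_subsingleton] at hz
    exact hz.elim
  · exact (Complex.abs_re_le_norm z).trans ((spectrum.norm_le_norm_of_mem hz).trans h)

/-- The identity function on a real segment. -/
noncomputable def segmentId (R : ℝ) : C(realSegment R, ℂ) := .restrict (realSegment R) (.id ℂ)

theorem norm_segmentId_le {R : ℝ} (hR : 0 ≤ R) : ‖segmentId R‖ ≤ R :=
  (ContinuousMap.norm_le _ hR).2 fun x => norm_le_of_mem_realSegment x.2

/-- Stone–Weierstrass: on a real segment conjugation fixes the coordinate, so polynomials in the
coordinate alone are already dense. -/
theorem eq_top_of_polynomial_mem {R : ℝ} {W : Set C(realSegment R, ℂ)} (hW : IsClosed W)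
    (h : ∀ p : Polynomial ℂ, Polynomial.aeval (segmentId R) p ∈ W) (f : C(realSegment R, ℂ)) :
    f ∈ W := by
  have hsub : ∀ f, f ∈ (Algebra.adjoin ℂ {segmentId R}).topologicalClosure := by
    intro f
    have hid : segmentId R ∈ (Algebra.adjoin ℂ {segmentId R}).topologicalClosure :=
      Subalgebra.le_topologicalClosure _ (Algebra.self_mem_adjoin_singleton ℂ _)
    induction f using ContinuousMap.induction_on_of_compact with
    | const r => exact Subalgebra.algebraMap_mem _ r
    | id => exact hid
    | star_id =>
      convert hid using 1
      ext x
      exact star_eq_of_mem_realSegment x.2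
    | add f g hf hg => exact Subalgebra.add_mem _ hf hg
    | mul f g hf hg => exact Subalgebra.mul_mem _ hf hg
    | frequently f hf =>
      have h1 := mem_closure_iff_frequently.2 hf
      have h2 : IsClosed ((Algebra.adjoin ℂ {segmentId R}).topologicalClosure
        : Set C(realSegment R, ℂ)) := Subalgebra.isClosed_topologicalClosure _
      exact h2.closure_subset h1
  have := hsub f
  rw [← SetLike.mem_coe, Subalgebra.topologicalClosure_coe] at this
  refine closure_minimal ?_ hW this
  intro g hg
  rw [SetLike.mem_coe, Algebra.adjoin_singleton_eq_range_aeval] at hg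
  obtain ⟨p, rfl⟩ := hg
  exact h p

theorem equicontinuous_of_norm_le {ι E : Type*} [NormedAddCommGroup E] [NormedSpace ℂ E]
    {F : ι → E →L[ℂ] ℂ} (h : ∀ i, ‖F i‖ ≤ 1) : Equicontinuous fun i x => F i x := by
  refine Metric.equicontinuous_of_continuity_modulus (fun t => t) tendsto_id _ fun x y i => ?_
  rw [dist_eq_norm, dist_eq_norm, ← map_sub]
  exact ((F i).le_opNorm _).trans (mul_le_of_le_one_left (norm_nonneg _) (h i))

/-- Pointwise convergence of contractive functionals on polynomials on a real segment gives a
limit functional. -/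
theorem exists_limit_functional {R : ℝ} {F : ℕ → C(realSegment R, ℂ) →L[ℂ] ℂ}
    (hF : ∀ n, ‖F n‖ ≤ 1) {a : ℕ → ℂ}
    (ha : ∀ k, Tendsto (fun n => F n (segmentId R ^ k)) atTop (𝓝 (a k))) :
    ∃ L : C(realSegment R, ℂ) →L[ℂ] ℂ, ‖L‖ ≤ 1 ∧ ∀ f, Tendsto (fun n => F n f) atTop (𝓝 (L f)) := by
  have hpoly : ∀ p : Polynomial ℂ, Tendsto (fun n => F n (Polynomial.aeval (segmentId R) p)) atTop
      (𝓝 (p.sum fun k c => c * a k)) := by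
    intro p
    simp only [Polynomial.aeval_eq_sum_range, map_sum, map_smul, Polynomial.sum_over_range p
      (f := fun k c => c * a k) (by simp), smul_eq_mul]
    exact tendsto_finsetSum _ fun k _ => (ha k).const_mul _
  have hlip : ∀ f n, ‖F n f‖ ≤ ‖f‖ := fun f n =>
    ((F n).le_opNorm f).trans (mul_le_of_le_one_left (norm_nonneg _) (hF n))
  have hcauchy : ∀ f, CauchySeq fun n => F n f := by
    refine eq_top_of_polynomial_mem (W := {f | CauchySeq fun n => F n f}) ?_
      fun p => (hpoly p).cauchySeq
    rw [← closure_subset_iff_isClosed]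
    intro f hf
    refine Metric.cauchySeq_iff'.2 fun ε hε => ?_
    obtain ⟨g, hg, hfg⟩ := Metric.mem_closure_iff.1 hf (ε / 3) (by positivity)
    obtain ⟨N, hN⟩ := Metric.cauchySeq_iff'.1 hg (ε / 3) (by positivity)
    refine ⟨N, fun n hn => ?_⟩
    have h1 : ∀ n, dist (F n f) (F n g) < ε / 3 := by
      intro n
      rw [dist_eq_norm, ← map_sub]
      exact (hlip _ _).trans_lt (by rwa [← dist_eq_norm])
    calc dist (F n f) (F N f)
        ≤ dist (F n f) (F n g) + dist (F n g) (F N g) + dist (F N g) (F N f) :=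
          dist_triangle4 _ _ _ _
      _ < ε / 3 + ε / 3 + ε / 3 := by
          rw [dist_comm (F N g)]
          exact add_lt_add (add_lt_add (h1 n) (hN n hn)) (h1 N)
      _ = ε := by ring
  choose L hL using fun f => cauchySeq_tendsto_of_complete (hcauchy f)
  refine ⟨LinearMap.mkContinuous ⟨⟨L, fun f g => ?_⟩, fun c f => ?_⟩ 1 fun f => ?_,
    LinearMap.mkContinuous_norm_le _ zero_le_one _, hL⟩
  · refine tendsto_nhds_unique (hL (f + g)) ?_
    simpa only [map_add] using (hL f).add (hL g)
  · refine tendsto_nhds_unique (hL (c • f)) ?_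
    simpa only [map_smul, RingHom.id_apply] using (hL f).const_smul c
  · rw [one_mul]
    exact le_of_tendsto' (hL f).norm fun n => hlip f n

namespace SelfSimilarData

variable {V : Type*} {X : SimpleGraph V}

/-- The functional `L` computes the traces of the continuous functions of `B`. -/
def IsSpectralFunctional (S : SelfSimilarData X) {R : ℝ} (L : C(realSegment R, ℂ) →L[ℂ] ℂ)
    (B : VertexSpace V →L[ℂ] VertexSpace V) : Prop :=
  ∃ hB : IsSelfAdjoint B, ∃ hR : spectrum ℂ B ⊆ realSegment R,
    ∀ f, S.HasTrace (cfcHomSuperset hB.isStarNormal hR f) (L f)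

/-- The normalized traces composed with the functional calculus are contractions on the continuous
functions, and converge on polynomials. The limit depends only on the moments, so one `L` serves
every self-adjoint operator of norm at most `R` with the same moments. -/
theorem exists_isSpectralFunctional (S : SelfSimilarData X) {R : ℝ} {a : ℕ → ℂ}
    {B : VertexSpace V →L[ℂ] VertexSpace V} (hB : IsSelfAdjoint B) (hBR : ‖B‖ ≤ R)
    (ha : ∀ k, S.HasTrace (B ^ k) (a k)) :
    ∃ L : C(realSegment R, ℂ) →L[ℂ] ℂ, ‖L‖ ≤ 1 ∧ (∀ k, L (segmentId R ^ k) = a k) ∧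
      ∀ B', IsSelfAdjoint B' → ‖B'‖ ≤ R → (∀ k, S.HasTrace (B' ^ k) (a k)) →
        S.IsSpectralFunctional L B' := by
  have hcfc : ∀ (B' : VertexSpace V →L[ℂ] VertexSpace V) (hB' : IsSelfAdjoint B')
      (hR : spectrum ℂ B' ⊆ realSegment R), ∃ F : ℕ → C(realSegment R, ℂ) →L[ℂ] ℂ,
      (∀ n, ‖F n‖ ≤ 1) ∧ (∀ n f, F n f = S.avgTrace n (cfcHomSuperset hB'.isStarNormal hR f)) ∧
      ∀ n k, F n (segmentId R ^ k) = S.avgTrace n (B' ^ k) := by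
    intro B' hB' hR
    have hlip : ∀ f, ‖cfcHomSuperset hB'.isStarNormal hR f‖ ≤ ‖f‖ := fun f =>
      NonUnitalStarAlgHom.norm_apply_le _ f
    refine ⟨fun n => (S.avgTrace n).comp
      (LinearMap.mkContinuous (cfcHomSuperset hB'.isStarNormal hR).toAlgHom.toLinearMap 1
        fun f => by rw [one_mul]; exact hlip f), fun n => ?_, fun n f => rfl, fun n k => ?_⟩
    · refine (ContinuousLinearMap.opNorm_comp_le _ _).trans ?_
      exact mul_le_one₀ (S.norm_avgTrace_le n) (norm_nonneg _)
        (LinearMap.mkContinuous_norm_le _ zero_le_one _)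
    · change S.avgTrace n (cfcHomSuperset hB'.isStarNormal hR (segmentId R ^ k)) = _
      rw [map_pow, segmentId, cfcHomSuperset_id]
  obtain ⟨F, hF1, hF2, hF3⟩ := hcfc B hB (hB.spectrum_subset_realSegment hBR)
  have hak : ∀ k, Tendsto (fun n => F n (segmentId R ^ k)) atTop (𝓝 (a k)) := fun k =>
    (ha k).congr fun n => (hF3 n k).symm
  obtain ⟨L, hL1, hL2⟩ := exists_limit_functional hF1 hak
  have hLk : ∀ k, L (segmentId R ^ k) = a k := fun k => tendsto_nhds_unique (hL2 _) (hak k)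
  refine ⟨L, hL1, hLk, fun B' hB' hBR' ha' => ⟨hB', hB'.spectrum_subset_realSegment hBR', ?_⟩⟩
  obtain ⟨F', hF1', hF2', hF3'⟩ := hcfc B' hB' (hB'.spectrum_subset_realSegment hBR')
  have hak' : ∀ k, Tendsto (fun n => F' n (segmentId R ^ k)) atTop (𝓝 (a k)) := fun k =>
    (ha' k).congr fun n => (hF3' n k).symm
  intro f
  rw [hasTrace_iff]
  simp only [← hF2']
  revert f
  refine eq_top_of_polynomial_mem
    ((equicontinuous_of_norm_le hF1').isClosed_setOfPred_tendsto L.continuous) fun p => ?_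
  change Tendsto _ _ _
  simp only [Polynomial.aeval_eq_sum_range, map_sum, map_smul, hLk]
  exact tendsto_finsetSum _ fun k _ => (hak' k).const_smul _

/-- The determinant of a linear function of a self-adjoint operator, up to conjugation. -/
theorem IsSpectralFunctional.hasDet [Infinite V] {S : SelfSimilarData X} {R : ℝ}
    {L : C(realSegment R, ℂ) →L[ℂ] ℂ} {B : VertexSpace V →L[ℂ] VertexSpace V}
    (h : S.IsSpectralFunctional L B) {s : (VertexSpace V →L[ℂ] VertexSpace V)ˣ}
    (hs : IsDiagonalUnit s) {a u c : ℂ} {r : ℝ} (hr : 0 < r) (hrc : r < ‖c‖)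
    (hK : ∀ x ∈ realSegment R, a - u * x ∈ Metric.ball c r) {f : C(realSegment R, ℂ)}
    (hf : ∀ x, f x = discLog c (a - u * x)) :
    S.HasDet (↑s * (a • 1 - u • B) * ↑s⁻¹) (Complex.exp (L f)) := by
  obtain ⟨hB, hR, htr⟩ := h
  have hcB : a • 1 - u • B = cfc (fun x => a - u * x) B := by
    rw [cfc_sub (fun _ => a) (fun x => u * x) B, cfc_const a B, cfc_const_mul_id u B,
      Algebra.algebraMap_eq_smul_one]
  have hN : IsStarNormal (a • 1 - u • B) := by
    rw [hcB]
    exact cfc_predicate _ _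
  have hspec : spectrum ℂ (a • 1 - u • B) = (fun x => a - u * x) '' spectrum ℂ B := by
    rw [hcB, cfc_map_spectrum (R := ℂ) (fun x => a - u * x) B]
  have hspec' : spectrum ℂ (a • 1 - u • B) ⊆ Metric.ball c r := by
    rw [hspec]
    rintro _ ⟨x, hx, rfl⟩
    exact hK x (hR hx)
  have hball : Metric.closedBall c r ⊆ Metric.ball c ‖c‖ := Metric.closedBall_subset_ball hrc
  have hconjspec : spectrum ℂ (↑s * (a • 1 - u • B) * ↑s⁻¹) = spectrum ℂ (a • 1 - u • B) :=
    spectrum.units_conjugate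
  refine ⟨⟨c, r, discLog c, hr, hconjspec ▸ hspec', ?_, ?_, ?_⟩, ?_⟩
  · rw [Metric.mem_closedBall, dist_comm, dist_zero_right, not_le]
    exact hrc
  · exact fun z hz => analyticAt_discLog (hball hz)
  · exact fun z hz => exp_discLog (hball hz)
  · rintro c' r' φ ⟨hr', hsp, -, hφ, hexp⟩
    rw [hconjspec] at hsp
    -- Both discs contain the spectrum and their intersection is convex, so there the two branches
    -- differ by `2πik`. The trace of the logarithm changes by this constant and its exponential
    -- does not change.
    obtain ⟨k, hk⟩ := eqOn_add_of_exp_eq (s := Metric.ball c r ∩ Metric.ball c' r')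
      ((convex_ball c r).inter (convex_ball c' r')).isPreconnected (f := φ) (g := discLog c)
      (hφ.continuousOn.mono (Set.inter_subset_right.trans Metric.ball_subset_closedBall))
      (fun z hz => (analyticAt_discLog
        (hball (Metric.ball_subset_closedBall hz.1))).continuousAt.continuousWithinAt)
      (fun z hz => by
        rw [hexp z (Metric.ball_subset_closedBall hz.2),
          exp_discLog (hball (Metric.ball_subset_closedBall hz.1))])
    refine ⟨L f + k * (2 * Real.pi * Complex.I), ?_, ?_⟩
    · rw [contourLog_conj_eq_cfc hN s hr' hsp hφ]
      refine (hasTrace_conj hs).2 ?_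
      have e1 : cfc φ (a • 1 - u • B) = cfcHomSuperset hB.isStarNormal hR
          (f + algebraMap ℂ _ (k * (2 * Real.pi * Complex.I))) := by
        have hφc : ContinuousOn φ ((fun x => a - u * x) '' spectrum ℂ B) := by
          rw [← hspec]
          exact hφ.continuousOn.mono (hsp.trans Metric.ball_subset_closedBall)
        rw [hcB, ← cfc_comp' φ (fun x => a - u * x) B hφc,
          cfc_apply (fun x => φ (a - u * x)) B hB.isStarNormal (hφc.comp (by fun_prop) (Set.mapsTo_image _ _))]
        change _ = cfcHom hB.isStarNormal _
        congr 1
        ext x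
        have hx : a - u * (x : ℂ) ∈ spectrum ℂ (a • 1 - u • B) := by
          rw [hspec]
          exact ⟨x, x.2, rfl⟩
        change φ (a - u * x) = f ⟨x, hR x.2⟩ + k * (2 * Real.pi * Complex.I)
        rw [hf, hk _ ⟨hspec' hx, hsp hx⟩]
      rw [e1, map_add, AlgHomClass.commutes, Algebra.algebraMap_eq_smul_one]
      refine (htr f).add ?_
      simpa using hasTrace_one.smul (S := S) (k * (2 * Real.pi * Complex.I) : ℂ)
    · rw [Complex.exp_add, Complex.exp_int_mul_two_pi_mul_I, mul_one]

end SelfSimilarData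

/-! ### The domain of the determinant -/

theorem zetaDomain_of_norm_lt {q : ℕ} (hq : 1 ≤ q) {u : ℂ} (hu : ‖u‖ < 1 / (q : ℝ)) :
    u ∈ zetaDomain q := by
  have hq' : (1 : ℝ) ≤ q := by exact_mod_cast hq
  have hq0 : (0 : ℝ) < q := by linarith
  rintro (h | ⟨him, h1, -⟩)
  · have h' : ‖u‖ ^ 2 = 1 / (q : ℝ) := h
    have h1 : 1 / (q : ℝ) ≤ 1 := by
      rw [div_le_one hq0]; exact hq'
    nlinarith [norm_nonneg u]
  · exact absurd (h1.trans (Complex.abs_re_le_norm u)) (not_le.2 hu)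

/-- Let `1 + q u² = u x` with `x` real. If `u` is not real, the imaginary part gives `x = 2 q Re u`
and then the real part gives `q |u|² = 1`. If `u` is real, `|x| ≤ q + 1` gives `(1 - |u|)(1 - q |u|)
≤ 0`, that is `1/q ≤ |u| ≤ 1`. -/
theorem one_add_mul_sq_ne {q : ℕ} (hq : 1 ≤ q) {u : ℂ} (hu : u ∈ zetaDomain q) {x : ℂ}
    (hx : x ∈ realSegment (q + 1)) : 1 + (q : ℂ) * u ^ 2 - u * x ≠ 0 := by
  have hq' : (1 : ℝ) ≤ q := by exact_mod_cast hq
  have hq0 : (0 : ℝ) < q := by linarith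
  obtain ⟨t, ⟨ht1, ht2⟩, rfl⟩ := hx
  intro h
  apply hu
  have hre := congrArg Complex.re h
  have him := congrArg Complex.im h
  simp only [pow_two, Complex.sub_re, Complex.add_re, Complex.one_re, Complex.mul_re,
    Complex.natCast_re, Complex.natCast_im, zero_mul, sub_zero, Complex.ofReal_re,
    Complex.ofReal_im, mul_zero, Complex.zero_re, Complex.sub_im, Complex.add_im, Complex.one_im,
    Complex.mul_im, Complex.zero_im, add_zero, zero_add] at hre him
  by_cases hi : u.im = 0
  · right
    rw [hi] at hre
    refine ⟨hi, ?_⟩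
    have habs : u.re * t ≤ |u.re| * (q + 1) := by
      rw [← abs_of_pos (by linarith : (0 : ℝ) < q + 1)]
      refine (le_abs_self _).trans ?_
      rw [abs_mul]
      refine mul_le_mul_of_nonneg_left ?_ (abs_nonneg _)
      rw [abs_of_pos (by linarith : (0 : ℝ) < q + 1)]
      exact abs_le.2 ⟨ht1, ht2⟩
    have hsq : u.re * u.re = |u.re| * |u.re| := (abs_mul_abs_self _).symm
    have hprod : (1 - |u.re|) * (1 - q * |u.re|) ≤ 0 := by nlinarith
    have hmul : (q : ℝ) * (1 / q) = 1 := by field_simp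
    constructor
    · by_contra hlt
      push Not at hlt
      have h1 : q * |u.re| < 1 := by
        calc q * |u.re| < q * (1 / q) := by gcongr
          _ = 1 := hmul
      have h2 : |u.re| ≤ q * |u.re| := le_mul_of_one_le_left (abs_nonneg _) hq'
      nlinarith
    · by_contra hlt
      push Not at hlt
      have h2 : |u.re| ≤ q * |u.re| := le_mul_of_one_le_left (abs_nonneg _) hq'
      nlinarith
  · left
    have ht : t = 2 * q * u.re := by
      have : u.im * (2 * q * u.re - t) = 0 := by linarith
      rcases mul_eq_zero.1 this with h' | h'
      · exact absurd h' hi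
      · linarith
    rw [Set.mem_ofPred_eq, eq_div_iff hq0.ne', ← Complex.normSq_eq_norm_sq, Complex.normSq_apply]
    rw [ht] at hre
    linarith

/-! ### The logarithm on the segment and its holomorphic dependence on `u` -/

section Analytic

/-- `1 - (1 + q u² - u x) / c`, as a function of `x`. -/
noncomputable def discCoord (q : ℕ) (c u : ℂ) : C(realSegment (q + 1), ℂ) :=
  algebraMap ℂ _ (1 - (1 + (q : ℂ) * u ^ 2) / c) + (u / c) • segmentId (q + 1)

variable {q : ℕ}

theorem discCoord_apply (c u : ℂ) (x : realSegment (q + 1)) :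
    discCoord q c u x = 1 - (1 + (q : ℂ) * u ^ 2 - u * x) / c := by
  change (1 - (1 + (q : ℂ) * u ^ 2) / c) + (u / c) * (x : ℂ) = _
  ring

theorem norm_discCoord_apply {c : ℂ} (hc : c ≠ 0) (u : ℂ) (x : realSegment (q + 1)) :
    ‖discCoord q c u x‖ = ‖1 + (q : ℂ) * u ^ 2 - u * x - c‖ / ‖c‖ := by
  rw [discCoord_apply, ← norm_div, ← norm_neg, sub_div _ c c, div_self hc, neg_sub]

/-- For `u` in `Ω` the values `1 + q u² - u x` form a compact convex set omitting `0`, hence lie in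
a disc about some `c` with radius less than `‖c‖`. The logarithm is then a power series in a
function of sup norm less than `1`. -/
theorem exists_norm_discCoord_lt (hq : 1 ≤ q) {u : ℂ} (hu : u ∈ zetaDomain q) :
    ∃ c : ℂ, c ≠ 0 ∧ ‖discCoord q c u‖ < 1 := by
  have hKc : IsCompact ((fun x : ℂ => 1 + (q : ℂ) * u ^ 2 - u * x) '' realSegment (q + 1)) :=
    (isCompact_realSegment _).image (by fun_prop)
  have hconv : Convex ℝ ((fun x : ℂ => 1 + (q : ℂ) * u ^ 2 - u * x) '' realSegment (q + 1)) := by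
    have h1 := (convex_realSegment ((q : ℝ) + 1)).linear_image
      (LinearMap.mulLeft ℝ (-u))
    have h2 := h1.translate (1 + (q : ℂ) * u ^ 2)
    rw [Set.image_image] at h2
    simpa [sub_eq_add_neg] using h2
  obtain ⟨c, r, hr, hrc, hball⟩ := exists_ball_of_convex hKc hconv (by
    rintro ⟨x, hx, h⟩
    exact one_add_mul_sq_ne hq hu hx h)
  have hc : 0 < ‖c‖ := hr.trans hrc
  have hc0 : c ≠ 0 := norm_pos_iff.1 hc
  refine ⟨c, hc0, ?_⟩
  refine lt_of_le_of_lt ((ContinuousMap.norm_le _ (by positivity : 0 ≤ r / ‖c‖)).2 fun x => ?_)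
    ((div_lt_one hc).2 hrc)
  have h := hball ⟨x, x.2, rfl⟩
  rw [Metric.mem_ball, dist_eq_norm] at h
  rw [norm_discCoord_apply hc0]
  exact div_le_div_of_nonneg_right h.le hc.le

/-- The branch of `log (1 + q u² - u x)` given by the disc with centre `c`. -/
noncomputable def segmentLog (q : ℕ) (c u : ℂ) : C(realSegment (q + 1), ℂ) :=
  algebraMap ℂ _ (Complex.log c) - ∑' n : ℕ, (n : ℂ)⁻¹ • discCoord q c u ^ n

theorem norm_inv_smul_pow_le {E : Type*} [NormedRing E] [NormedAlgebra ℂ E] [NormOneClass E]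
    (n : ℕ) (x : E) : ‖(n : ℂ)⁻¹ • x ^ n‖ ≤ ‖x‖ ^ n := by
  rw [norm_smul, norm_inv, Complex.norm_natCast]
  refine (mul_le_of_le_one_left (norm_nonneg _) ?_).trans (norm_pow_le _ _)
  exact Nat.cast_inv_le_one n

instance (q : ℕ) : Nonempty (realSegment ((q : ℝ) + 1)) :=
  ⟨⟨0, 0, ⟨neg_nonpos.2 (by positivity), by positivity⟩, by simp⟩⟩

/-- This is the Taylor series of `-log (1 - z)` at each point `x`; the term `n = 0` vanishes since
`0⁻¹ = 0`. -/
theorem segmentLog_apply {c u : ℂ} (h : ‖discCoord q c u‖ < 1)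
    (x : realSegment ((q : ℝ) + 1)) :
    segmentLog q c u x = discLog c (1 + (q : ℂ) * u ^ 2 - u * x) := by
  have hsum : Summable fun n : ℕ => (n : ℂ)⁻¹ • discCoord q c u ^ n :=
    Summable.of_norm_bounded (summable_geometric_of_lt_one (norm_nonneg _) h)
      fun n => norm_inv_smul_pow_le n _
  have h1 : (∑' n : ℕ, (n : ℂ)⁻¹ • discCoord q c u ^ n) x
      = -Complex.log (1 - discCoord q c u x) := by
    have h2 := (ContinuousMap.evalCLM ℂ x).hasSum hsum.hasSum
    refine h2.unique ?_
    have hx : ‖discCoord q c u x‖ < 1 := (ContinuousMap.norm_coe_le_norm _ x).trans_lt h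
    refine (Complex.hasSum_taylorSeries_neg_log hx).congr_fun fun n => ?_
    change (n : ℂ)⁻¹ * discCoord q c u x ^ n = _
    rw [div_eq_inv_mul]
  change Complex.log c - (∑' n : ℕ, (n : ℂ)⁻¹ • discCoord q c u ^ n) x = _
  rw [h1, discCoord_apply, discLog]
  ring_nf

theorem differentiable_discCoord (c : ℂ) : Differentiable ℂ (discCoord q c) := by
  unfold discCoord
  simp only [Algebra.algebraMap_eq_smul_one]
  fun_prop

theorem differentiableOn_segmentLog (c : ℂ) {ρ : ℝ} (hρ : ρ < 1) :
    DifferentiableOn ℂ (segmentLog q c) {u | ‖discCoord q c u‖ < ρ} := by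
  refine (differentiableOn_const _).sub ?_
  rcases le_or_gt ρ 0 with h0 | h0
  · intro u hu
    exact absurd (hu.trans_le h0) (not_lt.2 (norm_nonneg _))
  refine Complex.differentiableOn_tsum_of_summable_norm (u := fun n => ρ ^ n)
    (summable_geometric_of_lt_one h0.le hρ) (fun n => ?_) ?_ fun n u hu => ?_
  · exact (((differentiable_discCoord c).pow n).const_smul (n : ℂ)⁻¹).differentiableOn
  · exact isOpen_lt (differentiable_discCoord c).continuous.norm continuous_const
  · exact (norm_inv_smul_pow_le n _).trans (pow_le_pow_left₀ (norm_nonneg _) (le_of_lt hu) n)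

/-! ### Dickson polynomials on the segment -/

theorem eval_dickson_of_mul_eq {a x y : ℂ} (h : x * y = a) (m : ℕ) :
    (Polynomial.dickson 1 a m).eval (x + y) = x ^ m + y ^ m := by
  induction m using Nat.twoStepInduction with
  | zero => simp; norm_num
  | one => simp
  | more m ih1 ih2 =>
    rw [Polynomial.dickson_add_two, Polynomial.eval_sub, Polynomial.eval_mul, Polynomial.eval_mul,
      Polynomial.eval_X, Polynomial.eval_C, ih1, ih2, ← h]
    ring

/-- The numbers `y, z` are the roots of `t² - x t + q`. If `‖y‖ > q`, then `u = 1/y` lies in the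
disc `‖u‖ < 1/q`, inside `Ω`, and is a zero of `(1 - y u)(1 - z u) = 1 + q u² - u x`, against
`one_add_mul_sq_ne`. -/
theorem exists_roots_of_mem_segment (hq : 1 ≤ q) {x : ℂ} (hx : x ∈ realSegment ((q : ℝ) + 1)) :
    ∃ y z : ℂ, y + z = x ∧ y * z = q ∧ ‖y‖ ≤ q ∧ ‖z‖ ≤ q := by
  have hq0 : (q : ℂ) ≠ 0 := by
    have : q ≠ 0 := by omega
    exact_mod_cast this
  obtain ⟨w, hw⟩ := IsAlgClosed.exists_pow_nat_eq (x ^ 2 - 4 * q) (n := 2) two_pos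
  have hmul : (x + w) / 2 * ((x - w) / 2) = q := by
    have : (x + w) / 2 * ((x - w) / 2) = (x ^ 2 - w ^ 2) / 4 := by ring
    rw [this, hw]; ring
  have hbound : ∀ y z : ℂ, y + z = x → y * z = q → ‖y‖ ≤ q := by
    intro y z h1 h2
    by_contra hlt
    push Not at hlt
    have hy : y ≠ 0 := by
      rintro rfl
      rw [zero_mul] at h2
      exact hq0 h2.symm
    have hu : ‖y⁻¹‖ < 1 / (q : ℝ) := by
      rw [norm_inv, ← one_div]
      exact one_div_lt_one_div_of_lt (by exact_mod_cast hq) hlt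
    apply one_add_mul_sq_ne hq (zetaDomain_of_norm_lt hq hu) hx
    rw [← h1, ← h2]
    field_simp
    ring
  refine ⟨(x + w) / 2, (x - w) / 2, by ring, hmul, hbound _ _ (by ring) hmul,
    hbound _ ((x + w) / 2) (by ring) (by rw [mul_comm]; exact hmul)⟩

/-- The Dickson polynomial `D_m` on the segment. -/
noncomputable def segmentDickson (q m : ℕ) : C(realSegment ((q : ℝ) + 1), ℂ) :=
  Polynomial.aeval (segmentId (q + 1)) (Polynomial.dickson 1 (q : ℂ) m)

theorem segmentDickson_apply (m : ℕ) (x : realSegment ((q : ℝ) + 1)) :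
    segmentDickson q m x = (Polynomial.dickson 1 (q : ℂ) m).eval (x : ℂ) := by
  have := Polynomial.aeval_algHom_apply (ContinuousMap.evalAlgHom ℂ ℂ x) (segmentId ((q : ℝ) + 1))
    (Polynomial.dickson 1 (q : ℂ) m)
  change ContinuousMap.evalAlgHom ℂ ℂ x (segmentDickson q m) = _
  rw [segmentDickson, ← this, Polynomial.coe_aeval_eq_eval]
  rfl

theorem norm_segmentDickson_le (hq : 1 ≤ q) (m : ℕ) : ‖segmentDickson q m‖ ≤ 2 * (q : ℝ) ^ m := by
  refine (ContinuousMap.norm_le _ (by positivity)).2 fun x => ?_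
  obtain ⟨y, z, h1, h2, h3, h4⟩ := exists_roots_of_mem_segment hq x.2
  rw [segmentDickson_apply, ← h1, eval_dickson_of_mul_eq h2]
  refine (norm_add_le _ _).trans ?_
  rw [norm_pow, norm_pow, two_mul]
  gcongr

theorem norm_dickson_term_le (hq : 1 ≤ q) (u : ℂ) (m : ℕ) :
    ‖(u ^ m / m) • segmentDickson q m‖ ≤ 2 * (q * ‖u‖) ^ m := by
  rw [norm_smul, norm_div, norm_pow, Complex.norm_natCast, mul_pow]
  calc ‖u‖ ^ m / m * ‖segmentDickson q m‖ ≤ ‖u‖ ^ m * (2 * (q : ℝ) ^ m) := by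
        refine mul_le_mul ?_ (norm_segmentDickson_le hq m) (norm_nonneg _) (by positivity)
        rw [div_eq_mul_inv]
        exact mul_le_of_le_one_right (by positivity) (Nat.cast_inv_le_one m)
    _ = _ := by ring

theorem mul_norm_lt_one (hq : 1 ≤ q) {u : ℂ} (hu : ‖u‖ < 1 / (q : ℝ)) : (q : ℝ) * ‖u‖ < 1 := by
  have hq0 : (0 : ℝ) < q := by exact_mod_cast hq
  rwa [lt_div_iff₀ hq0, mul_comm] at hu

theorem summable_dickson_term (hq : 1 ≤ q) {u : ℂ} (hu : ‖u‖ < 1 / (q : ℝ)) :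
    Summable fun m : ℕ => (u ^ m / m) • segmentDickson q m :=
  Summable.of_norm_bounded ((summable_geometric_of_lt_one (by positivity)
    (mul_norm_lt_one hq hu)).mul_left 2) fun m => norm_dickson_term_le hq u m

theorem norm_root_mul_lt (hq : 1 ≤ q) {u : ℂ} (hu : ‖u‖ < 1 / (q : ℝ)) {y : ℂ} (hy : ‖y‖ ≤ q) :
    ‖y * u‖ < 1 := by
  rw [norm_mul]
  exact (mul_le_mul_of_nonneg_right hy (norm_nonneg _)).trans_lt (mul_norm_lt_one hq hu)

theorem tsum_dickson_apply (hq : 1 ≤ q) {u : ℂ} (hu : ‖u‖ < 1 / (q : ℝ))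
    (x : realSegment ((q : ℝ) + 1)) {y z : ℂ} (h1 : y + z = x) (h2 : y * z = q) (h3 : ‖y‖ ≤ q)
    (h4 : ‖z‖ ≤ q) : (∑' m : ℕ, (u ^ m / m) • segmentDickson q m) x
      = -Complex.log (1 - y * u) + -Complex.log (1 - z * u) := by
  have hs := (ContinuousMap.evalCLM ℂ x).hasSum (summable_dickson_term hq hu).hasSum
  have hs' := (Complex.hasSum_taylorSeries_neg_log (norm_root_mul_lt hq hu h3)).add
    (Complex.hasSum_taylorSeries_neg_log (norm_root_mul_lt hq hu h4))
  refine hs.unique (hs'.congr_fun fun m => ?_)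
  change u ^ m / m * segmentDickson q m x = _
  rw [segmentDickson_apply, ← h1, eval_dickson_of_mul_eq h2, mul_pow, mul_pow]
  ring

theorem one_sub_ne_zero_of_norm_lt {z : ℂ} (h : ‖z‖ < 1) : 1 - z ≠ 0 := by
  intro h0
  rw [← sub_eq_zero.1 h0, norm_one] at h
  exact lt_irrefl _ h

theorem exp_neg_tsum_dickson (hq : 1 ≤ q) {u : ℂ} (hu : ‖u‖ < 1 / (q : ℝ))
    (x : realSegment ((q : ℝ) + 1)) :
    Complex.exp (-((∑' m : ℕ, (u ^ m / m) • segmentDickson q m) x))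
      = 1 + (q : ℂ) * u ^ 2 - u * x := by
  obtain ⟨y, z, h1, h2, h3, h4⟩ := exists_roots_of_mem_segment hq x.2
  rw [tsum_dickson_apply hq hu x h1 h2 h3 h4, neg_add, neg_neg, neg_neg, Complex.exp_add,
    Complex.exp_log (one_sub_ne_zero_of_norm_lt (norm_root_mul_lt hq hu h3)),
    Complex.exp_log (one_sub_ne_zero_of_norm_lt (norm_root_mul_lt hq hu h4)), ← h1, ← h2]
  ring

/-- On the connected segment two logarithms of one function differ by a constant `2πik`, which `L`
preserves because `L 1 = 1`. This makes the choice of the centre `c` irrelevant. -/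
theorem exp_functional_eq {L : C(realSegment ((q : ℝ) + 1), ℂ) →L[ℂ] ℂ} (hL : L 1 = 1)
    {f g : C(realSegment ((q : ℝ) + 1), ℂ)} (h : ∀ x, Complex.exp (f x) = Complex.exp (g x)) :
    Complex.exp (L f) = Complex.exp (L g) := by
  have hpre : IsPreconnected (Set.univ : Set (realSegment ((q : ℝ) + 1))) :=
    (isPreconnected_iff_preconnectedSpace.1
      (convex_realSegment ((q : ℝ) + 1)).isPreconnected).isPreconnected_univ
  obtain ⟨k, hk⟩ := eqOn_add_of_exp_eq hpre f.continuous.continuousOn g.continuous.continuousOn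
    fun x _ => h x
  have heq : f = g
      + (k * (2 * Real.pi * Complex.I) : ℂ) • (1 : C(realSegment ((q : ℝ) + 1), ℂ)) := by
    ext x
    rw [hk x (Set.mem_univ x)]
    simp
  rw [heq, map_add, map_smul, hL, smul_eq_mul, mul_one, Complex.exp_add,
    Complex.exp_int_mul_two_pi_mul_I, mul_one]

theorem exp_segmentLog_apply {u c : ℂ} (hc : c ≠ 0) (h : ‖discCoord q c u‖ < 1)
    (x : realSegment ((q : ℝ) + 1)) :
    Complex.exp (segmentLog q c u x) = 1 + (q : ℂ) * u ^ 2 - u * x := by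
  rw [segmentLog_apply h, exp_discLog]
  have h1 := (ContinuousMap.norm_coe_le_norm (discCoord q c u) x).trans_lt h
  have hc' : 0 < ‖c‖ := norm_pos_iff.2 hc
  rw [norm_discCoord_apply hc, div_lt_one hc'] at h1
  rwa [Metric.mem_ball, dist_eq_norm]

open Classical in
/-- The exponential of the image of the function `log (1 + q u² - u x)` of `x` under a
functional. -/
noncomputable def zetaDet (q : ℕ) (L : C(realSegment ((q : ℝ) + 1), ℂ) →L[ℂ] ℂ) (u : ℂ) : ℂ :=
  if h : ∃ c : ℂ, c ≠ 0 ∧ ‖discCoord q c u‖ < 1 then Complex.exp (L (segmentLog q h.choose u))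
  -- This case does not occur on `Ω`; a nonzero default keeps `zetaDet_ne_zero` unconditional.
  else 1

theorem zetaDet_ne_zero (L : C(realSegment ((q : ℝ) + 1), ℂ) →L[ℂ] ℂ) (u : ℂ) :
    zetaDet q L u ≠ 0 := by
  rw [zetaDet]
  split_ifs
  · exact Complex.exp_ne_zero _
  · exact one_ne_zero

theorem zetaDet_eq {L : C(realSegment ((q : ℝ) + 1), ℂ) →L[ℂ] ℂ} (hL : L 1 = 1) {u c : ℂ}
    (hc : c ≠ 0) (h : ‖discCoord q c u‖ < 1) :
    zetaDet q L u = Complex.exp (L (segmentLog q c u)) := by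
  have hex : ∃ c : ℂ, c ≠ 0 ∧ ‖discCoord q c u‖ < 1 := ⟨c, hc, h⟩
  rw [zetaDet, dif_pos hex]
  refine exp_functional_eq hL fun x => ?_
  rw [exp_segmentLog_apply hc h, exp_segmentLog_apply hex.choose_spec.1 hex.choose_spec.2]

/-- A centre `c` that works at `u` works nearby, and there the value is the exponential of `L`
applied to a locally uniformly convergent series of functions holomorphic in `u`. -/
theorem differentiableOn_zetaDet (hq : 1 ≤ q) {L : C(realSegment ((q : ℝ) + 1), ℂ) →L[ℂ] ℂ}
    (hL : L 1 = 1) : DifferentiableOn ℂ (zetaDet q L) (zetaDomain q) := by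
  intro u hu
  obtain ⟨c, hc, h⟩ := exists_norm_discCoord_lt hq hu
  obtain ⟨ρ, h1, h2⟩ := exists_between h
  have hopen : IsOpen {u | ‖discCoord q c u‖ < ρ} :=
    isOpen_lt (differentiable_discCoord c).continuous.norm continuous_const
  have hd : DifferentiableAt ℂ (fun u => Complex.exp (L (segmentLog q c u))) u :=
    (L.differentiableAt.comp u
      ((differentiableOn_segmentLog c h2).differentiableAt (hopen.mem_nhds h1))).cexp
  refine (hd.congr_of_eventuallyEq ?_).differentiableWithinAt
  filter_upwards [hopen.mem_nhds h1] with v hv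
  exact zetaDet_eq hL hc (lt_trans hv h2)

theorem SelfSimilarData.IsSpectralFunctional.hasDet_zetaDet {V : Type*} [Infinite V]
    {X : SimpleGraph V} {S : SelfSimilarData X} {L : C(realSegment ((q : ℝ) + 1), ℂ) →L[ℂ] ℂ}
    {B : VertexSpace V →L[ℂ] VertexSpace V} (hL : S.IsSpectralFunctional L B)
    {s : (VertexSpace V →L[ℂ] VertexSpace V)ˣ} (hs : IsDiagonalUnit s) (hq : 1 ≤ q)
    (hL1 : L 1 = 1) {u : ℂ} (hu : u ∈ zetaDomain q) :
    S.HasDet (↑s * ((1 + (q : ℂ) * u ^ 2) • 1 - u • B) * ↑s⁻¹)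
      (zetaDet q L u) := by
  obtain ⟨c, hc, h⟩ := exists_norm_discCoord_lt hq hu
  rw [zetaDet_eq hL1 hc h]
  obtain ⟨ρ, hρ1, hρ2⟩ := exists_between h
  have hc' : 0 < ‖c‖ := norm_pos_iff.2 hc
  refine hL.hasDet hs (c := c) (r := ρ * ‖c‖) (mul_pos ((norm_nonneg _).trans_lt hρ1) hc')
    (mul_lt_of_lt_one_left hc' hρ2) (fun x hx => ?_) (segmentLog_apply h)
  have h1 := (ContinuousMap.norm_coe_le_norm (discCoord q c u) ⟨x, hx⟩).trans_lt hρ1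
  rw [norm_discCoord_apply hc, div_lt_iff₀ hc'] at h1
  rwa [Metric.mem_ball, dist_eq_norm]

theorem zetaDet_eq_exp_neg_tsum (hq : 1 ≤ q) {u : ℂ} (hu : ‖u‖ < 1 / (q : ℝ))
    {L : C(realSegment ((q : ℝ) + 1), ℂ) →L[ℂ] ℂ} (hL : L 1 = 1) :
    zetaDet q L u = Complex.exp (-∑' m : ℕ, u ^ m / m * L (segmentDickson q m)) := by
  obtain ⟨c, hc, h⟩ := exists_norm_discCoord_lt hq (zetaDomain_of_norm_lt hq hu)
  rw [zetaDet_eq hL hc h, exp_functional_eq hL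
    (g := -∑' m : ℕ, (u ^ m / m) • segmentDickson q m) fun x => ?_]
  · rw [map_neg, L.map_tsum (summable_dickson_term hq hu)]
    simp only [map_smul, smul_eq_mul]
  · change _ = Complex.exp (-((∑' m : ℕ, (u ^ m / m) • segmentDickson q m) x))
    rw [exp_neg_tsum_dickson hq hu, exp_segmentLog_apply hc h]

theorem norm_dickson_functional_le (hq : 1 ≤ q) {L : C(realSegment ((q : ℝ) + 1), ℂ) →L[ℂ] ℂ}
    (hL : ‖L‖ ≤ 1) (u : ℂ) (m : ℕ) :
    ‖u ^ m / m * L (segmentDickson q m)‖ ≤ 2 * (q * ‖u‖) ^ m := by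
  rw [← smul_eq_mul, ← map_smul]
  exact ((L.le_opNorm _).trans (mul_le_of_le_one_left (norm_nonneg _) hL)).trans
    (norm_dickson_term_le hq u m)

theorem summable_dickson_functional (hq : 1 ≤ q) {L : C(realSegment ((q : ℝ) + 1), ℂ) →L[ℂ] ℂ}
    (hL : ‖L‖ ≤ 1) {u : ℂ} (hu : ‖u‖ < 1 / (q : ℝ)) :
    Summable fun m : ℕ => u ^ m / m * L (segmentDickson q m) :=
  Summable.of_norm_bounded ((summable_geometric_of_lt_one (by positivity)
    (mul_norm_lt_one hq hu)).mul_left 2) fun m => norm_dickson_functional_le hq hL u m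

theorem differentiableOn_dickson_functional (hq : 1 ≤ q)
    {L : C(realSegment ((q : ℝ) + 1), ℂ) →L[ℂ] ℂ} (hL : ‖L‖ ≤ 1) :
    DifferentiableOn ℂ (fun u => ∑' m : ℕ, u ^ m / m * L (segmentDickson q m))
      (Metric.ball 0 (1 / (q : ℝ))) := by
  have hq0 : (0 : ℝ) < q := by exact_mod_cast hq
  intro u hu
  rw [mem_ball_zero_iff] at hu
  obtain ⟨ρ, h1, h2⟩ := exists_between hu
  have hρ0 : 0 ≤ ρ := (norm_nonneg u).trans h1.le
  have hρ : (q : ℝ) * ρ < 1 := by rwa [lt_div_iff₀ hq0, mul_comm] at h2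
  have h : DifferentiableOn ℂ (fun u => ∑' m : ℕ, u ^ m / m * L (segmentDickson q m))
      (Metric.ball 0 ρ) := by
    refine Complex.differentiableOn_tsum_of_summable_norm (u := fun m => 2 * (q * ρ) ^ m)
      ((summable_geometric_of_lt_one (by positivity) hρ).mul_left 2) (fun m => ?_)
      Metric.isOpen_ball fun m u hu => ?_
    · fun_prop
    · rw [mem_ball_zero_iff] at hu
      refine (norm_dickson_functional_le hq hL u m).trans ?_
      gcongr
  exact (h.differentiableAt (Metric.isOpen_ball.mem_nhds
    (mem_ball_zero_iff.2 h1))).differentiableWithinAt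

end Analytic

/-! ### The Euler product -/

theorem hasSum_evenTerm (q : ℕ) {u : ℂ} (hu : ‖u‖ < 1) :
    HasSum (fun m : ℕ => u ^ m / m * (SimpleGraph.evenTerm q m : ℂ))
      ((1 - (q : ℂ)) / 2 * Complex.log (1 - u ^ 2)) := by
  have hu2 : ‖u ^ 2‖ < 1 := by
    rw [norm_pow]
    exact pow_lt_one₀ (norm_nonneg _) hu two_ne_zero
  have hinj : Function.Injective fun j : ℕ => 2 * j := fun i j h => by
    simpa using h
  rw [← hinj.hasSum_iff]
  · have h := (Complex.hasSum_taylorSeries_neg_log hu2).mul_left (((q : ℂ) - 1) / 2)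
    have e : ((q : ℂ) - 1) / 2 * -Complex.log (1 - u ^ 2)
        = (1 - (q : ℂ)) / 2 * Complex.log (1 - u ^ 2) := by ring
    rw [e] at h
    refine h.congr_fun fun j => ?_
    simp only [Function.comp_apply, SimpleGraph.evenTerm, if_pos (even_two_mul j)]
    push_cast
    rw [pow_mul, div_eq_mul_inv, div_eq_mul_inv, mul_inv]
    ring
  · intro m hm
    have : ¬ Even m := by
      rintro ⟨j, rfl⟩
      exact hm ⟨j, two_mul j⟩
    simp [SimpleGraph.evenTerm, this]

section EulerProduct

variable {ι : Type*} {len : ι → ℕ+} {μ : ι → ℝ} {p N : ℕ+ → ℝ}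

/-- The pairs are grouped by their product. Since `p` is nonnegative, the norms in a group add up to
the norm of the grouped term, so absolute convergence of the single series gives that of the double
one. -/
theorem summable_pnat_pair {u : ℂ} (hp : ∀ l, 0 ≤ p l)
    (hN : ∀ l : ℕ+, N l = ∑ x : Nat.divisorsAntidiagonal (l : ℕ),
      p (sigmaAntidiagonalEquivProd ⟨l, x⟩).1)
    {t : ℂ} (h : HasSum (fun l : ℕ+ => u ^ (l : ℕ) / (l : ℕ) * (N l : ℂ)) t) :
    HasSum (fun x : ℕ+ × ℕ+ => u ^ ((x.1 : ℕ) * x.2) / ((x.1 : ℕ) * (x.2 : ℕ)) * (p x.1 : ℂ)) t := by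
  rw [← sigmaAntidiagonalEquivProd.hasSum_iff]
  have hterm : ∀ (l : ℕ+) (x : Nat.divisorsAntidiagonal (l : ℕ)),
      ((fun x : ℕ+ × ℕ+ => u ^ ((x.1 : ℕ) * x.2) / ((x.1 : ℕ) * (x.2 : ℕ)) * (p x.1 : ℂ))
        ∘ sigmaAntidiagonalEquivProd) ⟨l, x⟩
      = u ^ (l : ℕ) / (l : ℕ) * (p (sigmaAntidiagonalEquivProd ⟨l, x⟩).1 : ℂ) := by
    intro l x
    have hx : ((sigmaAntidiagonalEquivProd ⟨l, x⟩).1 : ℕ) * (sigmaAntidiagonalEquivProd ⟨l, x⟩).2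
        = l := (Nat.mem_divisorsAntidiagonal.1 x.2).1
    simp only [Function.comp_apply]
    rw [hx, ← Nat.cast_mul, hx]
  have hfib : ∀ l : ℕ+, HasSum (fun x : Nat.divisorsAntidiagonal (l : ℕ) =>
      ((fun x : ℕ+ × ℕ+ => u ^ ((x.1 : ℕ) * x.2) / ((x.1 : ℕ) * (x.2 : ℕ)) * (p x.1 : ℂ))
        ∘ sigmaAntidiagonalEquivProd) ⟨l, x⟩) (u ^ (l : ℕ) / (l : ℕ) * (N l : ℂ)) := by
    intro l
    simp only [hterm]
    rw [hN, Complex.ofReal_sum, Finset.mul_sum]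
    exact hasSum_fintype _
  have hsum : Summable ((fun x : ℕ+ × ℕ+ =>
      u ^ ((x.1 : ℕ) * x.2) / ((x.1 : ℕ) * (x.2 : ℕ)) * (p x.1 : ℂ))
        ∘ sigmaAntidiagonalEquivProd) := by
    refine Summable.of_norm ?_
    rw [summable_sigma_of_nonneg fun _ => norm_nonneg _]
    refine ⟨fun l => (hasSum_fintype _).summable, ?_⟩
    refine h.summable.norm.congr fun l => ?_
    rw [tsum_fintype]
    simp only [hterm, norm_mul]
    rw [← Finset.mul_sum, hN]
    congr 1
    simp only [Complex.norm_real, Real.norm_eq_abs]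
    rw [abs_of_nonneg (Finset.sum_nonneg fun _ _ => hp _)]
    exact Finset.sum_congr rfl fun _ _ => (abs_of_nonneg (hp _)).symm
  have := hsum.hasSum.sigma hfib
  rw [h.unique this]
  exact hsum.hasSum

/-- Here `p l` stands for the density of primitive walks and `N l` for that of all reduced walks.
The logarithms of the factors of length `d` add up to `-(p d / d) log (1 - u ^ d) = ∑ j, u ^ (d j) /
(d j) * p d`, and collecting the pairs with `d j = l` gives `u ^ l / l * N l`. Nonnegativity of `μ`
makes every rearrangement absolutely convergent. -/
theorem hasProd_of_hasSum {u : ℂ} (hu : ‖u‖ < 1) (hμ : ∀ κ, 0 ≤ μ κ)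
    (hp : ∀ l : ℕ+, HasSum (fun κ : {κ : ι // len κ = l} => (l : ℕ) * μ κ) (p l))
    (hN : ∀ l : ℕ+, N l = ∑ x : Nat.divisorsAntidiagonal (l : ℕ),
      p (sigmaAntidiagonalEquivProd ⟨l, x⟩).1)
    {t : ℂ} (h : HasSum (fun l : ℕ+ => u ^ (l : ℕ) / (l : ℕ) * (N l : ℂ)) t) :
    HasProd (fun κ => (1 - u ^ (len κ : ℕ)) ^ (-(μ κ : ℂ))) (Complex.exp t) := by
  have hp0 : ∀ l, 0 ≤ p l := fun l => (hp l).nonneg fun κ => by have := hμ κ; positivity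
  have hpow : ∀ d : ℕ+, ‖u ^ (d : ℕ)‖ < 1 := by
    intro d
    rw [norm_pow]
    exact pow_lt_one₀ (norm_nonneg _) hu d.pos.ne'
  have h1 := summable_pnat_pair hp0 hN h
  have hinner : ∀ d : ℕ+, HasSum (fun j : ℕ+ =>
      u ^ ((d : ℕ) * j) / ((d : ℕ) * (j : ℕ)) * (p d : ℂ))
      ((p d : ℂ) / (d : ℕ) * -Complex.log (1 - u ^ (d : ℕ))) := by
    intro d
    have h2 := (Complex.hasSum_taylorSeries_neg_log (hpow d)).mul_left ((p d : ℂ) / (d : ℕ))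
    have h3 : HasSum ((fun n : ℕ => (p d : ℂ) / (d : ℕ) * ((u ^ (d : ℕ)) ^ n / n))
        ∘ ((↑) : ℕ+ → ℕ)) ((p d : ℂ) / (d : ℕ) * -Complex.log (1 - u ^ (d : ℕ))) := by
      rw [PNat.coe_injective.hasSum_iff]
      · exact h2
      · intro n hn
        have : n = 0 := by
          by_contra h0
          exact hn ⟨⟨n, Nat.pos_of_ne_zero h0⟩, rfl⟩
        simp [this]
    refine h3.congr_fun fun j => ?_
    rw [Function.comp_apply, pow_mul, div_mul_div_comm]
    ring
  have h2 : HasSum (fun d : ℕ+ => (p d : ℂ) / (d : ℕ) * -Complex.log (1 - u ^ (d : ℕ))) t :=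
    h1.prod_fiberwise hinner
  have hfib : ∀ d : ℕ+, HasSum (fun κ : {κ : ι // len κ = d} => μ κ) (p d / (d : ℕ)) := by
    intro d
    have hd : ((d : ℕ) : ℝ) ≠ 0 := by exact_mod_cast d.pos.ne'
    refine ((hp d).div_const ((d : ℕ) : ℝ)).congr_fun fun κ => ?_
    rw [mul_div_cancel_left₀ _ hd]
  let F : ι → ℂ := fun κ => (μ κ : ℂ) * -Complex.log (1 - u ^ (len κ : ℕ))
  have hFd : ∀ (d : ℕ+) (κ : {κ : ι // len κ = d}),
      F κ = (μ κ : ℂ) * -Complex.log (1 - u ^ (d : ℕ)) := by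
    rintro d ⟨κ, rfl⟩
    rfl
  have hfibF : ∀ d : ℕ+, HasSum (fun κ : {κ : ι // len κ = d} => F κ)
      ((p d : ℂ) / (d : ℕ) * -Complex.log (1 - u ^ (d : ℕ))) := by
    intro d
    simp only [hFd]
    refine HasSum.mul_right _ ?_
    have := Complex.hasSum_ofReal.2 (hfib d)
    simpa using this
  have hsumF : Summable (F ∘ Equiv.sigmaFiberEquiv len) := by
    refine Summable.of_norm ?_
    rw [summable_sigma_of_nonneg fun _ => norm_nonneg _]
    have hn : ∀ d : ℕ+, HasSum (fun κ : {κ : ι // len κ = d} => ‖F κ‖)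
        (‖(p d : ℂ) / (d : ℕ) * -Complex.log (1 - u ^ (d : ℕ))‖) := by
      intro d
      simp only [hFd, norm_mul, Complex.norm_real, Real.norm_eq_abs]
      refine HasSum.mul_right _ ?_
      rw [norm_div, Complex.norm_real, Complex.norm_natCast, Real.norm_eq_abs,
        abs_of_nonneg (hp0 d)]
      refine (hfib d).congr_fun fun κ => ?_
      exact abs_of_nonneg (hμ κ)
    refine ⟨fun d => (hn d).summable, h2.summable.norm.congr fun d => ?_⟩
    exact (hn d).tsum_eq.symm
  have hF : HasSum F t := by
    rw [← (Equiv.sigmaFiberEquiv len).hasSum_iff]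
    have h3 := hsumF.hasSum.sigma hfibF
    rw [h2.unique h3]
    exact hsumF.hasSum
  have := hF.cexp
  refine this.congr_fun fun κ => ?_
  have hne : 1 - u ^ (len κ : ℕ) ≠ 0 := one_sub_ne_zero_of_norm_lt (hpow (len κ))
  rw [Function.comp_apply, Complex.cpow_def_of_ne_zero hne]
  congr 1
  ring

end EulerProduct

/-! ### The power series of the logarithm of the zeta function -/

theorem functional_segmentDickson {q : ℕ} {L : C(realSegment ((q : ℝ) + 1), ℂ) →L[ℂ] ℂ} {a : ℕ → ℝ}
    (ha : ∀ k, L (segmentId ((q : ℝ) + 1) ^ k) = a k) (m : ℕ) :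
    L (segmentDickson q m)
      = (((Polynomial.dickson 1 (q : ℝ) m).sum fun k c => c * a k : ℝ) : ℂ) := by
  have hmap : Polynomial.dickson 1 (q : ℂ) m
      = (Polynomial.dickson 1 (q : ℝ) m).map Complex.ofRealHom := by
    rw [Polynomial.map_dickson]
    simp
  rw [segmentDickson, Polynomial.aeval_eq_sum_range, map_sum, hmap,
    Polynomial.natDegree_map_eq_of_injective Complex.ofRealHom.injective,
    Polynomial.sum_over_range _ (by simp), Complex.ofReal_sum]
  refine Finset.sum_congr rfl fun k _ => ?_
  rw [map_smul, ha, Polynomial.coeff_map]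
  simp

/-- The logarithm of the zeta function. -/
noncomputable def logZeta (q : ℕ) (L : C(realSegment ((q : ℝ) + 1), ℂ) →L[ℂ] ℂ) (u : ℂ) : ℂ :=
  ∑' m : ℕ, u ^ m / m * L (segmentDickson q m) + (1 - (q : ℂ)) / 2 * Complex.log (1 - u ^ 2)

section LogZeta

variable {q : ℕ} {L : C(realSegment ((q : ℝ) + 1), ℂ) →L[ℂ] ℂ}

theorem norm_lt_one_of_lt (hq : 1 ≤ q) {u : ℂ} (hu : ‖u‖ < 1 / (q : ℝ)) : ‖u‖ < 1 := by
  refine hu.trans_le ?_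
  rw [div_le_one (by exact_mod_cast hq)]
  exact_mod_cast hq

theorem one_sub_sq_mem_slitPlane {u : ℂ} (hu : ‖u‖ < 1) : 1 - u ^ 2 ∈ Complex.slitPlane := by
  rw [sub_eq_add_neg]
  refine Complex.mem_slitPlane_of_norm_lt_one ?_
  rw [norm_neg, norm_pow]
  exact pow_lt_one₀ (norm_nonneg _) hu two_ne_zero

theorem logZeta_zero : logZeta q L 0 = 0 := by
  have h : ∀ m : ℕ, (0 : ℂ) ^ m / m * L (segmentDickson q m) = 0 := by
    intro m
    rcases Nat.eq_zero_or_pos m with rfl | hm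
    · simp
    · simp [hm.ne']
  simp [logZeta, h]

theorem differentiableOn_logZeta (hq : 1 ≤ q) (hL : ‖L‖ ≤ 1) :
    DifferentiableOn ℂ (logZeta q L) (Metric.ball 0 (1 / (q : ℝ))) := by
  refine (differentiableOn_dickson_functional hq hL).add ?_
  refine (DifferentiableOn.clog (by fun_prop) fun u hu => ?_).const_mul _
  exact one_sub_sq_mem_slitPlane (norm_lt_one_of_lt hq (mem_ball_zero_iff.1 hu))

theorem hasSum_logZeta (hq : 1 ≤ q) (hL : ‖L‖ ≤ 1) {u : ℂ} (hu : ‖u‖ < 1 / (q : ℝ)) :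
    HasSum (fun m : ℕ => u ^ m / m * (L (segmentDickson q m) + (SimpleGraph.evenTerm q m : ℂ)))
      (logZeta q L u) := by
  simp only [mul_add]
  exact (summable_dickson_functional hq hL hu).hasSum.add
    (hasSum_evenTerm q (norm_lt_one_of_lt hq hu))

theorem exp_logZeta (hq : 1 ≤ q) {u : ℂ} (hu : ‖u‖ < 1 / (q : ℝ)) (hL : L 1 = 1) :
    Complex.exp (logZeta q L u) = (1 - u ^ 2) ^ ((1 - (q : ℂ)) / 2)
      * (zetaDet q L u)⁻¹ := by
  rw [zetaDet_eq_exp_neg_tsum hq hu hL, logZeta, Complex.exp_add, Complex.exp_neg, inv_inv,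
    Complex.cpow_def_of_ne_zero (Complex.slitPlane_ne_zero
      (one_sub_sq_mem_slitPlane (norm_lt_one_of_lt hq hu))), mul_comm (Complex.log _), mul_comm]

end LogZeta

/-! ### The expansions in terms of the moments -/

/-- Both sides are logarithms of the same number and remain defined with `u` replaced by `t u`, `0 ≤
t ≤ 1`. Their difference is constant in `t` and vanishes at `t = 0`. -/
theorem log_one_sub_mul {u y z : ℂ} (hy : ‖y * u‖ < 1) (hz : ‖z * u‖ < 1)
    (h : ‖y + z‖ * ‖u‖ + ‖y * z‖ * ‖u‖ ^ 2 < 1) :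
    Complex.log (1 - ((y + z) * u - y * z * u ^ 2))
      = Complex.log (1 - y * u) + Complex.log (1 - z * u) := by
  have hw : ∀ t ∈ Set.Icc (0 : ℝ) 1,
      ‖(y + z) * (t * u) - y * z * (t * u) ^ 2‖ < 1 := by
    rintro t ⟨h0, h1⟩
    refine lt_of_le_of_lt ((norm_sub_le _ _).trans ?_) h
    simp only [norm_mul, norm_pow, Complex.norm_real, Real.norm_eq_abs, abs_of_nonneg h0]
    gcongr
    · exact mul_le_of_le_one_left (norm_nonneg _) h1
    · exact mul_le_of_le_one_left (norm_nonneg _) h1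
  have hlin : ∀ y : ℂ, ‖y * u‖ < 1 → ∀ t ∈ Set.Icc (0 : ℝ) 1, ‖y * (t * u)‖ < 1 := by
    rintro y hy t ⟨h0, h1⟩
    refine lt_of_le_of_lt ?_ hy
    simp only [norm_mul, Complex.norm_real, Real.norm_eq_abs, abs_of_nonneg h0]
    gcongr
    exact mul_le_of_le_one_left (norm_nonneg _) h1
  have hslit : ∀ {v : ℂ}, ‖v‖ < 1 → 1 - v ∈ Complex.slitPlane := by
    intro v hv
    rw [sub_eq_add_neg]
    exact Complex.mem_slitPlane_of_norm_lt_one (by rwa [norm_neg])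
  obtain ⟨k, hk⟩ := eqOn_add_of_exp_eq (isPreconnected_Icc (a := (0 : ℝ)) (b := 1))
    (f := fun t : ℝ => Complex.log (1 - ((y + z) * (t * u) - y * z * (t * u) ^ 2)))
    (g := fun t : ℝ => Complex.log (1 - y * (t * u)) + Complex.log (1 - z * (t * u)))
    (ContinuousOn.clog (by fun_prop) fun t ht => hslit (hw t ht))
    ((ContinuousOn.clog (by fun_prop) fun t ht => hslit (hlin y hy t ht)).add
      (ContinuousOn.clog (by fun_prop) fun t ht => hslit (hlin z hz t ht)))
    (fun t ht => by
      rw [Complex.exp_add, Complex.exp_log (one_sub_ne_zero_of_norm_lt (hw t ht)),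
        Complex.exp_log (one_sub_ne_zero_of_norm_lt (hlin y hy t ht)),
        Complex.exp_log (one_sub_ne_zero_of_norm_lt (hlin z hz t ht))]
      ring)
  have h0 := hk 0 (by simp)
  have h1 := hk 1 (by simp)
  have hk0 : (k : ℂ) * (2 * Real.pi * Complex.I) = 0 := by simpa using h0.symm
  rw [hk0, add_zero] at h1
  simpa using h1

section Moments

variable {q : ℕ}

/-- `u x - q u²` as a function of `x`. -/
noncomputable def segmentVar (q : ℕ) (u : ℂ) : C(realSegment ((q : ℝ) + 1), ℂ) :=
  u • segmentId ((q : ℝ) + 1) + algebraMap ℂ _ (-(q : ℂ) * u ^ 2)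

theorem norm_segmentVar_le (u : ℂ) :
    ‖segmentVar q u‖ ≤ ((q : ℝ) + 1) * ‖u‖ + (q : ℝ) * ‖u‖ ^ 2 := by
  refine (norm_add_le _ _).trans (add_le_add ?_ ?_)
  · rw [norm_smul, mul_comm]
    exact mul_le_mul_of_nonneg_right (norm_segmentId_le (by positivity)) (norm_nonneg _)
  · rw [norm_algebraMap', norm_mul, norm_neg, norm_pow, Complex.norm_natCast]

theorem norm_lt_of_small (hq : 1 ≤ q) {u : ℂ}
    (hu : ((q : ℝ) + 1) * ‖u‖ + (q : ℝ) * ‖u‖ ^ 2 < 1) : ‖u‖ < 1 / (q : ℝ) := by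
  have hq0 : (0 : ℝ) < q := by exact_mod_cast hq
  rw [lt_div_iff₀ hq0]
  nlinarith [norm_nonneg u, mul_nonneg hq0.le (sq_nonneg ‖u‖)]

/-- Both series represent `-log (1 + q u² - u x)`: one in powers of `u x - q u²`, the other through
the factorization with roots `y` and `z`. The condition on `u` makes the first converge in norm. -/
theorem tsum_segmentVar_eq (hq : 1 ≤ q) {u : ℂ}
    (hu : ((q : ℝ) + 1) * ‖u‖ + (q : ℝ) * ‖u‖ ^ 2 < 1) :
    HasSum (fun n : ℕ => (n : ℂ)⁻¹ • segmentVar q u ^ n)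
      (∑' m : ℕ, (u ^ m / m) • segmentDickson q m) := by
  have hn : ‖segmentVar q u‖ < 1 := (norm_segmentVar_le u).trans_lt hu
  have hu' := norm_lt_of_small hq hu
  have hsum : Summable fun n : ℕ => (n : ℂ)⁻¹ • segmentVar q u ^ n :=
    Summable.of_norm_bounded (summable_geometric_of_lt_one (norm_nonneg _) hn)
      fun n => norm_inv_smul_pow_le n _
  have heq : ∑' n : ℕ, (n : ℂ)⁻¹ • segmentVar q u ^ n
      = ∑' m : ℕ, (u ^ m / m) • segmentDickson q m := by
    ext x
    obtain ⟨y, z, h1, h2, h3, h4⟩ := exists_roots_of_mem_segment hq x.2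
    rw [tsum_dickson_apply hq hu' x h1 h2 h3 h4, ← neg_add,
      ← log_one_sub_mul (norm_root_mul_lt hq hu' h3) (norm_root_mul_lt hq hu' h4)]
    · have hs := (ContinuousMap.evalCLM ℂ x).hasSum hsum.hasSum
      refine hs.unique ?_
      have hx : segmentVar q u x = (y + z) * u - y * z * u ^ 2 := by
        rw [h1, h2]
        change u * (x : ℂ) + -(q : ℂ) * u ^ 2 = _
        ring
      rw [← hx]
      refine (Complex.hasSum_taylorSeries_neg_log
        ((ContinuousMap.norm_coe_le_norm _ x).trans_lt hn)).congr_fun fun n => ?_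
      change (n : ℂ)⁻¹ * segmentVar q u x ^ n = _
      rw [div_eq_inv_mul]
    · refine lt_of_le_of_lt ?_ hu
      rw [h1, h2, Complex.norm_natCast]
      gcongr
      exact norm_le_of_mem_realSegment x.2
  rw [← heq]
  exact hsum.hasSum

variable {L : C(realSegment ((q : ℝ) + 1), ℂ) →L[ℂ] ℂ} {τ : ℕ → ℂ}

/-- The term of the expansion of the logarithm of the determinant with exponents `(k, j)` of
`u x` and `-q u²`. -/
noncomputable def momentTerm (q : ℕ) (τ : ℕ → ℂ) (u : ℂ) (x : ℕ × ℕ) : ℂ :=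
  ((x.1 + x.2 : ℕ) : ℂ)⁻¹ * (((x.1 + x.2).choose x.1 : ℂ) * ((q : ℂ) + 1) ^ x.1
    * (-(q : ℂ)) ^ x.2 * u ^ (x.1 + 2 * x.2) * τ x.1)

theorem sum_momentTerm (hτ : ∀ k, L (segmentId ((q : ℝ) + 1) ^ k) = ((q : ℂ) + 1) ^ k * τ k)
    (u : ℂ) (n : ℕ) : ∑ x ∈ Finset.HasAntidiagonal.antidiagonal n, momentTerm q τ u x
      = L ((n : ℂ)⁻¹ • segmentVar q u ^ n) := by
  rw [segmentVar, (Commute.all _ _).add_pow', map_smul, map_sum, smul_eq_mul, Finset.mul_sum]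
  refine Finset.sum_congr rfl fun x hx => ?_
  have hx' := Finset.HasAntidiagonal.mem_antidiagonal.1 hx
  rw [momentTerm, hx', map_nsmul, ← map_pow, mul_comm (_ ^ _) (algebraMap ℂ _ _),
    ← Algebra.smul_def, map_smul, smul_pow, map_smul, hτ, nsmul_eq_mul, smul_eq_mul, smul_eq_mul]
  ring

theorem norm_momentTerm_le (hτ1 : ∀ k, ‖τ k‖ ≤ 1) (u : ℂ) (n : ℕ) :
    ∑ x ∈ Finset.HasAntidiagonal.antidiagonal n, ‖momentTerm q τ u x‖
      ≤ (((q : ℝ) + 1) * ‖u‖ + (q : ℝ) * ‖u‖ ^ 2) ^ n := by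
  rw [(Commute.all _ _).add_pow']
  refine Finset.sum_le_sum fun x hx => ?_
  have hx' := Finset.HasAntidiagonal.mem_antidiagonal.1 hx
  have hq1 : ‖(q : ℂ) + 1‖ = q + 1 := by
    rw [← Nat.cast_add_one, Complex.norm_natCast]
    push_cast
    rfl
  rw [momentTerm, hx', norm_mul, norm_inv, Complex.norm_natCast]
  refine (mul_le_of_le_one_left (norm_nonneg _) (Nat.cast_inv_le_one n)).trans ?_
  rw [norm_mul]
  refine (mul_le_of_le_one_right (norm_nonneg _) (hτ1 _)).trans (le_of_eq ?_)
  rw [norm_mul, norm_mul, norm_mul, norm_pow, norm_pow, norm_pow, norm_neg, hq1,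
    Complex.norm_natCast, Complex.norm_natCast, nsmul_eq_mul, mul_pow, mul_pow, ← pow_mul, pow_add]
  ring

theorem summable_momentTerm (hτ1 : ∀ k, ‖τ k‖ ≤ 1) {u : ℂ}
    (hu : ((q : ℝ) + 1) * ‖u‖ + (q : ℝ) * ‖u‖ ^ 2 < 1) : Summable (momentTerm q τ u) := by
  rw [← Finset.HasAntidiagonal.sigmaAntidiagonalEquivProd.summable_iff]
  refine Summable.of_norm ?_
  rw [summable_sigma_of_nonneg fun _ => norm_nonneg _]
  refine ⟨fun n => (hasSum_fintype _).summable, ?_⟩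
  refine Summable.of_nonneg_of_le (fun n => tsum_nonneg fun _ => norm_nonneg _) (fun n => ?_)
    (summable_geometric_of_lt_one (by positivity) hu)
  rw [tsum_fintype]
  refine le_trans (le_of_eq ?_) (norm_momentTerm_le hτ1 u n)
  exact Finset.sum_coe_sort (Finset.HasAntidiagonal.antidiagonal n) fun x => ‖momentTerm q τ u x‖

theorem hasSum_momentTerm (hq : 1 ≤ q)
    (hτ : ∀ k, L (segmentId ((q : ℝ) + 1) ^ k) = ((q : ℂ) + 1) ^ k * τ k)
    (hτ1 : ∀ k, ‖τ k‖ ≤ 1) {u : ℂ} (hu : ((q : ℝ) + 1) * ‖u‖ + (q : ℝ) * ‖u‖ ^ 2 < 1) :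
    HasSum (momentTerm q τ u) (∑' m : ℕ, u ^ m / m * L (segmentDickson q m)) := by
  have h1 := L.hasSum (tsum_segmentVar_eq hq hu)
  have hfib : ∀ n : ℕ, HasSum (fun x : Finset.HasAntidiagonal.antidiagonal n =>
      (momentTerm q τ u ∘ Finset.HasAntidiagonal.sigmaAntidiagonalEquivProd) ⟨n, x⟩)
      (L ((n : ℂ)⁻¹ • segmentVar q u ^ n)) := by
    intro n
    rw [← sum_momentTerm hτ, ← Finset.sum_coe_sort]
    exact hasSum_fintype _
  have hs := (Finset.HasAntidiagonal.sigmaAntidiagonalEquivProd (A := ℕ)).summable_iff.2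
    (summable_momentTerm hτ1 hu)
  have h2 := h1.unique (hs.hasSum.sigma hfib)
  have h3 : L (∑' m : ℕ, (u ^ m / m) • segmentDickson q m)
      = ∑' m : ℕ, u ^ m / m * L (segmentDickson q m) := by
    rw [L.map_tsum (summable_dickson_term hq (norm_lt_of_small hq hu))]
    simp only [map_smul, smul_eq_mul]
  rw [← h3, h2, ← Finset.HasAntidiagonal.sigmaAntidiagonalEquivProd.hasSum_iff]
  exact hs.hasSum

/-- The expansion ordered by the degree in the moments. -/
theorem hasSum_by_degree (hq : 1 ≤ q)
    (hτ : ∀ k, L (segmentId ((q : ℝ) + 1) ^ k) = ((q : ℂ) + 1) ^ k * τ k)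
    {u : ℂ} (hu : ((q : ℝ) + 1) * ‖u‖ + (q : ℝ) * ‖u‖ ^ 2 < 1) :
    HasSum (fun n : ℕ => (1 / ((n : ℂ) + 1)) * ∑ k ∈ Finset.range (n + 1 + 1),
        ((n + 1).choose k : ℂ) * ((q : ℂ) + 1) ^ k * (-(q : ℂ)) ^ (n + 1 - k)
          * u ^ (2 * (n + 1) - k) * τ k)
      (∑' m : ℕ, u ^ m / m * L (segmentDickson q m)) := by
  have h1 := L.hasSum (tsum_segmentVar_eq hq hu)
  have h3 : L (∑' m : ℕ, (u ^ m / m) • segmentDickson q m)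
      = ∑' m : ℕ, u ^ m / m * L (segmentDickson q m) := by
    rw [L.map_tsum (summable_dickson_term hq (norm_lt_of_small hq hu))]
    simp only [map_smul, smul_eq_mul]
  rw [h3, ← hasSum_nat_add_iff' 1] at h1
  simp only [Finset.range_one, Finset.sum_singleton, CharP.cast_eq_zero, inv_zero, zero_smul,
    map_zero, sub_zero] at h1
  refine h1.congr_fun fun n => ?_
  rw [← sum_momentTerm hτ, Finset.Nat.sum_antidiagonal_eq_sum_range_succ_mk,
    Finset.mul_sum]
  refine Finset.sum_congr rfl fun k hk => ?_
  have hk' : k ≤ n + 1 := Nat.lt_succ_iff.1 (Finset.mem_range.1 hk)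
  have e1 : k + (n + 1 - k) = n + 1 := by omega
  have e2 : k + 2 * (n + 1 - k) = 2 * (n + 1) - k := by omega
  simp only [momentTerm, e1, e2]
  push_cast
  rw [one_div]

/-- The coefficient of `u ^ m`. -/
noncomputable def momentCoeff (q : ℕ) (τ : ℕ → ℂ) (m : ℕ) : ℂ :=
  ∑ n ∈ Finset.Icc 1 m, (1 / (n : ℂ)) * ∑ k ∈ (Finset.range (n + 1)).filter
    (fun k => m + k = 2 * n), (n.choose k : ℂ) * ((q : ℂ) + 1) ^ k * (-(q : ℂ)) ^ (n - k) * τ k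

theorem sum_fiber_momentTerm (u : ℂ) (m : ℕ) :
    ∑ x ∈ (Finset.range (m + 1) ×ˢ Finset.range (m + 1)).filter (fun x => x.1 + 2 * x.2 = m),
      momentTerm q τ u x = u ^ m * momentCoeff q τ m := by
  rcases Nat.eq_zero_or_pos m with rfl | hm
  · rw [Finset.sum_eq_zero]
    · simp [momentCoeff]
    · intro x hx
      have := (Finset.mem_filter.1 hx).2
      have h1 : x.1 + x.2 = 0 := by omega
      simp [momentTerm, h1]
  · rw [momentCoeff, Finset.mul_sum]
    simp only [Finset.mul_sum]
    rw [Finset.sum_sigma']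
    symm
    -- The index `(n, k)` of the power series corresponds to the exponents `(k, n - k)` of `u x` and
    -- `-q u²`; the power of `u` is `k + 2 (n - k) = 2 n - k`.
    refine Finset.sum_bij' (fun p _ => (p.2, p.1 - p.2)) (fun x _ => ⟨x.1 + x.2, x.1⟩) ?_ ?_ ?_ ?_ ?_
    · rintro ⟨n, k⟩ hp
      simp only [Finset.mem_sigma, Finset.mem_Icc, Finset.mem_filter, Finset.mem_range] at hp
      simp only [Finset.mem_filter, Finset.mem_product, Finset.mem_range]
      omega
    · rintro ⟨k, j⟩ hx
      simp only [Finset.mem_filter, Finset.mem_product, Finset.mem_range] at hx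
      simp only [Finset.mem_sigma, Finset.mem_Icc, Finset.mem_filter, Finset.mem_range]
      omega
    · rintro ⟨n, k⟩ hp
      simp only [Finset.mem_sigma, Finset.mem_Icc, Finset.mem_filter, Finset.mem_range] at hp
      have : k + (n - k) = n := by omega
      simp [this]
    · rintro ⟨k, j⟩ _
      simp
    · rintro ⟨n, k⟩ hp
      simp only [Finset.mem_sigma, Finset.mem_Icc, Finset.mem_filter, Finset.mem_range] at hp
      have e1 : k + (n - k) = n := by omega
      have e2 : k + 2 * (n - k) = m := by omega
      simp only [momentTerm, e1, e2]
      ring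

theorem hasSum_momentCoeff (hq : 1 ≤ q)
    (hτ : ∀ k, L (segmentId ((q : ℝ) + 1) ^ k) = ((q : ℂ) + 1) ^ k * τ k)
    (hτ1 : ∀ k, ‖τ k‖ ≤ 1) {u : ℂ} (hu : ((q : ℝ) + 1) * ‖u‖ + (q : ℝ) * ‖u‖ ^ 2 < 1) :
    HasSum (fun m => u ^ m * momentCoeff q τ m)
      (∑' m : ℕ, u ^ m / m * L (segmentDickson q m)) := by
  have h := hasSum_momentTerm hq hτ hτ1 hu
  rw [← (Equiv.sigmaFiberEquiv fun x : ℕ × ℕ => x.1 + 2 * x.2).hasSum_iff] at h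
  refine h.sigma fun m => ?_
  have hF : ∀ x : ℕ × ℕ, x ∈ (Finset.range (m + 1) ×ˢ Finset.range (m + 1)).filter
      (fun x => x.1 + 2 * x.2 = m) ↔ x.1 + 2 * x.2 = m := by
    rintro ⟨k, j⟩
    simp only [Finset.mem_filter, Finset.mem_product, Finset.mem_range]
    omega
  let : Fintype {x : ℕ × ℕ // x.1 + 2 * x.2 = m} := Fintype.subtype _ hF
  rw [← sum_fiber_momentTerm, Finset.sum_subtype _ hF (momentTerm q τ u)]
  exact hasSum_fintype fun x : {x : ℕ × ℕ // x.1 + 2 * x.2 = m} => momentTerm q τ u x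

/-- Near `0` the regrouped moment series and the Dickson series have the same sum, so their
coefficients agree. Thus the moment series, once ordered by powers of `u`, converges on all of `‖u‖
< 1/q`, beyond the region where the double series was controlled. -/
theorem momentCoeff_eq (hq : 1 ≤ q)
    (hτ : ∀ k, L (segmentId ((q : ℝ) + 1) ^ k) = ((q : ℂ) + 1) ^ k * τ k)
    (hτ1 : ∀ k, ‖τ k‖ ≤ 1) (hL : ‖L‖ ≤ 1) (m : ℕ) :
    momentCoeff q τ m = L (segmentDickson q m) / m := by
  have hnhds : ∀ᶠ u : ℂ in 𝓝 0, ((q : ℝ) + 1) * ‖u‖ + (q : ℝ) * ‖u‖ ^ 2 < 1 := by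
    refine (Continuous.tendsto' (f := fun u : ℂ => ((q : ℝ) + 1) * ‖u‖ + (q : ℝ) * ‖u‖ ^ 2)
      (by fun_prop) 0 0 (by simp)).eventually_lt_const one_pos
  have h1 : HasFPowerSeriesAt (fun u : ℂ => ∑' m : ℕ, u ^ m / m * L (segmentDickson q m))
      (FormalMultilinearSeries.ofScalars ℂ (momentCoeff q τ)) 0 := by
    rw [hasFPowerSeriesAt_iff]
    filter_upwards [hnhds] with u hu
    simpa [FormalMultilinearSeries.coeff_ofScalars] using hasSum_momentCoeff hq hτ hτ1 hu
  have h2 : HasFPowerSeriesAt (fun u : ℂ => ∑' m : ℕ, u ^ m / m * L (segmentDickson q m))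
      (FormalMultilinearSeries.ofScalars ℂ fun m => L (segmentDickson q m) / m) 0 := by
    rw [hasFPowerSeriesAt_iff]
    filter_upwards [hnhds] with u hu
    have h3 := (summable_dickson_functional hq hL (norm_lt_of_small hq hu)).hasSum
    simp only [FormalMultilinearSeries.coeff_ofScalars, smul_eq_mul, zero_add]
    refine h3.congr_fun fun m => ?_
    ring
  have := congrArg (fun p => p.coeff m) (h1.eq_formalMultilinearSeries h2)
  simpa [FormalMultilinearSeries.coeff_ofScalars] using this

end Moments

/-! ### The square root of `1 - u²` -/

section PowerDomain

variable {q : ℕ}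

theorem sq_sub_mem_slitPlane_of_im_pos {u : ℂ} (hu : 0 < u.im) : 1 - u ^ 2 ∈ Complex.slitPlane := by
  rw [Complex.mem_slitPlane_iff]
  by_contra h
  push Not at h
  obtain ⟨h1, h2⟩ := h
  simp only [pow_two, Complex.sub_re, Complex.one_re, Complex.mul_re, Complex.sub_im,
    Complex.one_im, Complex.mul_im] at h1 h2
  have h3 : u.re = 0 := by
    have : u.re * u.im = 0 := by linarith
    exact (mul_eq_zero.1 this).resolve_right hu.ne'
  rw [h3] at h1
  nlinarith [mul_pos hu hu]

theorem one_sub_inv_sq_mem_slitPlane {u : ℂ} (h : ¬ (u.im = 0 ∧ |u.re| ≤ 1)) :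
    1 - (u ^ 2)⁻¹ ∈ Complex.slitPlane := by
  rw [Complex.mem_slitPlane_iff]
  by_contra hn
  push Not at hn
  obtain ⟨h1, h2⟩ := hn
  apply h
  set v := (u ^ 2)⁻¹ with hv
  have hvi : v.im = 0 := by simpa using h2
  have hvr : 1 ≤ v.re := by simpa using h1
  have hu2 : u ^ 2 = ((v.re)⁻¹ : ℝ) := by
    have : v = (v.re : ℂ) := Complex.ext rfl (by simpa using hvi)
    rw [Complex.ofReal_inv, ← this, hv, inv_inv]
  have hre := congrArg Complex.re hu2
  have him := congrArg Complex.im hu2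
  rw [Complex.ofReal_re, pow_two, Complex.mul_re] at hre
  rw [Complex.ofReal_im, pow_two, Complex.mul_im] at him
  have hv0 : 0 < (v.re)⁻¹ := by positivity
  have hv1 : (v.re)⁻¹ ≤ 1 := inv_le_one_of_one_le₀ hvr
  have hi : u.im = 0 := by
    have : u.re * u.im = 0 := by linarith
    rcases mul_eq_zero.1 this with h0 | h0
    · rw [h0] at hre
      nlinarith [mul_self_nonneg u.im]
    · exact h0
  refine ⟨hi, ?_⟩
  rw [hi] at hre
  rw [abs_le_one_iff_mul_self_le_one]
  linarith

/-- The square root of `1 - u²` near the origin and on the upper half plane. -/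
noncomputable def innerSqrt (u : ℂ) : ℂ := Complex.exp (Complex.log (1 - u ^ 2) / 2)

/-- The square root of `1 - u²` near infinity. -/
noncomputable def outerSqrt (u : ℂ) : ℂ :=
  -Complex.I * u * Complex.exp (Complex.log (1 - (u ^ 2)⁻¹) / 2)

theorem innerSqrt_sq {u : ℂ} (h : 1 - u ^ 2 ≠ 0) : innerSqrt u ^ 2 = 1 - u ^ 2 := by
  rw [innerSqrt, ← Complex.exp_nat_mul, Nat.cast_ofNat, mul_div_cancel₀ _ two_ne_zero,
    Complex.exp_log h]

theorem outerSqrt_sq {u : ℂ} (hu : u ≠ 0) (h : 1 - (u ^ 2)⁻¹ ≠ 0) :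
    outerSqrt u ^ 2 = 1 - u ^ 2 := by
  rw [outerSqrt, mul_pow, mul_pow, neg_sq, Complex.I_sq, ← Complex.exp_nat_mul, Nat.cast_ofNat,
    mul_div_cancel₀ _ two_ne_zero, Complex.exp_log h]
  field_simp
  ring

theorem ne_zero_of_im_pos {u : ℂ} (hu : 0 < u.im) : u ≠ 0 := by
  rintro rfl
  exact lt_irrefl _ hu

theorem one_sub_inv_sq_mem_slitPlane_of_im_pos {u : ℂ} (hu : 0 < u.im) :
    1 - (u ^ 2)⁻¹ ∈ Complex.slitPlane :=
  one_sub_inv_sq_mem_slitPlane fun h => hu.ne' h.1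

theorem differentiableAt_innerSqrt {u : ℂ} (h : 1 - u ^ 2 ∈ Complex.slitPlane) :
    DifferentiableAt ℂ innerSqrt u :=
  ((DifferentiableAt.clog (f := fun u : ℂ => 1 - u ^ 2) (by fun_prop) h).div_const 2).cexp

theorem differentiableAt_outerSqrt {u : ℂ} (hu : u ≠ 0) (h : 1 - (u ^ 2)⁻¹ ∈ Complex.slitPlane) :
    DifferentiableAt ℂ outerSqrt u := by
  refine DifferentiableAt.mul (by fun_prop)
    ((DifferentiableAt.clog (f := fun u : ℂ => 1 - (u ^ 2)⁻¹) ?_ h).div_const 2).cexp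
  exact (differentiableAt_const _).sub ((differentiableAt_id.pow 2).inv (pow_ne_zero 2 hu))

/-- Two continuous square roots of one nonvanishing function on a connected set agree if they agree
at a point; at `i` both are `√2`, which is why `outerSqrt` has the factor `-i`. -/
theorem innerSqrt_eq_outerSqrt {u : ℂ} (hu : 0 < u.im) : innerSqrt u = outerSqrt u := by
  have hpre : IsPreconnected {z : ℂ | 0 < z.im} := (convex_halfSpace_im_gt 0).isPreconnected
  refine hpre.eq_of_sq_eq (f := innerSqrt) (g := outerSqrt)
    (fun z hz => (differentiableAt_innerSqrt
      (sq_sub_mem_slitPlane_of_im_pos hz)).continuousAt.continuousWithinAt)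
    (fun z hz => (differentiableAt_outerSqrt (ne_zero_of_im_pos hz)
      (one_sub_inv_sq_mem_slitPlane_of_im_pos hz)).continuousAt.continuousWithinAt)
    (fun z hz => ?_) (fun {z} hz => ?_) (y := Complex.I) (by simp) ?_ hu
  · change innerSqrt z ^ 2 = outerSqrt z ^ 2
    rw [innerSqrt_sq (Complex.slitPlane_ne_zero (sq_sub_mem_slitPlane_of_im_pos hz)),
      outerSqrt_sq (ne_zero_of_im_pos hz)
        (Complex.slitPlane_ne_zero (one_sub_inv_sq_mem_slitPlane_of_im_pos hz))]
  · exact mul_ne_zero (mul_ne_zero (neg_ne_zero.2 Complex.I_ne_zero) (ne_zero_of_im_pos hz))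
      (Complex.exp_ne_zero _)
  · simp [innerSqrt, outerSqrt, Complex.I_sq]

open Classical in
/-- A holomorphic square root of `1 - u²` on the power domain. -/
noncomputable def domainSqrt (q : ℕ) (u : ℂ) : ℂ :=
  if ‖u‖ ^ 2 < 1 / (q : ℝ) ∨ 0 < u.im then innerSqrt u else outerSqrt u

theorem domainSqrt_ne_zero (hq : 1 ≤ q) (u : ℂ) : domainSqrt q u ≠ 0 := by
  rw [domainSqrt]
  split_ifs with h
  · exact Complex.exp_ne_zero _
  · refine mul_ne_zero (mul_ne_zero (neg_ne_zero.2 Complex.I_ne_zero) ?_) (Complex.exp_ne_zero _)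
    rintro rfl
    apply h
    left
    have : (0 : ℝ) < q := by exact_mod_cast hq
    rw [norm_zero, zero_pow two_ne_zero]
    positivity

/-- `outerSqrt` has its cut on `[-1, 1]`, so it is holomorphic on the part of the domain with `‖u‖²
> 1/q`; `innerSqrt` is holomorphic on the disc `‖u‖² < 1/q` and on the upper half plane. They agree
on the upper half plane, and the part of the circle with `Im u ≤ 0` is not in the domain. -/
theorem differentiableOn_domainSqrt (hq : 1 ≤ q) :
    DifferentiableOn ℂ (domainSqrt q) (zetaPowerDomain q) := by
  have hq' : (1 : ℝ) ≤ q := by exact_mod_cast hq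
  have hq0 : (0 : ℝ) < q := by linarith
  intro u hu
  refine DifferentiableAt.differentiableWithinAt ?_
  by_cases h : ‖u‖ ^ 2 < 1 / (q : ℝ) ∨ 0 < u.im
  · have hopen : IsOpen ({u : ℂ | ‖u‖ ^ 2 < 1 / (q : ℝ)} ∪ {u : ℂ | 0 < u.im}) :=
      (isOpen_lt (by fun_prop) continuous_const).union
        (isOpen_lt continuous_const Complex.continuous_im)
    refine (differentiableAt_innerSqrt (u := u) ?_).congr_of_eventuallyEq ?_
    · rcases h with h | h
      · refine one_sub_sq_mem_slitPlane ?_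
        have : ‖u‖ ^ 2 < 1 := h.trans_le ((div_le_one hq0).2 hq')
        rwa [sq_lt_one_iff₀ (norm_nonneg u)] at this
      · exact sq_sub_mem_slitPlane_of_im_pos h
    · filter_upwards [hopen.mem_nhds h] with v hv
      exact if_pos hv
  · push Not at h
    have hgt : 1 / (q : ℝ) < ‖u‖ ^ 2 := by
      refine lt_of_le_of_ne h.1 fun heq => hu (Or.inl ⟨heq.symm, h.2⟩)
    have hopen : IsOpen {u : ℂ | 1 / (q : ℝ) < ‖u‖ ^ 2} :=
      isOpen_lt continuous_const (by fun_prop)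
    have hu0 : u ≠ 0 := by
      rintro rfl
      have : 0 < 1 / (q : ℝ) := by positivity
      rw [norm_zero] at hgt
      linarith
    refine (differentiableAt_outerSqrt hu0
      (one_sub_inv_sq_mem_slitPlane ?_)).congr_of_eventuallyEq ?_
    · rintro ⟨hi, hr⟩
      refine hu (Or.inr ⟨hi, ?_, hr⟩)
      rw [← Complex.normSq_eq_norm_sq, Complex.normSq_apply, hi] at hgt
      have : |u.re| * |u.re| = u.re * u.re := abs_mul_abs_self _
      nlinarith [abs_nonneg u.re]
    · filter_upwards [hopen.mem_nhds hgt] with v hv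
      rw [domainSqrt]
      split_ifs with h'
      · exact innerSqrt_eq_outerSqrt (h'.resolve_left (not_lt.2 (le_of_lt hv)))
      · rfl

theorem domainSqrt_pow_inv (hq : 1 ≤ q) {u : ℂ} (hu : ‖u‖ < 1 / (q : ℝ)) :
    (domainSqrt q u ^ (q - 1))⁻¹ = (1 - u ^ 2) ^ ((1 - (q : ℂ)) / 2) := by
  have h1 := norm_lt_one_of_lt hq hu
  have h2 : ‖u‖ ^ 2 < 1 / (q : ℝ) := by
    refine lt_of_le_of_lt ?_ hu
    nlinarith [norm_nonneg u]
  rw [domainSqrt, if_pos (Or.inl h2), innerSqrt, ← Complex.exp_nat_mul, ← Complex.exp_neg,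
    Complex.cpow_def_of_ne_zero (Complex.slitPlane_ne_zero (one_sub_sq_mem_slitPlane h1)),
    Nat.cast_sub hq]
  congr 1
  push_cast
  ring

theorem zetaDomain_subset_zetaPowerDomain : zetaDomain q ⊆ zetaPowerDomain q :=
  Set.compl_subset_compl.2 (Set.union_subset_union_left _ fun _ h => h.1)

end PowerDomain

/-! ### The two operators as self-adjoint operators of norm at most `q + 1` -/

section ScaledOperators

variable {V : Type*} {X : SimpleGraph V} [X.LocallyFinite] {d q : ℕ} (hd : ∀ v, X.degree v ≤ d)

theorem norm_adjOp_le (hdeg : ∀ v, X.degree v ≤ q + 1) : ‖adjOp X hd‖ ≤ (q : ℝ) + 1 := by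
  have h : adjOp X hd = adjOp X hdeg := by
    ext f x
    rfl
  rw [h]
  refine (norm_weightedAdj_le hdeg _ _).trans (le_of_eq ?_)
  push_cast
  rfl

theorem isSelfAdjoint_smul_symmWalkOp :
    IsSelfAdjoint (((q : ℂ) + 1) • symmWalkOp X hd) := by
  refine IsSelfAdjoint.smul ?_ (isSelfAdjoint_symmWalkOp hd)
  rw [IsSelfAdjoint, star_add, star_natCast, star_one]

theorem norm_smul_symmWalkOp_le : ‖((q : ℂ) + 1) • symmWalkOp X hd‖ ≤ (q : ℝ) + 1 := by
  rw [norm_smul, ← Nat.cast_add_one, Complex.norm_natCast]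
  push_cast
  exact mul_le_of_le_one_right (by positivity) (norm_symmWalkOp_le hd)

end ScaledOperators

namespace SelfSimilarData

variable {V : Type*} [Infinite V] {X : SimpleGraph V} [X.LocallyFinite] {S : SelfSimilarData X}

theorem hasTrace_smul_symmWalkOp_pow {d q : ℕ} (hd : ∀ v, X.degree v ≤ d)
    (hq : {v | X.degree v ≠ q + 1}.Finite) {s : (VertexSpace V →L[ℂ] VertexSpace V)ˣ}
    (hs : IsDiagonalUnit s) (hwalk : walkOp X hd = ↑s * symmWalkOp X hd * ↑s⁻¹) {k : ℕ} {a : ℂ}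
    (ha : S.HasTrace (adjOp X hd ^ k) a) :
    S.HasTrace ((((q : ℂ) + 1) • symmWalkOp X hd) ^ k) a := by
  have hq0 : (q : ℂ) + 1 ≠ 0 := by exact_mod_cast Nat.succ_ne_zero q
  have h1 := hasTrace_walkOp_pow hd hq ha
  rw [hwalk, Units.conj_pow, hasTrace_conj hs] at h1
  have h2 := h1.smul (((q : ℂ) + 1) ^ k)
  rw [← mul_assoc, ← mul_pow, mul_inv_cancel₀ hq0, one_pow, one_mul] at h2
  rwa [smul_pow]

/-- The bound `q + 1` on all degrees gives `‖A‖ ≤ q + 1`. The symmetrized walk operator times `q +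
1` has the same norm bound and the same moments, so both share `L`. -/
theorem exists_zeta_functional (hconn : X.Connected) {d q : ℕ} (hd : ∀ v, X.degree v ≤ d)
    (hq : {v | X.degree v ≠ q + 1}.Finite) {a : ℕ → ℂ}
    (ha : ∀ k, S.HasTrace (adjOp X hd ^ k) (a k)) :
    ∃ L : C(realSegment ((q : ℝ) + 1), ℂ) →L[ℂ] ℂ, ‖L‖ ≤ 1 ∧
      (∀ k, L (segmentId ((q : ℝ) + 1) ^ k) = a k) ∧
      S.IsSpectralFunctional L (adjOp X hd) ∧
      S.IsSpectralFunctional L (((q : ℂ) + 1) • symmWalkOp X hd) := by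
  have hdeg : ∀ v, X.degree v ≤ q + 1 := S.degree_le_of_essentially_regular hq
  obtain ⟨s, hs, hwalk⟩ := exists_walkOp_eq_conj hd fun v => hconn.degree_pos_of_infinite v
  obtain ⟨L, hL1, hLa, hL⟩ := exists_isSpectralFunctional S (R := (q : ℝ) + 1)
    (isSelfAdjoint_adjOp hd) (norm_adjOp_le hd hdeg) ha
  exact ⟨L, hL1, hLa, hL _ (isSelfAdjoint_adjOp hd) (norm_adjOp_le hd hdeg) ha,
    hL _ (isSelfAdjoint_smul_symmWalkOp hd) (norm_smul_symmWalkOp_le hd)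
      fun k => hasTrace_smul_symmWalkOp_pow hd hq hs hwalk (ha k)⟩

theorem hasDet_adjOp {d q : ℕ} (hd : ∀ v, X.degree v ≤ d) (hq1 : 1 ≤ q)
    {L : C(realSegment ((q : ℝ) + 1), ℂ) →L[ℂ] ℂ} (hL : S.IsSpectralFunctional L (adjOp X hd))
    (hL1 : L 1 = 1) {u : ℂ} (hu : u ∈ zetaDomain q) :
    S.HasDet ((1 + (q : ℂ) * u ^ 2) • 1 - u • adjOp X hd) (zetaDet q L u) := by
  have h := hL.hasDet_zetaDet isDiagonalUnit_one hq1 hL1 hu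
  rwa [Units.val_one, one_mul, inv_one, Units.val_one, mul_one] at h

theorem hasDet_walkOp (hconn : X.Connected) {d q : ℕ} (hd : ∀ v, X.degree v ≤ d) (hq1 : 1 ≤ q)
    {L : C(realSegment ((q : ℝ) + 1), ℂ) →L[ℂ] ℂ}
    (hL : S.IsSpectralFunctional L (((q : ℂ) + 1) • symmWalkOp X hd))
    (hL1 : L 1 = 1) {u : ℂ} (hu : u ∈ zetaDomain q) :
    S.HasDet ((1 + (q : ℂ) * u ^ 2) • 1 - (((q : ℂ) + 1) * u) • walkOp X hd) (zetaDet q L u) := by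
  obtain ⟨s, hs, hwalk⟩ := exists_walkOp_eq_conj hd fun v => hconn.degree_pos_of_infinite v
  have h := hL.hasDet_zetaDet hs hq1 hL1 hu
  rwa [mul_sub, sub_mul, mul_smul_comm, smul_mul_assoc, mul_one, Units.mul_inv, smul_smul,
    mul_smul_comm, smul_mul_assoc, ← hwalk, mul_comm u] at h

/-- The multiplicities of the prime classes and the Euler product. -/
theorem exists_multiplicity_hasProd {d q : ℕ} (hd : ∀ v, X.degree v ≤ d) (hq1 : 1 ≤ q)
    {L : C(realSegment ((q : ℝ) + 1), ℂ) →L[ℂ] ℂ} (hL : ‖L‖ ≤ 1) {a : ℕ → ℝ}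
    (hLa : ∀ k, L (segmentId ((q : ℝ) + 1) ^ k) = (a k : ℂ))
    (hred : ∀ m, 0 < m → Tendsto (fun n => (seqCount (reducedSeqs X m) (S.K n : Set V) : ℝ)
        / (S.K n).card) atTop
        (𝓝 (((Polynomial.dickson 1 (q : ℝ) m).sum fun k c => c * a k)
          + SimpleGraph.evenTerm q m))) :
    ∃ μ : PrimeClass S → ℝ, (∀ κ : PrimeClass S, κ.HasMultiplicity (μ κ)) ∧
      ∀ u : ℂ, ‖u‖ < 1 / (q : ℝ) →
        HasProd (fun κ : PrimeClass S => (1 - u ^ κ.len) ^ (-(μ κ : ℂ)))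
          (Complex.exp (logZeta q L u)) := by
  obtain ⟨μ, hμ, hμ0, hμp⟩ := exists_multiplicity hd S
  choose! p hp hps using hμp
  refine ⟨μ, hμ, fun u hu => ?_⟩
  have hN : ∀ l, 0 < l → ((Polynomial.dickson 1 (q : ℝ) l).sum fun k c => c * a k)
      + SimpleGraph.evenTerm q l = ∑ k ∈ l.divisors, p k := by
    intro l hl
    refine tendsto_nhds_unique (hred l hl) ?_
    have h : Tendsto (fun n => ∑ k ∈ l.divisors,
        (seqCount (primeSeqs X k) (S.K n : Set V) : ℝ) / (S.K n).card) atTop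
        (𝓝 (∑ k ∈ l.divisors, p k)) :=
      tendsto_finsetSum _ fun k hk => hp k (Nat.pos_of_mem_divisors hk)
    refine h.congr fun n => ?_
    rw [seqCount_reducedSeqs hd hl (Finset.finite_toSet _), Nat.cast_sum, Finset.sum_div]
  have hsum : HasSum (fun l : ℕ+ => u ^ (l : ℕ) / (l : ℕ) *
      ((((Polynomial.dickson 1 (q : ℝ) l).sum fun k c => c * a k)
        + SimpleGraph.evenTerm q l : ℝ) : ℂ)) (logZeta q L u) := by
    have h : HasSum ((fun m : ℕ => u ^ m / m * (L (segmentDickson q m)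
        + (SimpleGraph.evenTerm q m : ℂ))) ∘ ((↑) : ℕ+ → ℕ)) (logZeta q L u) := by
      rw [PNat.coe_injective.hasSum_iff]
      · exact hasSum_logZeta hq1 hL hu
      · intro n hn
        have : n = 0 := by
          by_contra h0
          exact hn ⟨⟨n, Nat.pos_of_ne_zero h0⟩, rfl⟩
        simp [this]
    refine h.congr_fun fun l => ?_
    rw [Function.comp_apply, functional_segmentDickson hLa, Complex.ofReal_add]
  let len : PrimeClass S → ℕ+ := fun κ => ⟨κ.len, κ.len_pos⟩
  refine hasProd_of_hasSum (len := len) (p := fun l => p l) (norm_lt_one_of_lt hq1 hu) hμ0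
    (fun l => ?_) (fun l => ?_) hsum
  · have e : ∀ κ : PrimeClass S, len κ = l ↔ κ.len = l := fun κ =>
      ⟨fun h => congrArg PNat.val h, fun h => PNat.eq h⟩
    exact (Equiv.subtypeEquivRight e).hasSum_iff.2 (hps l l.pos)
  · rw [hN l l.pos, ← Nat.sum_divisorsAntidiagonal fun k _ => p k, ← Finset.sum_coe_sort]
    rfl

end SelfSimilarData

/-! ### The theorem -/

theorem mainTheorem6 {V : Type*} [Infinite V] (X : SimpleGraph V) [X.LocallyFinite]
    (hconn : X.Connected) (d : ℕ) (hd : ∀ v, X.degree v ≤ d) (S : SelfSimilarData X)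
    (q : ℕ) (hq : {v | X.degree v ≠ q + 1}.Finite) :
    -- the average Euler–Poincaré characteristic
    Tendsto (fun n => S.eulerChar n / ((S.K n).card : ℝ)) atTop (𝓝 ((1 - (q : ℝ)) / 2)) ∧
    -- the average multiplicities, the traces of the powers of `P`, the zeta function
    ∃ (μ : PrimeClass S → ℝ) (τ : ℕ → ℂ) (Z : ℂ → ℂ),
      (∀ κ : PrimeClass S, κ.HasMultiplicity (μ κ)) ∧
      (S.CycleSeparated → ∀ c : PrimeCycle X,
        Tendsto (fun n => ((S.copies (c.size S) n).ncard : ℝ) / ((S.K n).card : ℝ)) atTop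
          (𝓝 (μ (c.toClass S)))) ∧
      (∀ k, S.HasTrace (walkOp X hd ^ k) (τ k)) ∧
      (∀ u : ℂ, ‖u‖ < 1 / (q : ℝ) →
        HasProd (fun κ : PrimeClass S => (1 - u ^ κ.len) ^ (-(μ κ : ℂ))) (Z u)) ∧
      -- the determinant formulas
      (∀ u : ℂ, ‖u‖ < 1 / (q : ℝ) → ∃ δ : ℂ,
        S.HasDet ((1 + (q : ℂ) * u ^ 2) • 1 - u • adjOp X hd) δ ∧
        S.HasDet ((1 + (q : ℂ) * u ^ 2) • 1 - (((q : ℂ) + 1) * u) • walkOp X hd) δ ∧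
        Z u = (1 - u ^ 2) ^ ((1 - (q : ℂ)) / 2) * δ⁻¹) ∧
      -- the extension to `Ω` given by the determinant formula
      (∃ F w : ℂ → ℂ,
        DifferentiableOn ℂ w (zetaPowerDomain q) ∧
        (∀ u : ℂ, ‖u‖ < 1 / (q : ℝ) → w u = (1 - u ^ 2) ^ ((1 - (q : ℂ)) / 2)) ∧
        (∀ u ∈ zetaDomain q, ∃ δ : ℂ,
          S.HasDet ((1 + (q : ℂ) * u ^ 2) • 1 - u • adjOp X hd) δ ∧ F u = w u * δ⁻¹) ∧
        DifferentiableOn ℂ F (zetaDomain q) ∧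
        (∀ u ∈ zetaDomain q, F u ≠ 0) ∧
        (∀ u : ℂ, ‖u‖ < 1 / (q : ℝ) → F u = Z u)) ∧
      -- the series for `log Z`
      (∃ L : ℂ → ℂ,
        DifferentiableOn ℂ L (Metric.ball 0 (1 / (q : ℝ))) ∧ L 0 = 0 ∧
        (∀ u : ℂ, ‖u‖ < 1 / (q : ℝ) → Complex.exp (L u) = Z u) ∧
        -- ordered by powers of `u`
        (∀ u : ℂ, ‖u‖ < 1 / (q : ℝ) →
          HasSum (fun m : ℕ => u ^ m * ∑ n ∈ Finset.Icc 1 m,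
            (1 / (n : ℂ)) * ∑ k ∈ (Finset.range (n + 1)).filter (fun k => m + k = 2 * n),
              (n.choose k : ℂ) * ((q : ℂ) + 1) ^ k * (-(q : ℂ)) ^ (n - k) * τ k)
            (L u - (1 - (q : ℂ)) / 2 * Complex.log (1 - u ^ 2))) ∧
        -- ordered by `n`
        (∀ u : ℂ, ((q : ℝ) + 1) * ‖u‖ + (q : ℝ) * ‖u‖ ^ 2 < 1 →
          HasSum (fun n : ℕ => (1 / ((n : ℂ) + 1)) * ∑ k ∈ Finset.range (n + 1 + 1),
            ((n + 1).choose k : ℂ) * ((q : ℂ) + 1) ^ k * (-(q : ℂ)) ^ (n + 1 - k)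
              * u ^ (2 * (n + 1) - k) * τ k)
            (L u - (1 - (q : ℂ)) / 2 * Complex.log (1 - u ^ 2)))) := by
  have hdeg : ∀ v, X.degree v ≤ q + 1 := S.degree_le_of_essentially_regular hq
  have hq1 : 1 ≤ q := one_le_of_essentially_regular hconn hdeg
  refine ⟨S.eulerChar_tendsto hd hq, ?_⟩
  obtain ⟨a, ha0, hacl, hared⟩ := S.exists_walk_density hd hq
  have htr : ∀ k, S.HasTrace (adjOp X hd ^ k) (a k : ℂ) := by
    intro k
    rcases Nat.eq_zero_or_pos k with rfl | hk
    · rw [pow_zero, ha0, Complex.ofReal_one]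
      exact SelfSimilarData.hasTrace_one
    · exact SelfSimilarData.hasTrace_adjOp_pow hd hk (hacl k hk)
  obtain ⟨L, hL, hLa, hLA, hLP⟩ := SelfSimilarData.exists_zeta_functional hconn hd hq htr
  have hL1 : L 1 = 1 := by
    rw [← pow_zero (segmentId ((q : ℝ) + 1)), hLa, ha0, Complex.ofReal_one]
  obtain ⟨μ, hμ, hprod⟩ := SelfSimilarData.exists_multiplicity_hasProd (S := S) hd hq1 hL hLa hared
  have hq0 : (q : ℂ) + 1 ≠ 0 := by exact_mod_cast Nat.succ_ne_zero q
  -- The traces of `P ^ k` are those of `A ^ k` divided by `(q + 1) ^ k`, since the operators differ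
  -- at finitely many basis vectors.
  let τ : ℕ → ℂ := fun k => ((q : ℂ) + 1)⁻¹ ^ k * a k
  have hτ : ∀ k, L (segmentId ((q : ℝ) + 1) ^ k) = ((q : ℂ) + 1) ^ k * τ k := by
    intro k
    rw [hLa, ← mul_assoc, ← mul_pow, mul_inv_cancel₀ hq0, one_pow, one_mul]
  have hτ1 : ∀ k, ‖τ k‖ ≤ 1 := by
    intro k
    have h : ‖(a k : ℂ)‖ ≤ ((q : ℝ) + 1) ^ k := by
      rw [← hLa]
      refine (L.le_opNorm _).trans ((mul_le_of_le_one_left (norm_nonneg _) hL).trans ?_)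
      exact (norm_pow_le _ _).trans
        (pow_le_pow_left₀ (norm_nonneg _) (norm_segmentId_le (by positivity)) k)
    have hn : ‖(q : ℂ) + 1‖ = (q : ℝ) + 1 := by
      rw [← Nat.cast_add_one, Complex.norm_natCast]
      push_cast
      rfl
    rw [norm_mul, norm_pow, norm_inv, hn, inv_pow]
    exact inv_mul_le_one_of_le₀ h (by positivity)
  have hsub : ∀ u : ℂ, logZeta q L u - (1 - (q : ℂ)) / 2 * Complex.log (1 - u ^ 2)
      = ∑' m : ℕ, u ^ m / m * L (segmentDickson q m) := fun u => add_sub_cancel_right _ _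
  refine ⟨μ, τ, fun u => Complex.exp (logZeta q L u), hμ,
    fun hsep c => hsep.tendsto_copies hμ c,
    fun k => SelfSimilarData.hasTrace_walkOp_pow hd hq (htr k), hprod, ?_, ?_, ?_⟩
  · intro u hu
    have hu' := zetaDomain_of_norm_lt hq1 hu
    exact ⟨zetaDet q L u, SelfSimilarData.hasDet_adjOp hd hq1 hLA hL1 hu',
      SelfSimilarData.hasDet_walkOp hconn hd hq1 hLP hL1 hu', exp_logZeta hq1 hu hL1⟩
  -- The exponent `(1 - q)/2` is half an integer, so the power is an integral power of the square
  -- root of `1 - u²`, and only that root has to be continued.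
  · have hw : DifferentiableOn ℂ (fun u => (domainSqrt q u ^ (q - 1))⁻¹) (zetaPowerDomain q) :=
      ((differentiableOn_domainSqrt hq1).pow _).inv fun u _ =>
        pow_ne_zero _ (domainSqrt_ne_zero hq1 u)
    refine ⟨fun u => (domainSqrt q u ^ (q - 1))⁻¹ * (zetaDet q L u)⁻¹,
      fun u => (domainSqrt q u ^ (q - 1))⁻¹, hw, fun u hu => domainSqrt_pow_inv hq1 hu,
      fun u hu => ⟨zetaDet q L u, SelfSimilarData.hasDet_adjOp hd hq1 hLA hL1 hu, rfl⟩,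
      (hw.mono zetaDomain_subset_zetaPowerDomain).mul
        ((differentiableOn_zetaDet hq1 hL1).inv fun u _ => zetaDet_ne_zero L u),
      fun u _ => mul_ne_zero (inv_ne_zero (pow_ne_zero _ (domainSqrt_ne_zero hq1 u)))
        (inv_ne_zero (zetaDet_ne_zero L u)), fun u hu => ?_⟩
    change (domainSqrt q u ^ (q - 1))⁻¹ * (zetaDet q L u)⁻¹ = Complex.exp (logZeta q L u)
    rw [domainSqrt_pow_inv hq1 hu, exp_logZeta hq1 hu hL1]
  · refine ⟨logZeta q L, differentiableOn_logZeta hq1 hL, logZeta_zero, fun _ _ => rfl,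
      fun u hu => ?_, fun u hu => ?_⟩
    · rw [hsub]
      refine (summable_dickson_functional hq1 hL hu).hasSum.congr_fun fun m => ?_
      change u ^ m * momentCoeff q τ m = _
      rw [momentCoeff_eq hq1 hτ hτ1 hL]
      ring
    · rw [hsub]
      exact hasSum_by_degree hq1 hτ hu
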